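/- **Setting.** Let $\hbar>0$. On $L^2(\mathbb R^{3N})$ let $H_N^0=-\sum_{i=1}^N\frac{\hbar^2}{2}\Delta_i$, $W_N=\frac1N\sum_{i<j}w(x_i-x_j)$, $H_N=H^0_N+W_N$ (domain $H^2$), all acting on the bosonic space $\mathcal H^{(N)}=L^2_S(\mathbb R^{3N})$, with $P_S$ the projection onto it. For a bounded operator $b$ on $L^2(\mathbb R^{3m})$ put $$A^{(m)}_N(b)=\frac{N(N-1)\cdots(N-m+1)}{N^m}\,P_S\,(b\otimes I^{(N-m)})\,P_S\quad\text{on }\mathcal H^{(N)}\qquad(=0\text{ if }m>N).$$ Fourier transforms are normalized by $f(z)=\int\widehat f(s)e^{i\langle s,z\rangle}ds$. For $\sigma>0$, $\mathcal A_{\sigma,p}$ is the set of $\tau\in L^1(\mathbb R^{6p})$ with $\|\tau\|_\sigma:=\int|\widehat\tau(s)|e^{\sigma|s|}ds<\infty$, where $|s|=\sum_{j=1}^p(|s_j|+|\varsigma_j|)$ for $s=(s_1,\dots,s_p;\varsigma_1,\dots,\varsigma_p)$. The potential $w:\mathbb R^3\to\mathbb R$ is even, integrable, with $\|w\|_\sigma:=\int_{\mathbb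 R^3}|\widehat w(\eta)|e^{\sigma|\eta|}d\eta<\infty$. The operator $a=a^{(p)}$ on $L^2(\mathbb R^{3p})$ is the Weyl quantization of $\tau$ if it is bounded and, for Schwartz functions $\psi$, $(a\psi)(x)=(2\pi\hbar)^{-3p}\iint\tau(\tfrac{x+y}2,\xi)e^{i\langle x-y,\xi\rangle/\hbar}\psi(y)\,dy\,d\xi$. Write $A_N=A_N^{(p)}(a)$, $A_{t,N}=e^{iH_N^0t/\hbar}A_Ne^{-iH_N^0t/\hbar}$, $w^{ij}_s=e^{iH^0s/\hbar}w(x_i-x_j)e^{-iH^0s/\hbar}$, and define the tree amplitudes on $L^2(\mathbb R^{3(p+n)})$ by $$g^{(0)}=e^{iH_p^0t/\hbar}ae^{-iH^0_pt/\hbar},\qquad g^{(n)}_{t_1,\dots,t_n}=\frac i\hbar\sum_{i=1}^{p+n-1}\big[w^{i\,p+n}_{t_n},\,g^{(n-1)}_{t_1,\dots,t_{n-1}}\otimes I\big].$$ For a bounded operator $X$ on $\mathcal H^{(N)}$ put $\mathcal U_s(X)=e^{iH_Ns/\hbar}e^{-iH_N^0s/\hbar}Xe^{iH_N^0s/\hbar}e^{-iH_Ns/\hbar}$.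 With strong integrals of strongly continuous operator families over $t\ge t_1\ge t_2\ge\cdots\ge 0$, let $$B_n=\int_0^t\!\!\cdots\!\int_0^{t_{n-1}}A_N^{(p+n)}(g^{(n)}_{t_1,\dots,t_n})\,dt_n\cdots dt_1,$$ $$Q_n=\int_0^t\!\!\cdots\!\int_0^{t_{n-1}}\mathcal U_{t_n}\Big(\frac i\hbar\sum_{1\le i<j\le p+n-1}A_N^{(p+n-1)}\big([w^{ij}_{t_n},g^{(n-1)}_{t_1,\dots,t_{n-1}}]\big)\Big)dt_n\cdots dt_1,$$ $$R^{k}=\int_0^t\!\!\cdots\!\int_0^{t_{k-1}}\Big(\mathcal U_{t_k}\big(A_N^{(p+k)}(g^{(k)}_{t_1,\dots,t_k})\big)-A_N^{(p+k)}(g^{(k)}_{t_1,\dots,t_k})\Big)dt_k\cdots dt_1$$ (for $k=0$ there is no integral and $t_0=t$). **Proposition.** Let $p\ge1$, $\sigma>0$ and let $w$ be a potential as above. There are constants $M_1,L_1,M_2,M_3,L_3>0$ (depending only on $p,\sigma,w$; in particular independent of $\hbar$, $t$, $N$ and $a$) such that for all $\hbar>0$, all $t$ with $\epsilon:=\|w\|_\infty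 t>0$, all $N\ge p$, and every $a$ that is the Weyl quantization of a symbol $\tau\in\mathcal A_{\sigma,p}$, with the truncation order $k=k(\epsilon)=\lfloor1/\sqrt\epsilon\rfloor$, the integrals $B_n$, $Q_n$ $(1\le n\le k)$ and $R^k$ define bounded operators on $\mathcal H^{(N)}$ and, with $\Lambda=\sum_{n=1}^kQ_n$, $$e^{iH_Nt/\hbar}A_Ne^{-iH_Nt/\hbar}=A_{t,N}+\sum_{n=1}^kB_n+R^k+\frac{\Lambda}{N},$$ $$\Big\|\sum_{n=1}^kB_n\Big\|\le M_1\|\tau\|_\sigma\sum_{n=1}^kL_1^n\,n!^2(\|w\|_\sigma t)^n,\qquad\|R^k\|\le M_3\|\tau\|_\sigma e^{-L_3/\sqrt\epsilon},\qquad\|\Lambda\|\le M_2\|\tau\|_\sigma\,\epsilon.$$ If $k\ge1$, then also $\|B_k\|\le M_3\|\tau\|_\sigma e^{-L_3/\sqrt\epsilon}$ (so the last tree term may be moved into the remainder). -/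

import Mathlib

open MeasureTheory Complex
open scoped FourierTransform ENNReal SchwartzMap

namespace MeanField

noncomputable section

/-! ### Configuration space, `L²`, bosonic subspace -/

/-- Physical space `ℝ³`. -/
abbrev E3 : Type := EuclideanSpace ℝ (Fin 3)

/-- Configuration space `(ℝ³)^ι` of particles labelled by `ι`; `x (j, c)` is the `c`-th
coordinate of particle `j`. -/
abbrev Conf (ι : Type) [Fintype ι] : Type := EuclideanSpace ℝ (ι × Fin 3)

/-- `L²((ℝ³)^ι; ℂ)`, with Lebesgue measure. -/
abbrev L2 (ι : Type) [Fintype ι] : Type := Lp ℂ 2 (volume : Measure (Conf ι))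

/-- Position of particle `j`. -/
def pos {ι : Type} [Fintype ι] (x : Conf ι) (j : ι) : E3 := WithLp.toLp 2 fun c => x (j, c)

/-- Relabelling of the particles by a permutation, as an isometry of configuration space. -/
def permute {ι : Type} [Fintype ι] (π : Equiv.Perm ι) : Conf ι ≃ₗᵢ[ℝ] Conf ι :=
  LinearIsometryEquiv.piLpCongrLeft 2 ℝ ℝ (π.prodCongr (Equiv.refl (Fin 3)))

/-- Action `ψ ↦ ψ ∘ π` of a permutation on `L²`. -/
def permuteL2 {ι : Type} [Fintype ι] (π : Equiv.Perm ι) : L2 ι →ₗᵢ[ℂ] L2 ι :=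
  Lp.compMeasurePreservingₗᵢ ℂ (permute π) (permute π).measurePreserving

/-- `H^(N) = L²_S(ℝ^{3N})`: the totally symmetric functions in `L²(ℝ^{3N})`. -/
def bosonic (N : ℕ) : Submodule ℂ (L2 (Fin N)) where
  carrier := {ψ | ∀ π : Equiv.Perm (Fin N), permuteL2 π ψ = ψ}
  zero_mem' := fun π => map_zero (permuteL2 π)
  add_mem' := fun {ψ φ} hψ hφ π => by rw [map_add, hψ π, hφ π]
  smul_mem' := fun c ψ hψ π => by rw [map_smul, hψ π]

theorem isClosed_bosonic (N : ℕ) : IsClosed (bosonic N : Set (L2 (Fin N))) := by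
  have h : (bosonic N : Set (L2 (Fin N))) =
      ⋂ π : Equiv.Perm (Fin N), {ψ | permuteL2 π ψ = ψ} := by
    ext ψ
    simp only [Set.mem_iInter]
    exact Iff.rfl
  rw [h]
  exact isClosed_iInter fun π => isClosed_eq (permuteL2 π).continuous continuous_id

instance instCompleteBosonic (N : ℕ) : CompleteSpace (bosonic N) :=
  (isClosed_bosonic N).completeSpace_coe

/-- Operators on `L²(ℝ^{3N})` give operators `P_S T P_S` on the bosonic space; this is just the
restriction of `T` when `T` commutes with the permutations. -/
def onBosons (N : ℕ) (T : L2 (Fin N) →L[ℂ] L2 (Fin N)) : bosonic N →L[ℂ] bosonic N :=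
  (bosonic N).orthogonalProjectionOnto ∘L T ∘L (bosonic N).subtypeL

/-! ### Unitary groups generated by unbounded operators -/

/-- `U` is the strongly continuous unitary group `U t = exp(-i t H / ħ)`: the generator of the
group (with its exact domain) is `-i H / ħ`. -/
structure IsSchrodingerGroup {E : Type} [NormedAddCommGroup E] [InnerProductSpace ℂ E]
    (ħ : ℝ) (H : E →ₗ.[ℂ] E) (U : ℝ → E →L[ℂ] E) : Prop where
  map_zero : U 0 = 1
  map_add : ∀ s t, U (s + t) = U s * U t
  norm_map : ∀ t ψ, ‖U t ψ‖ = ‖ψ‖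
  continuous : ∀ ψ, Continuous fun t => U t ψ
  generator : ∀ ψ φ : E, HasDerivAt (fun t => U t ψ) (-(I / (ħ : ℂ)) • φ) 0 ↔
    ∃ h : ψ ∈ H.domain, H ⟨ψ, h⟩ = φ

open Classical in
/-- `expGroup ħ H t = exp(-i t H / ħ)`, for self-adjoint `H` (Stone's theorem). -/
def expGroup {E : Type} [NormedAddCommGroup E] [InnerProductSpace ℂ E]
    (ħ : ℝ) (H : E →ₗ.[ℂ] E) : ℝ → E →L[ℂ] E :=
  if h : ∃ U, IsSchrodingerGroup ħ H U then h.choose else fun _ => 0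

/-- Conjugation `U(-t) X U(t)`; for `U t = exp(-i t H / ħ)` this is `e^{iHt/ħ} X e^{-iHt/ħ}`. -/
def heisenberg {E : Type} [NormedAddCommGroup E] [InnerProductSpace ℂ E]
    (U : ℝ → E →L[ℂ] E) (t : ℝ) (X : E →L[ℂ] E) : E →L[ℂ] E :=
  U (-t) * X * U t

/-! ### The Hamiltonians -/

/-- `k ↦ |k|² ψ̂(k)`. -/
def sqFourier {ι : Type} [Fintype ι] (ψ : L2 ι) : Conf ι → ℂ :=
  fun k => ((‖k‖ ^ 2 : ℝ) : ℂ) * (Lp.fourierTransformₗᵢ (Conf ι) ℂ ψ) k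

theorem sqFourier_zero {ι : Type} [Fintype ι] :
    sqFourier (0 : L2 ι) =ᵐ[volume] fun _ => 0 := by
  unfold sqFourier
  rw [map_zero]
  filter_upwards [Lp.coeFn_zero ℂ 2 (volume : Measure (Conf ι))] with k hk
  rw [hk, Pi.zero_apply, mul_zero]

theorem sqFourier_add {ι : Type} [Fintype ι] (ψ φ : L2 ι) :
    sqFourier (ψ + φ) =ᵐ[volume] sqFourier ψ + sqFourier φ := by
  unfold sqFourier
  rw [map_add]
  filter_upwards [Lp.coeFn_add (Lp.fourierTransformₗᵢ (Conf ι) ℂ ψ)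
    (Lp.fourierTransformₗᵢ (Conf ι) ℂ φ)] with k hk
  rw [hk, Pi.add_apply, Pi.add_apply, mul_add]

theorem sqFourier_smul {ι : Type} [Fintype ι] (c : ℂ) (ψ : L2 ι) :
    sqFourier (c • ψ) =ᵐ[volume] c • sqFourier ψ := by
  unfold sqFourier
  rw [map_smul]
  filter_upwards [Lp.coeFn_smul c (Lp.fourierTransformₗᵢ (Conf ι) ℂ ψ)] with k hk
  rw [hk, Pi.smul_apply, Pi.smul_apply, smul_eq_mul, smul_eq_mul, mul_left_comm]

/-- The Sobolev space `H²`: those `ψ ∈ L²` with `|k|² ψ̂(k)` in `L²`. -/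
def sobolevTwo (ι : Type) [Fintype ι] : Submodule ℂ (L2 ι) where
  carrier := {ψ | MemLp (sqFourier ψ) 2 volume}
  zero_mem' := (memLp_congr_ae sqFourier_zero).mpr MemLp.zero'
  add_mem' := fun {ψ φ} hψ hφ => (memLp_congr_ae (sqFourier_add ψ φ)).mpr (MemLp.add hψ hφ)
  smul_mem' := fun c ψ hψ => (memLp_congr_ae (sqFourier_smul c ψ)).mpr (MemLp.const_smul hψ c)

theorem memLp_sqFourier {ι : Type} [Fintype ι] (ψ : sobolevTwo ι) :
    MemLp (sqFourier (ψ : L2 ι)) 2 volume := ψ.2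

/-- `H⁰ = -∑ⱼ (ħ²/2) Δⱼ` with domain `H²`: multiplication by `(ħ²/2) |2πk|²` on the Fourier side
(the Fourier kernel being `e^{-2πi k·x}`). -/
def kinetic (ι : Type) [Fintype ι] (ħ : ℝ) : L2 ι →ₗ.[ℂ] L2 ι where
  domain := sobolevTwo ι
  toFun :=
    { toFun := fun ψ => ((ħ ^ 2 / 2 * (2 * Real.pi) ^ 2 : ℝ) : ℂ) •
        (Lp.fourierTransformₗᵢ (Conf ι) ℂ).symm
          (MemLp.toLp (sqFourier (ψ : L2 ι)) (memLp_sqFourier ψ))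
      map_add' := fun ψ φ => by
        rw [← smul_add, ← map_add, ← MemLp.toLp_add]
        congr 2
        exact MemLp.toLp_congr _ _ (sqFourier_add (ψ : L2 ι) (φ : L2 ι))
      map_smul' := fun c ψ => by
        have h : MemLp.toLp (sqFourier ((c • ψ : sobolevTwo ι) : L2 ι)) (memLp_sqFourier (c • ψ)) =
            c • MemLp.toLp (sqFourier (ψ : L2 ι)) (memLp_sqFourier ψ) := by
          rw [← MemLp.toLp_const_smul]
          exact MemLp.toLp_congr _ _ (sqFourier_smul c (ψ : L2 ι))
        rw [h, map_smul, smul_comm, RingHom.id_apply] }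

open Classical in
/-- Multiplication operator on `L²` by an essentially bounded function `V`. -/
def multOp {ι : Type} [Fintype ι] (V : Conf ι → ℂ) : L2 ι →L[ℂ] L2 ι :=
  if h : MemLp V ⊤ volume then
    (ContinuousLinearMap.mul ℂ ℂ).holderL volume ⊤ 2 2 (h.toLp V)
  else 0

/-- `w^{ij}`: multiplication by `w(xᵢ - xⱼ)`. -/
def pairOp {ι : Type} [Fintype ι] (w : E3 → ℝ) (i j : ι) : L2 ι →L[ℂ] L2 ι :=
  multOp fun x => ((w (pos x i - pos x j) : ℝ) : ℂ)

/-- `W_N = (1/N) ∑_{i<j} w(xᵢ - xⱼ)`. -/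
def interaction (N : ℕ) (w : E3 → ℝ) : L2 (Fin N) →L[ℂ] L2 (Fin N) :=
  (1 / (N : ℂ)) • ∑ i : Fin N, ∑ j ∈ Finset.Ioi i, pairOp w i j

/-- `H_N = H_N⁰ + W_N`, with domain `H²`. -/
def hamiltonian (N : ℕ) (ħ : ℝ) (w : E3 → ℝ) : L2 (Fin N) →ₗ.[ℂ] L2 (Fin N) :=
  (interaction N w : L2 (Fin N) →ₗ[ℂ] L2 (Fin N)) +ᵥ kinetic (Fin N) ħ

/-- The free group `e^{-i t H⁰ / ħ}` on `L²((ℝ³)^ι)`. -/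
def freeGroup (ι : Type) [Fintype ι] (ħ : ℝ) : ℝ → L2 ι →L[ℂ] L2 ι :=
  expGroup ħ (kinetic ι ħ)

/-- The free group `e^{-i t H_N⁰ / ħ}` on the bosonic space. -/
def bosonFree (N : ℕ) (ħ : ℝ) (t : ℝ) : bosonic N →L[ℂ] bosonic N :=
  onBosons N (freeGroup (Fin N) ħ t)

/-- The interacting group `e^{-i t H_N / ħ}` on the bosonic space. -/
def bosonFull (N : ℕ) (ħ : ℝ) (w : E3 → ℝ) (t : ℝ) : bosonic N →L[ℂ] bosonic N :=
  onBosons N (expGroup ħ (hamiltonian N ħ w) t)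

/-! ### Observables -/

/-- The first `m` particles of a configuration of `N`. -/
def firstPart {m N : ℕ} (h : m ≤ N) (x : Conf (Fin N)) : Conf (Fin m) :=
  WithLp.toLp 2 fun q => x (Fin.castLE h q.1, q.2)

/-- The remaining `N - m` particles. -/
def restPart (m : ℕ) {N : ℕ} (x : Conf (Fin N)) : Conf {j : Fin N // m ≤ j.val} :=
  WithLp.toLp 2 fun q => x (q.1.1, q.2)

/-- `T = a ⊗ I^{(N-m)}`, characterized by `T (f ⊗ g) = (a f) ⊗ g`. -/
def IsAmpliation {m N : ℕ} (h : m ≤ N) (a : L2 (Fin m) →L[ℂ] L2 (Fin m))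
    (T : L2 (Fin N) →L[ℂ] L2 (Fin N)) : Prop :=
  ∀ (f : L2 (Fin m)) (g : L2 {j : Fin N // m ≤ j.val}) (Ψ : L2 (Fin N)),
    (Ψ =ᵐ[volume] fun x => f (firstPart h x) * g (restPart m x)) →
      T Ψ =ᵐ[volume] fun x => a f (firstPart h x) * g (restPart m x)

open Classical in
/-- The bounded operator `a ⊗ I^{(N-m)}` on `L²(ℝ^{3N})` (it exists, and it is unique because
product functions are total). -/
def ampliation {m N : ℕ} (h : m ≤ N) (a : L2 (Fin m) →L[ℂ] L2 (Fin m)) :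
    L2 (Fin N) →L[ℂ] L2 (Fin N) :=
  if hT : ∃ T, IsAmpliation h a T then hT.choose else 0

/-- `A_N^{(m)}(a) = (N(N-1)⋯(N-m+1)/N^m) P_S (a ⊗ I^{(N-m)}) P_S` on the bosonic space; the
combinatorial factor, hence the operator, is zero if `m > N`. -/
def secondQuant (N m : ℕ) (a : L2 (Fin m) →L[ℂ] L2 (Fin m)) : bosonic N →L[ℂ] bosonic N :=
  if h : m ≤ N then
    ((N.descFactorial m : ℂ) / (N : ℂ) ^ m) • onBosons N (ampliation h a)
  else 0

/-! ### Symbols and Weyl quantization -/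

/-- Phase space `ℝ^{3p} × ℝ^{3p}`. -/
abbrev Phase (p : ℕ) : Type := Conf (Fin p) × Conf (Fin p)

/-- `|s| = ∑ⱼ (|sⱼ| + |σⱼ|)` for `s = (s₁, …, s_p; σ₁, …, σ_p)`. -/
def phaseNorm {p : ℕ} (s : Phase p) : ℝ := ∑ j : Fin p, (‖pos s.1 j‖ + ‖pos s.2 j‖)

/-- Fourier transform on phase space, normalized so that `τ(z) = ∫ τ̂(s) e^{i⟨s,z⟩} ds`. -/
def symbolHat {p : ℕ} (τ : Phase p → ℂ) (s : Phase p) : ℂ :=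
  (((2 * Real.pi) ^ (6 * p))⁻¹ : ℝ) *
    ∫ z : Phase p, Complex.exp (-(I * ((inner ℝ s.1 z.1 + inner ℝ s.2 z.2 : ℝ) : ℂ))) * τ z

/-- The space `𝒜_{σ,p}` of symbols. -/
def IsSymbol {p : ℕ} (σ : ℝ) (τ : Phase p → ℂ) : Prop :=
  Integrable τ ∧ Integrable fun s => (Real.exp (σ * phaseNorm s) : ℂ) * symbolHat τ s

/-- `‖τ‖_σ = ∫ |τ̂(s)| e^{σ|s|} ds`. -/
def symbolNorm {p : ℕ} (σ : ℝ) (τ : Phase p → ℂ) : ℝ :=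
  ∫ s : Phase p, ‖symbolHat τ s‖ * Real.exp (σ * phaseNorm s)

/-- `a` is the Weyl quantization of `τ`: on Schwartz functions,
`(aψ)(x) = (2πħ)^{-3p} ∫∫ τ((x+y)/2, ξ) e^{i⟨x-y,ξ⟩/ħ} ψ(y) dy dξ`. -/
def IsWeylQuantization {p : ℕ} (ħ : ℝ) (τ : Phase p → ℂ)
    (a : L2 (Fin p) →L[ℂ] L2 (Fin p)) : Prop :=
  ∀ ψ : 𝓢(Conf (Fin p), ℂ), a (ψ.toLp 2) =ᵐ[volume] fun x =>
    (((2 * Real.pi * ħ) ^ (3 * p))⁻¹ : ℝ) *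
      ∫ q : Conf (Fin p) × Conf (Fin p),
        τ ((2⁻¹ : ℝ) • (x + q.1), q.2) *
          Complex.exp (I * ((inner ℝ (x - q.1) q.2 / ħ : ℝ) : ℂ)) * ψ q.1

/-- Fourier transform on `ℝ³`, normalized so that `w(x) = ∫ ŵ(η) e^{i⟨η,x⟩} dη`. -/
def potentialHat (w : E3 → ℝ) (η : E3) : ℂ :=
  (((2 * Real.pi) ^ 3)⁻¹ : ℝ) * ∫ x : E3, Complex.exp (-(I * ((inner ℝ η x : ℝ) : ℂ))) * (w x : ℂ)

/-- Two-body potentials of class `𝒜_σ`: real, even, integrable, with `e^{σ|η|} ŵ` integrable. -/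
structure IsPotential (σ : ℝ) (w : E3 → ℝ) : Prop where
  even : ∀ᵐ x, w (-x) = w x
  integrable : Integrable w
  integrable_hat : Integrable fun η => (Real.exp (σ * ‖η‖) : ℂ) * potentialHat w η

/-- `‖w‖_σ = ∫ |ŵ(η)| e^{σ|η|} dη`. -/
def potentialNorm (σ : ℝ) (w : E3 → ℝ) : ℝ :=
  ∫ η : E3, ‖potentialHat w η‖ * Real.exp (σ * ‖η‖)

/-- `‖w‖_∞`. -/
def supNorm (w : E3 → ℝ) : ℝ := lpNorm w ⊤ volume

/-! ### The terms of the expansion -/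

/-- `w^{ij}_s = e^{i s H⁰/ħ} w^{ij} e^{-i s H⁰/ħ}`. -/
def pairAt {ι : Type} [Fintype ι] (ħ : ℝ) (w : E3 → ℝ) (s : ℝ) (i j : ι) : L2 ι →L[ℂ] L2 ι :=
  heisenberg (freeGroup ι ħ) s (pairOp w i j)

/-- Tree amplitudes: `g^{(0;p)} = a_t = e^{itH⁰/ħ} a e^{-itH⁰/ħ}` and
`g^{(n+1;p)}_{t₁,…,t_{n+1}} =
  (i/ħ) ∑_{i ≤ p+n} [w^{i,p+n+1}_{t_{n+1}}, g^{(n;p)}_{t₁,…,t_n} ⊗ I]`. -/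
def tree (ħ : ℝ) (w : E3 → ℝ) (t : ℝ) {p : ℕ} (a : L2 (Fin p) →L[ℂ] L2 (Fin p)) :
    (n : ℕ) → (Fin n → ℝ) → (L2 (Fin (p + n)) →L[ℂ] L2 (Fin (p + n)))
  | 0, _ => heisenberg (freeGroup (Fin p) ħ) t a
  | n + 1, s => (I / (ħ : ℂ)) • ∑ i : Fin (p + n),
      ⁅pairAt ħ w (s (Fin.last n)) (Fin.castSucc i) (Fin.last (p + n)),
        ampliation (Nat.le_succ (p + n)) (tree ħ w t a n (Fin.init s))⁆

/-- `X ↦ e^{isH_N/ħ} e^{-isH_N⁰/ħ} X e^{isH_N⁰/ħ} e^{-isH_N/ħ}`. -/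
def interConj (N : ℕ) (ħ : ℝ) (w : E3 → ℝ) (s : ℝ) (X : bosonic N →L[ℂ] bosonic N) :
    bosonic N →L[ℂ] bosonic N :=
  heisenberg (bosonFull N ħ w) s (heisenberg (bosonFree N ħ) (-s) X)

/-- Integrand `A_N^{(p+n)}(g^{(n;p)}_{t₁,…,t_n})` of the tree terms. -/
def treeTerm (N : ℕ) (ħ : ℝ) (w : E3 → ℝ) (t : ℝ) {p : ℕ}
    (a : L2 (Fin p) →L[ℂ] L2 (Fin p)) (n : ℕ) (s : Fin n → ℝ) : bosonic N →L[ℂ] bosonic N :=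
  secondQuant N (p + n) (tree ħ w t a n s)

/-- Integrand of the loop terms of order `n + 1`:
`(i/ħ) ∑_{i<j≤p+n} A_N^{(p+n)}([w^{ij}_{t_{n+1}}, g^{(n;p)}_{t₁,…,t_n}])`, conjugated by
`e^{i t_{n+1} H_N/ħ} e^{-i t_{n+1} H_N⁰/ħ}`. -/
def loopTerm (N : ℕ) (ħ : ℝ) (w : E3 → ℝ) (t : ℝ) {p : ℕ}
    (a : L2 (Fin p) →L[ℂ] L2 (Fin p)) (n : ℕ) (s : Fin (n + 1) → ℝ) :
    bosonic N →L[ℂ] bosonic N :=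
  interConj N ħ w (s (Fin.last n)) ((I / (ħ : ℂ)) •
    ∑ i : Fin (p + n), ∑ j ∈ Finset.Ioi i,
      secondQuant N (p + n)
        ⁅pairAt ħ w (s (Fin.last n)) i j, tree ħ w t a n (Fin.init s)⁆)

/-- Integrand of the remainder after order `k`: the difference between the `k`-th order tree term
conjugated by `e^{i t_k H_N/ħ} e^{-i t_k H_N⁰/ħ}` and the tree term itself (with `t₀ = t`). -/
def remainderTerm (N : ℕ) (ħ : ℝ) (w : E3 → ℝ) (t : ℝ) {p : ℕ}
    (a : L2 (Fin p) →L[ℂ] L2 (Fin p)) (k : ℕ) (s : Fin k → ℝ) : bosonic N →L[ℂ] bosonic N :=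
  interConj N ħ w ((Fin.cons t s : Fin (k + 1) → ℝ) (Fin.last k)) (treeTerm N ħ w t a k s) -
    treeTerm N ħ w t a k s

/-- `∫₀ᵗ dt₁ ∫₀^{t₁} dt₂ ⋯ ∫₀^{t_{n-1}} dt_n f(t₁, …, t_n)`. -/
def timeIntegral {E : Type} [NormedAddCommGroup E] [NormedSpace ℝ E] :
    (n : ℕ) → ℝ → ((Fin n → ℝ) → E) → E
  | 0, _, f => f Fin.elim0
  | n + 1, t, f => ∫ t₁ in (0 : ℝ)..t, timeIntegral n t₁ fun s => f (Fin.cons t₁ s)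

/-- `T = ∫₀ᵗ ⋯ ∫₀^{t_{n-1}} F(t₁, …, t_n) dt_n ⋯ dt₁` as a strong integral of a strongly continuous
family of operators. -/
def IsTimeIntegral {E : Type} [NormedAddCommGroup E] [NormedSpace ℂ E] (n : ℕ) (t : ℝ)
    (F : (Fin n → ℝ) → E →L[ℂ] E) (T : E →L[ℂ] E) : Prop :=
  ∀ ψ : E, Continuous (fun s => F s ψ) ∧ T ψ = timeIntegral n t fun s => F s ψ

end

end MeanField

open MeanField

/-! The Heisenberg equation is integrated in the interaction picture and iterated. If $W_s$ is the
freely evolved interaction, then $\frac{d}{ds}\mathcal U_s(X)=\mathcal U_s(\frac i\hbar[W_s,X])$,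
and between bosonic states the commutator of $W_s$ with $b\otimes I$, $b$ acting on $m$ particles,
splits exactly. Pairs of outer particles commute with $b\otimes I$. The $N-m$ pairs joining a given
inner particle to an outer one all contribute the same operator, and the factor $(N-m)/N$ promotes
the normalization of $A_N^{(m)}$ to that of $A_N^{(m+1)}$: this is the tree term. Pairs of inner
particles keep a factor $1/N$: this is the loop term. The identity is
`smul_onBosons_commutator_interactionAt`; integrated, it gives $R^n=B_{n+1}+R^{n+1}+Q_{n+1}/N$
(`remainderTerm_apply`), which telescopes (`expansion_succ`).

Bounds uniform in $\hbar$ come from writing operators as superpositions $\int c(z)W(v(z))\,d\mu(z)$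
of Weyl operators, measured by $\int|c|e^{\rho|v|}d\mu$ (`WeylBound`). Weyl quantizations and pair
potentials have this form by Fourier inversion. Ampliation, permutations and free evolution act on
$v$ alone, the last by the shear $(u,q)\mapsto(u,q+tu)$, which does not involve $\hbar$. The
commutator of two Weyl operators is a Weyl operator times $2i\sin(\frac\hbar2\,\cdot)$ of the
symplectic form, so the prefactor $1/\hbar$ is traded for the symplectic form, which is linear in
$|v|$. As $|v|\le\delta^{-1}e^{\delta|v|}$, each commutator costs a factor of order $1/\delta$ and a
loss $\delta$ of weight (`weylBound_sum_commutator`). Spending the available weight in $n$ equal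
portions bounds the amplitude of order $n$ by $(Gn)^n\|\tau\|_\sigma$; the simplex volume $t^n/n!$
turns this into $(K\epsilon)^n\|\tau\|_\sigma$.

The constants do not depend on $t$ because $k\ge1$ forces $\epsilon\le1$, so that
$t\le1/\|w\|_\infty$ and the expansion factor $1+t$ of the flow is controlled. For
$k=\lfloor1/\sqrt\epsilon\rfloor$ one has $k!\,\epsilon^k\le1$, whence $(K\epsilon)^k\le C
e^{-1/\sqrt\epsilon}$ even if $K\epsilon$ is large (`pow_floor_le_exp`); the same device sums the
loop terms to $O(\epsilon)$ (`sum_pow_le_of_lt_floor`). If $k=0$ all sums are empty and the trivial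
bound $2\|\tau\|_\sigma$ on $R^0$ suffices.

No domain questions arise: the interacting group enters only through the vectors
$e^{isH^0/\hbar}e^{-isH/\hbar}\psi$, which for every $\psi$ solve a linear equation with bounded,
strongly continuous coefficients (`IsSchrodingerGroup.hasDerivAt_interaction`). -/

namespace MeanField
noncomputable section

/-! ### Strongly continuous operator families applied to moving vectors. -/

section StrongContinuity

variable {X E F : Type*} [TopologicalSpace X] [NormedAddCommGroup E] [NormedSpace ℂ E]
  [NormedAddCommGroup F] [NormedSpace ℂ F]

/-- A bounded strongly continuous family of operators, applied to a continuous family of vectors,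
is continuous. -/
theorem continuous_clm_apply_of_bounded {T : X → E →L[ℂ] F} {C : ℝ}
    (hT : ∀ ψ, Continuous fun x => T x ψ) (hC : ∀ x, ‖T x‖ ≤ C) {f : X → E} (hf : Continuous f) :
    Continuous fun x => T x (f x) := by
  rw [continuous_iff_continuousAt]
  intro x
  -- Split `T y (f y)` into `T y (f y - f x)`, small by the uniform bound, and `T y (f x)`, handled
  -- by strong continuity.
  have h1 : Filter.Tendsto (fun y => T y (f y - f x)) (nhds x) (nhds 0) := by
    have h0 : Filter.Tendsto (fun y => C * ‖f y - f x‖) (nhds x) (nhds 0) := by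
      have : Continuous fun y => C * ‖f y - f x‖ := by fun_prop
      simpa using this.tendsto x
    refine squeeze_zero_norm (fun y => ?_) h0
    exact (T y).le_of_opNorm_le (hC y) _
  have h2 := h1.add ((hT (f x)).tendsto x)
  simp only [zero_add] at h2
  refine h2.congr fun y => ?_
  rw [map_sub, sub_add_cancel]

/-- Product rule for `T s x(s)` at `t` for a bounded strongly differentiable family. -/
theorem hasDerivAt_clm_apply_of_bounded {T : ℝ → E →L[ℂ] F} {C : ℝ} {t : ℝ} {x : ℝ → E} {x' : E}
    {y : F} (hC : ∀ s, ‖T s‖ ≤ C) (hT : ∀ ψ, Continuous fun s => T s ψ)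
    (hT' : HasDerivAt (fun s => T s (x t)) y t) (hx : HasDerivAt x x' t) :
    HasDerivAt (fun s => T s (x s)) (y + T t x') t := by
  rw [hasDerivAt_iff_tendsto_slope] at *
  have h1 : Filter.Tendsto (fun s => T s (slope x t s - x')) (nhdsWithin t {t}ᶜ) (nhds 0) := by
    have h0 : Filter.Tendsto (fun s => C * ‖slope x t s - x'‖) (nhdsWithin t {t}ᶜ) (nhds 0) := by
      have := ((hx.sub_const x').norm.const_mul C)
      simpa using this
    exact squeeze_zero_norm (fun s => (T s).le_of_opNorm_le (hC s) _) h0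
  have h2 := (hT'.add (((hT x').tendsto t).mono_left nhdsWithin_le_nhds)).add h1
  rw [add_zero] at h2
  refine h2.congr fun s => ?_
  have h3 : ∀ v : E, T s ((s - t)⁻¹ • v) = (s - t)⁻¹ • T s v := fun v => by
    have := (T s).map_smul (((s - t)⁻¹ : ℝ) : ℂ) v
    simpa using this
  simp only [slope, vsub_eq_sub, map_sub, h3, smul_sub]
  abel

end StrongContinuity

/-! ### Dyson series for bounded, strongly continuous linear equations. -/

section LinearFlow

variable {E : Type*} [NormedAddCommGroup E] [NormedSpace ℂ E]

/-- Terms of the Dyson series of `y' = A y`, `y 0 = x`. -/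
def dysonTerm (A : ℝ → E →L[ℂ] E) (x : E) : ℕ → ℝ → E
  | 0, _ => x
  | n + 1, t => ∫ s in (0 : ℝ)..t, A s (dysonTerm A x n s)

variable {A : ℝ → E →L[ℂ] E} {C : ℝ}

theorem continuous_dysonTerm (hA : ∀ ψ, Continuous fun s => A s ψ) (hC : ∀ s, ‖A s‖ ≤ C) (x : E)
    (n : ℕ) : Continuous (dysonTerm A x n) := by
  induction n with
  | zero => exact continuous_const
  | succ n ih =>
    exact intervalIntegral.continuous_primitive
      (fun a b => (continuous_clm_apply_of_bounded hA hC ih).intervalIntegrable a b) 0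

/-- Iterated integration over a simplex produces the factorial, so the series converges on every
bounded interval whatever the size of `C`. Negative times are needed as well, hence `|t|`. -/
theorem norm_dysonTerm_le (hC : ∀ s, ‖A s‖ ≤ C) (x : E) (n : ℕ) (t : ℝ) :
    ‖dysonTerm A x n t‖ ≤ (C * |t|) ^ n / n.factorial * ‖x‖ := by
  have hC0 : 0 ≤ C := (norm_nonneg _).trans (hC 0)
  induction n generalizing t with
  | zero => simp [dysonTerm]
  | succ n ih =>
    have key : ∀ s, ‖A s (dysonTerm A x n s)‖ ≤ C ^ (n + 1) / n.factorial * ‖x‖ * |s| ^ n := by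
      intro s
      calc _ ≤ C * ((C * |s|) ^ n / n.factorial * ‖x‖) := by
            exact ((A s).le_of_opNorm_le (hC s) _).trans (by gcongr; exact ih s)
        _ = _ := by rw [mul_pow, pow_succ]; ring
    rw [dysonTerm]
    calc _ ≤ |∫ s in (0 : ℝ)..t, C ^ (n + 1) / n.factorial * ‖x‖ * |s| ^ n| := by
          refine intervalIntegral.norm_integral_le_abs_of_norm_le (Filter.Eventually.of_forall
            key) ?_
          exact Continuous.intervalIntegrable (by fun_prop) _ _
      _ = _ := by
          rw [intervalIntegral.integral_const_mul, abs_mul]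
          have : |∫ s in (0 : ℝ)..t, |s| ^ n| = |t| ^ (n + 1) / (n + 1) := by
            rcases le_total 0 t with h | h
            · have : ∫ s in (0 : ℝ)..t, |s| ^ n = ∫ s in (0 : ℝ)..t, s ^ n := by
                refine intervalIntegral.integral_congr fun s hs => ?_
                rw [Set.uIcc_of_le h] at hs
                simp [abs_of_nonneg hs.1]
              rw [this, integral_pow]
              simp [abs_of_nonneg h, abs_of_nonneg (by positivity : (0 : ℝ) ≤ n + 1), abs_div]
            · have : ∫ s in (0 : ℝ)..t, |s| ^ n = - ∫ s in (0 : ℝ)..(-t), s ^ n := by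
                have h2 : ∫ s in (0 : ℝ)..t, |s| ^ n = ∫ s in (0 : ℝ)..t, (-s) ^ n := by
                  refine intervalIntegral.integral_congr fun s hs => ?_
                  rw [Set.uIcc_of_ge h] at hs
                  simp [abs_of_nonpos hs.2]
                rw [h2, intervalIntegral.integral_comp_neg (fun s => s ^ n), neg_zero,
                  intervalIntegral.integral_symm]
              rw [this, integral_pow, abs_neg]
              simp [abs_of_nonpos h, abs_of_nonneg (by positivity : (0 : ℝ) ≤ n + 1), abs_div]
          rw [this, abs_of_nonneg (by positivity), Nat.factorial_succ, mul_pow]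
          push_cast
          field_simp

/-- A bounded strongly continuous linear ordinary differential equation has global solutions. -/
theorem exists_linear_flow [CompleteSpace E] (hA : ∀ ψ, Continuous fun s => A s ψ)
    (hC : ∀ s, ‖A s‖ ≤ C) (x : E) :
    ∃ y : ℝ → E, y 0 = x ∧ ∀ t, HasDerivAt y (A t (y t)) t := by
  have hC0 : 0 ≤ C := (norm_nonneg _).trans (hC 0)
  have hsum : ∀ t, Summable fun n => dysonTerm A x n t := fun t =>
    Summable.of_norm_bounded ((Real.summable_pow_div_factorial (C * |t|)).mul_right ‖x‖)
      fun n => norm_dysonTerm_le hC x n t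
  have hder : ∀ n t, HasDerivAt (dysonTerm A x (n + 1)) (A t (dysonTerm A x n t)) t := fun n t =>
    (continuous_clm_apply_of_bounded hA hC (continuous_dysonTerm hA hC x n)).integral_hasStrictDerivAt
      0 t |>.hasDerivAt
  have hzero : ∀ n, dysonTerm A x (n + 1) 0 = 0 := fun n => by
    rw [dysonTerm, intervalIntegral.integral_same]
  -- The constant zeroth term is kept apart, so that differentiating the remaining series term by
  -- term reproduces `A t` applied to the full series.
  refine ⟨fun t => x + ∑' n, dysonTerm A x (n + 1) t, by simp [hzero], fun t => ?_⟩
  set R : ℝ := |t| + 1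
  have hbd : ∀ n, ∀ s ∈ Set.Ioo (-R) R, ‖A s (dysonTerm A x n s)‖ ≤
      C * ((C * R) ^ n / n.factorial * ‖x‖) := by
    intro n s hs
    refine ((A s).le_of_opNorm_le (hC s) _).trans ?_
    gcongr
    refine (norm_dysonTerm_le hC x n s).trans ?_
    gcongr
    exact (abs_lt.mpr hs).le
  have h := hasDerivAt_tsum_of_isPreconnected
    (((Real.summable_pow_div_factorial (C * R)).mul_right ‖x‖).mul_left C) isOpen_Ioo
    isPreconnected_Ioo (fun n s _ => hder n s) hbd
    (y₀ := 0) ⟨by linarith [abs_nonneg t], by linarith [abs_nonneg t]⟩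
    (by simp only [hzero]; exact summable_zero)
    (y := t) ⟨by linarith [neg_abs_le t], by linarith [le_abs_self t]⟩
  have h2 : A t (x + ∑' n, dysonTerm A x (n + 1) t) = ∑' n, A t (dysonTerm A x n t) := by
    rw [← (A t).map_tsum (hsum t), (hsum t).tsum_eq_zero_add]
    rfl
  rw [h2]
  exact h.const_add x

end LinearFlow

/-! ### Unitary groups, their generators and bounded perturbations. -/

section Groups

variable {E : Type} [NormedAddCommGroup E] [InnerProductSpace ℂ E]

/-- Two solutions of `y' = A y` with skew-adjoint `A` keep their inner product. -/
theorem inner_eq_of_skew_flow {A : ℝ → E →L[ℂ] E}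
    (hskew : ∀ t x y, inner ℂ (A t x) y = -inner ℂ x (A t y)) {y z : ℝ → E}
    (hy : ∀ t, HasDerivAt y (A t (y t)) t) (hz : ∀ t, HasDerivAt z (A t (z t)) t) (t : ℝ) :
    inner ℂ (y t) (z t) = inner ℂ (y 0) (z 0) := by
  have h : ∀ s, HasDerivAt (fun s => inner ℂ (y s) (z s)) 0 s := fun s => by
    have := (hy s).inner ℂ (hz s)
    rwa [hskew, add_neg_cancel] at this
  exact is_const_of_deriv_eq_zero (fun s => (h s).differentiableAt) (fun s => (h s).deriv) t 0

/-- The difference of two solutions is again a solution, hence has constant norm, and it starts at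
zero. -/
theorem eq_of_skew_flow {A : ℝ → E →L[ℂ] E}
    (hskew : ∀ t x y, inner ℂ (A t x) y = -inner ℂ x (A t y)) {y z : ℝ → E}
    (hy : ∀ t, HasDerivAt y (A t (y t)) t) (hz : ∀ t, HasDerivAt z (A t (z t)) t)
    (h0 : y 0 = z 0) (t : ℝ) : y t = z t := by
  have h : ∀ s, HasDerivAt (fun s => y s - z s) (A s (y s - z s)) s := fun s => by
    rw [map_sub]; exact (hy s).sub (hz s)
  have := inner_eq_of_skew_flow hskew h h t
  simp only [h0, sub_self, inner_zero_left] at this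
  exact sub_eq_zero.mp (inner_self_eq_zero.mp this)

variable {ħ : ℝ} {H : E →ₗ.[ℂ] E} {U U' : ℝ → E →L[ℂ] E}

theorem expGroup_spec (h : ∃ U, IsSchrodingerGroup ħ H U) :
    IsSchrodingerGroup ħ H (expGroup ħ H) := by
  unfold expGroup
  rw [dif_pos h]
  exact h.choose_spec

namespace IsSchrodingerGroup

theorem opNorm_le (hU : IsSchrodingerGroup ħ H U) (t : ℝ) : ‖U t‖ ≤ 1 :=
  ContinuousLinearMap.opNorm_le_bound _ zero_le_one fun x => by rw [hU.norm_map, one_mul]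

theorem neg_mul_self (hU : IsSchrodingerGroup ħ H U) (t : ℝ) : U (-t) * U t = 1 := by
  rw [← hU.map_add (-t) t, neg_add_cancel, hU.map_zero]

theorem self_mul_neg (hU : IsSchrodingerGroup ħ H U) (t : ℝ) : U t * U (-t) = 1 := by
  rw [← hU.map_add t (-t), add_neg_cancel, hU.map_zero]

theorem neg_apply_self (hU : IsSchrodingerGroup ħ H U) (t : ℝ) (x : E) : U (-t) (U t x) = x :=
  congrArg (fun T : E →L[ℂ] E => T x) (hU.neg_mul_self t)

theorem self_apply_neg (hU : IsSchrodingerGroup ħ H U) (t : ℝ) (x : E) : U t (U (-t) x) = x :=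
  congrArg (fun T : E →L[ℂ] E => T x) (hU.self_mul_neg t)

theorem add_apply (hU : IsSchrodingerGroup ħ H U) (s t : ℝ) (x : E) :
    U (s + t) x = U s (U t x) :=
  congrArg (fun T : E →L[ℂ] E => T x) (hU.map_add s t)

theorem inner_map (hU : IsSchrodingerGroup ħ H U) (t : ℝ) (x y : E) :
    inner ℂ (U t x) (U t y) = inner ℂ x y :=
  LinearIsometry.inner_map_map ⟨(U t : E →ₗ[ℂ] E), hU.norm_map t⟩ x y

theorem inner_left (hU : IsSchrodingerGroup ħ H U) (t : ℝ) (x y : E) :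
    inner ℂ (U t x) y = inner ℂ x (U (-t) y) := by
  rw [← hU.inner_map t x (U (-t) y), hU.self_apply_neg]

theorem hasDerivAt_of_mem (hU : IsSchrodingerGroup ħ H U) {ψ : E} (h : ψ ∈ H.domain) (t : ℝ) :
    HasDerivAt (fun s => U s ψ) (U t (-(I / (ħ : ℂ)) • H ⟨ψ, h⟩)) t := by
  have h0 := (hU.generator ψ (H ⟨ψ, h⟩)).mpr ⟨h, rfl⟩
  have h1 : HasDerivAt (fun s => U (s - t) ψ) (-(I / (ħ : ℂ)) • H ⟨ψ, h⟩) t :=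
    HasDerivAt.comp_sub_const t t (by rwa [sub_self])
  have h2 := ((U t).restrictScalars ℝ).hasFDerivAt.comp_hasDerivAt t h1
  refine h2.congr_of_eventuallyEq (Filter.Eventually.of_forall fun s => ?_)
  simp only [Function.comp, ContinuousLinearMap.coe_restrictScalars', ← hU.add_apply]
  congr 2; ring

/-- The difference quotients of `U s (U t ψ)` at `s = 0` are the images under `U t` of those of `U s
ψ`, and `generator` decides membership in the domain by the existence of their limit. -/
theorem map_mem (hU : IsSchrodingerGroup ħ H U) {ψ : E} (h : ψ ∈ H.domain) (t : ℝ) :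
    ∃ h' : U t ψ ∈ H.domain, H ⟨U t ψ, h'⟩ = U t (H ⟨ψ, h⟩) := by
  rw [← hU.generator, ← map_smul]
  have h0 := (hU.generator ψ (H ⟨ψ, h⟩)).mpr ⟨h, rfl⟩
  have h2 := ((U t).restrictScalars ℝ).hasFDerivAt.comp_hasDerivAt 0 h0
  refine h2.congr_of_eventuallyEq (Filter.Eventually.of_forall fun s => ?_)
  simp only [Function.comp, ContinuousLinearMap.coe_restrictScalars', ← hU.add_apply]
  congr 2; ring

/-- The time averages `r⁻¹ ∫₀ʳ U s ψ ds` lie in the domain, since applying `U t` only shifts the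
interval of integration, and they tend to `ψ` as `r → 0`. -/
theorem dense_domain [CompleteSpace E] (hU : IsSchrodingerGroup ħ H U) (hħ : ħ ≠ 0) :
    Dense (H.domain : Set E) := by
  intro ψ
  have hint : ∀ a b, IntervalIntegrable (fun s => U s ψ) volume a b := fun a b =>
    (hU.continuous ψ).intervalIntegrable a b
  have hmem : ∀ r : ℝ, (r⁻¹ • ∫ s in (0 : ℝ)..r, U s ψ) ∈ H.domain := by
    intro r
    have h1 : ∀ t, U t (∫ s in (0 : ℝ)..r, U s ψ) =
        (∫ s in (0 : ℝ)..(t + r), U s ψ) - ∫ s in (0 : ℝ)..t, U s ψ := by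
      intro t
      rw [← ContinuousLinearMap.intervalIntegral_comp_comm _ (hint 0 r)]
      simp only [← hU.add_apply]
      rw [intervalIntegral.integral_comp_add_left (fun s => U s ψ) t, add_zero,
        intervalIntegral.integral_interval_sub_left (hint _ _) (hint _ _)]
    have h2 : HasDerivAt (fun t => U t (∫ s in (0 : ℝ)..r, U s ψ)) (U r ψ - U 0 ψ) 0 := by
      simp only [h1]
      have ha := ((hU.continuous ψ).integral_hasStrictDerivAt 0 r).hasDerivAt
      have hb := ((hU.continuous ψ).integral_hasStrictDerivAt 0 0).hasDerivAt
      refine HasDerivAt.sub ?_ hb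
      exact HasDerivAt.comp_add_const 0 r (by rwa [zero_add])
    have h3 : (∫ s in (0 : ℝ)..r, U s ψ) ∈ H.domain := by
      have hI : (I / (ħ : ℂ)) ≠ 0 := div_ne_zero I_ne_zero (by exact_mod_cast hħ)
      have := (hU.generator (∫ s in (0 : ℝ)..r, U s ψ)
        ((-(I / (ħ : ℂ)))⁻¹ • (U r ψ - U 0 ψ))).mp (by
          rwa [smul_smul, mul_inv_cancel₀ (neg_ne_zero.mpr hI), one_smul])
      exact this.1
    have := H.domain.smul_mem ((r⁻¹ : ℝ) : ℂ) h3
    rwa [Complex.coe_smul] at this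
  have hlim : Filter.Tendsto (fun r : ℝ => r⁻¹ • ∫ s in (0 : ℝ)..r, U s ψ)
      (nhdsWithin 0 {0}ᶜ) (nhds ψ) := by
    have ha := ((hU.continuous ψ).integral_hasStrictDerivAt 0 0).hasDerivAt
    rw [hasDerivAt_iff_tendsto_slope, hU.map_zero] at ha
    refine ha.congr fun r => ?_
    simp [slope]
  exact mem_closure_of_tendsto hlim (Filter.Eventually.of_forall hmem)

/-- A unitary group is determined by its generator. -/
theorem unique [CompleteSpace E] (hU : IsSchrodingerGroup ħ H U) (hU' : IsSchrodingerGroup ħ H U')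
    (hħ : ħ ≠ 0) : U = U' := by
  funext t
  refine ContinuousLinearMap.ext_on (hU.dense_domain hħ |>.mono fun ψ hψ =>
    Submodule.subset_span hψ) fun ψ hψ => ?_
  -- On the domain, `U' (-s) (U s ψ)` is constant in `s`, the two generator contributions
  -- cancelling; density of the domain extends the equality to all vectors.
  have key : ∀ s, HasDerivAt (fun s => U' (-s) (U s ψ)) 0 s := by
    intro s
    obtain ⟨h', hH⟩ := hU.map_mem hψ s
    have h1 := hU'.hasDerivAt_of_mem h' (-s)
    have h2 : HasDerivAt (fun r => U' (-r) (U s ψ))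
        (-(U' (-s) (-(I / (ħ : ℂ)) • H ⟨U s ψ, h'⟩))) s := by
      have := h1.scomp s (hasDerivAt_neg s)
      simpa [Function.comp_def] using this
    have h3 := hasDerivAt_clm_apply_of_bounded (T := fun r => U' (-r)) (C := 1)
      (fun r => hU'.opNorm_le _) (fun ψ => (hU'.continuous ψ).comp continuous_neg) h2
      (hU.hasDerivAt_of_mem hψ s)
    rwa [hH, ← map_smul, neg_add_cancel] at h3
  have := is_const_of_deriv_eq_zero (fun s => (key s).differentiableAt) (fun s => (key s).deriv) t 0
  simp only [neg_zero, hU.map_zero, hU'.map_zero, one_apply_eq_self] at this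
  rw [← hU'.self_apply_neg t (U t ψ), this]

end IsSchrodingerGroup

/-! ### Bounded perturbations -/

/-- The generator of the interaction picture evolution. -/
def interactionGen (ħ : ℝ) (U : ℝ → E →L[ℂ] E) (W : E →L[ℂ] E) (t : ℝ) : E →L[ℂ] E :=
  -(I / (ħ : ℂ)) • heisenberg U t W

variable {W : E →L[ℂ] E}

theorem interactionGen_apply (t : ℝ) (x : E) :
    interactionGen ħ U W t x = -(I / (ħ : ℂ)) • U (-t) (W (U t x)) := rfl

theorem heisenberg_apply (t : ℝ) (X : E →L[ℂ] E) (x : E) :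
    heisenberg U t X x = U (-t) (X (U t x)) := rfl

theorem IsSchrodingerGroup.norm_heisenberg_le (hU : IsSchrodingerGroup ħ H U) (t : ℝ)
    (X : E →L[ℂ] E) : ‖heisenberg U t X‖ ≤ ‖X‖ :=
  ContinuousLinearMap.opNorm_le_bound _ (norm_nonneg _) fun x => by
    rw [heisenberg_apply, hU.norm_map]
    exact (X.le_opNorm _).trans (by rw [hU.norm_map])

theorem IsSchrodingerGroup.continuous_heisenberg (hU : IsSchrodingerGroup ħ H U)
    (X : E →L[ℂ] E) (x : E) : Continuous fun t => heisenberg U t X x :=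
  continuous_clm_apply_of_bounded (T := fun t => U (-t)) (C := 1)
    (fun ψ => (hU.continuous ψ).comp continuous_neg) (fun t => hU.opNorm_le _)
    (X.continuous.comp (hU.continuous x))

theorem norm_interactionGen_le (hU : IsSchrodingerGroup ħ H U) (t : ℝ) :
    ‖interactionGen ħ U W t‖ ≤ ‖-(I / (ħ : ℂ))‖ * ‖W‖ := by
  rw [interactionGen, norm_smul]
  gcongr
  exact hU.norm_heisenberg_le t W

theorem continuous_interactionGen (hU : IsSchrodingerGroup ħ H U) (x : E) :
    Continuous fun t => interactionGen ħ U W t x :=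
  (hU.continuous_heisenberg W x).const_smul _

/-- The factor `-i/ħ` turns the symmetric operator `U (-t) W U t` into a skew one. This makes the
interaction picture flow isometric and its solutions unique. -/
theorem interactionGen_skew (hU : IsSchrodingerGroup ħ H U)
    (hW : ∀ x y, inner ℂ (W x) y = inner ℂ x (W y)) (t : ℝ) (x y : E) :
    inner ℂ (interactionGen ħ U W t x) y = -inner ℂ x (interactionGen ħ U W t y) := by
  simp only [interactionGen, smul_apply, inner_smul_left, inner_smul_right,
    heisenberg_apply]
  rw [hU.inner_left, neg_neg, hW, ← neg_neg t, ← hU.inner_left, neg_neg]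
  simp [div_eq_mul_inv]

/-- Bounded symmetric perturbations of generators of unitary groups generate unitary groups. -/
theorem IsSchrodingerGroup.exists_perturbation [CompleteSpace E] (hU : IsSchrodingerGroup ħ H U)
    (hW : ∀ x y, inner ℂ (W x) y = inner ℂ x (W y)) :
    ∃ V : ℝ → E →L[ℂ] E, IsSchrodingerGroup ħ ((W : E →ₗ[ℂ] E) +ᵥ H) (fun t => U t * V t) ∧
      (∀ ψ, V 0 ψ = ψ) ∧ ∀ ψ t, HasDerivAt (fun t => V t ψ) (interactionGen ħ U W t (V t ψ)) t := by
  have hskew := interactionGen_skew hU hW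
  choose y hy0 hy using exists_linear_flow (continuous_interactionGen (W := W) hU)
    (norm_interactionGen_le hU)
  have huniq : ∀ {x : E} {z : ℝ → E}, (∀ t, HasDerivAt z (interactionGen ħ U W t (z t)) t) →
      z 0 = x → ∀ t, y x t = z t := fun {x z} hz h0 t =>
    eq_of_skew_flow hskew (hy x) hz ((hy0 x).trans h0.symm) t
  have hnorm : ∀ x t, ‖y x t‖ = ‖x‖ := fun x t => by
    have := inner_eq_of_skew_flow hskew (hy x) (hy x) t
    rw [hy0, inner_self_eq_norm_sq_to_K, inner_self_eq_norm_sq_to_K] at this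
    have h2 : ‖y x t‖ ^ 2 = ‖x‖ ^ 2 := by exact_mod_cast this
    exact (pow_left_inj₀ (norm_nonneg _) (norm_nonneg _) two_ne_zero).mp h2
  -- Linearity of the solution map is uniqueness applied to sums and multiples of solutions.
  let V : ℝ → E →L[ℂ] E := fun t => LinearMap.mkContinuous
    { toFun := fun x => y x t
      map_add' := fun x x' => huniq (z := fun t => y x t + y x' t)
        (fun t => by rw [_root_.map_add]; exact (hy x t).add (hy x' t)) (by simp [hy0]) t
      map_smul' := fun c x => huniq (z := fun t => c • y x t)
        (fun t => by rw [map_smul]; exact (hy x t).const_smul c) (by simp [hy0]) t }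
    1 (fun x => by simp [hnorm])
  have hV : ∀ t x, V t x = y x t := fun t x => rfl
  refine ⟨V, ?_, fun ψ => by rw [hV, hy0], fun ψ t => by simp only [hV]; exact hy ψ t⟩
  have hVd : ∀ ψ t, HasDerivAt (fun t => V t ψ) (interactionGen ħ U W t (V t ψ)) t := hy
  refine ⟨?_, fun s t => ?_, fun t ψ => ?_, fun ψ => ?_, fun ψ φ => ?_⟩
  · ext x; simp [hU.map_zero, hV, hy0]
  · ext x
    -- Conjugation by `U t` shifts the time in the generator, so `r ↦ U t (V (r + t) x)` solves the
    -- unshifted equation. Uniqueness then gives the group law.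
    have hz : ∀ r, HasDerivAt (fun r => U t (V (r + t) x))
        (interactionGen ħ U W r (U t (V (r + t) x))) r := by
      intro r
      have h1 : HasDerivAt (fun r => V (r + t) x)
        (interactionGen ħ U W (r + t) (V (r + t) x)) r := (hVd x (r + t)).comp_add_const r t
      have h2 := ((U t).restrictScalars ℝ).hasFDerivAt.comp_hasDerivAt r h1
      have e : interactionGen ħ U W r (U t (V (r + t) x)) =
          U t (interactionGen ħ U W (r + t) (V (r + t) x)) := by
        rw [interactionGen_apply, interactionGen_apply, map_smul, ← hU.add_apply, ← hU.add_apply,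
          neg_add_rev, add_neg_cancel_left]
      rw [e]
      exact h2
    have h := huniq hz (x := U t (V t x)) (by simp) s
    simp only [mul_apply_eq_comp, hV] at h ⊢
    rw [h, ← hU.add_apply]
  · simp [hU.norm_map, hV, hnorm]
  · exact continuous_clm_apply_of_bounded hU.continuous hU.opNorm_le
      (continuous_iff_continuousAt.mpr fun t => (hVd ψ t).continuousAt)
  -- For every `ψ` the perturbed and the free orbit differ by a differentiable function, so both are
  -- differentiable at `0` for the same `ψ`, and the derivatives differ by `-(i/ħ) W ψ`. Hence the
  -- domain is unchanged.
  · have hdiff : HasDerivAt (fun t => U t (V t ψ) - U t ψ) (-(I / (ħ : ℂ)) • W ψ) 0 := by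
      have h1 : HasDerivAt (fun t => V t ψ - ψ) (-(I / (ħ : ℂ)) • W ψ) 0 := by
        have := (hVd ψ 0).sub_const ψ
        simpa [interactionGen, heisenberg_apply, hU.map_zero, hV, hy0] using this
      have h2 := hasDerivAt_clm_apply_of_bounded (T := U) (C := 1) (t := 0)
        (x := fun t => V t ψ - ψ) (y := 0) hU.opNorm_le hU.continuous
        (by simpa [hV, hy0] using hasDerivAt_const (0 : ℝ) (0 : E)) h1
      simpa [hU.map_zero] using h2
    have hiff : HasDerivAt (fun t => (U t * V t) ψ) (-(I / (ħ : ℂ)) • φ) 0 ↔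
        HasDerivAt (fun t => U t ψ) (-(I / (ħ : ℂ)) • (φ - W ψ)) 0 := by
      constructor
      · intro h
        have := h.sub hdiff
        rw [← smul_sub] at this
        simpa [Pi.sub_def] using this
      · intro h
        have := h.add hdiff
        rw [← smul_add, sub_add_cancel] at this
        simpa [Pi.add_def] using this
    rw [hiff, hU.generator]
    constructor
    · rintro ⟨h, e⟩
      refine ⟨h, ?_⟩
      rw [LinearPMap.coe_vadd]
      simp [e]
    · rintro ⟨h, e⟩
      refine ⟨h, ?_⟩
      rw [LinearPMap.coe_vadd] at e
      simp at e
      rw [← e, add_sub_cancel_left]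

/-- The interaction picture evolution `e^{itH/ħ} e^{-it(H+W)/ħ}` of a perturbed group solves a
bounded differential equation. -/
theorem IsSchrodingerGroup.hasDerivAt_interaction [CompleteSpace E] (hU : IsSchrodingerGroup ħ H U)
    (hW : ∀ x y, inner ℂ (W x) y = inner ℂ x (W y))
    (hU' : IsSchrodingerGroup ħ ((W : E →ₗ[ℂ] E) +ᵥ H) U') (hħ : ħ ≠ 0) (ψ : E) (t : ℝ) :
    HasDerivAt (fun t => U (-t) (U' t ψ)) (interactionGen ħ U W t (U (-t) (U' t ψ))) t := by
  obtain ⟨V, hV, -, hd⟩ := hU.exists_perturbation hW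
  obtain rfl := hU'.unique hV hħ
  have : ∀ t, U (-t) ((U t * V t) ψ) = V t ψ := fun t => hU.neg_apply_self t _
  simp only [this]
  exact hd ψ t

end Groups


/-! ### Comparison of the two real scalar multiplications on complex `L²`. -/

section RealStructures

theorem hasDerivAt_iff_tendsto_smul {E : Type*} [NormedAddCommGroup E] [NormedSpace ℝ E]
    {f : ℝ → E} {f' : E} {x : ℝ} {mul : ℝ → E → E} (h : ∀ r v, r • v = mul r v) :
    HasDerivAt f f' x ↔
      Filter.Tendsto (fun t => mul (t - x)⁻¹ (f t - f x)) (nhdsWithin x {x}ᶜ) (nhds f') := by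
  rw [hasDerivAt_iff_tendsto_slope]
  refine Filter.tendsto_congr fun t => ?_
  rw [← h]; rfl

/-- Differentiability with respect to the real structure induced by the complex one. -/
abbrev HasComplexDerivAt {E : Type} [NormedAddCommGroup E] [InnerProductSpace ℂ E] (f : ℝ → E)
    (f' : E) (x : ℝ) : Prop := HasDerivAt f f' x

theorem hasComplexDerivAt_iff {E : Type} [NormedAddCommGroup E] [InnerProductSpace ℂ E]
    {f : ℝ → E} {f' : E} {x : ℝ} : HasComplexDerivAt f f' x ↔
      Filter.Tendsto (fun t => (((t - x)⁻¹ : ℝ) : ℂ) • (f t - f x)) (nhdsWithin x {x}ᶜ)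
        (nhds f') :=
  hasDerivAt_iff_tendsto_smul fun _ _ => rfl

/-- Differentiability in `L²` does not depend on the choice of the real structure. -/
theorem hasDerivAt_complexToReal_iff {ι : Type} [Fintype ι] {f : ℝ → L2 ι} {f' : L2 ι} {x : ℝ} :
    HasComplexDerivAt f f' x ↔ HasDerivAt f f' x := by
  refine hasComplexDerivAt_iff.trans
    (hasDerivAt_iff_tendsto_smul (mul := fun r v => (r : ℂ) • v) fun r v => ?_).symm
  refine Lp.ext ?_
  filter_upwards [Lp.coeFn_smul r v, Lp.coeFn_smul (r : ℂ) v] with k h1 h2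
  rw [h1, h2]; simp

end RealStructures

/-! ### Norm and dominated convergence in `L²`. -/

section Lebesgue

variable {α : Type*} [MeasurableSpace α] {μ : Measure α}

theorem norm_sq_eq_integral (f : Lp ℂ 2 μ) : ‖f‖ ^ 2 = ∫ x, ‖f x‖ ^ 2 ∂μ := by
  have h : (inner ℂ f f : ℂ) = ((∫ x, ‖f x‖ ^ 2 ∂μ : ℝ) : ℂ) := by
    rw [L2.inner_def, ← integral_complex_ofReal]
    refine integral_congr_ae (Filter.Eventually.of_forall fun x => ?_)
    simp only [inner_self_eq_norm_sq_to_K]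
    push_cast; rfl
  rw [inner_self_eq_norm_sq_to_K] at h
  apply Complex.ofReal_injective
  rw [← h]; push_cast; rfl

theorem integrable_norm_sq (f : Lp ℂ 2 μ) : Integrable (fun x => ‖f x‖ ^ 2) μ :=
  (Lp.memLp f).integrable_norm_pow two_ne_zero

/-- Dominated convergence in `L²`. -/
theorem tendsto_L2_of_dominated {β : Type*} {l : Filter β} [l.IsCountablyGenerated] [l.NeBot]
    {F : β → Lp ℂ 2 μ} {f g : Lp ℂ 2 μ} {C : ℝ} (hF : ∀ n, ∀ᵐ x ∂μ, ‖F n x‖ ≤ C * ‖g x‖)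
    (hlim : ∀ᵐ x ∂μ, Filter.Tendsto (fun n => F n x) l (nhds (f x)))
    (hf : ∀ᵐ x ∂μ, ‖f x‖ ≤ C * ‖g x‖) :
    Filter.Tendsto F l (nhds f) := by
  rw [tendsto_iff_norm_sub_tendsto_zero]
  have h : Filter.Tendsto (fun n => ‖F n - f‖ ^ 2) l (nhds 0) := by
    have h2 : ∀ n, ‖F n - f‖ ^ 2 = ∫ x, ‖F n x - f x‖ ^ 2 ∂μ := fun n => by
      rw [norm_sq_eq_integral]
      refine integral_congr_ae ?_
      filter_upwards [Lp.coeFn_sub (F n) f] with x hx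
      rw [hx]; rfl
    simp only [h2]
    have h0 : (0 : ℝ) = ∫ x : α, (0 : ℝ) ∂μ := by simp
    rw [h0]
    refine tendsto_integral_filter_of_dominated_convergence (fun x => (2 * C) ^ 2 * ‖g x‖ ^ 2)
      (Filter.Eventually.of_forall fun n => ?_) (Filter.Eventually.of_forall fun n => ?_) ?_ ?_
    · exact ((Lp.aestronglyMeasurable _).sub (Lp.aestronglyMeasurable _)).norm.pow 2
    · filter_upwards [hF n, hf] with x h1 h3
      rw [Real.norm_of_nonneg (by positivity), ← mul_pow]
      gcongr
      calc _ ≤ ‖F n x‖ + ‖f x‖ := norm_sub_le _ _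
        _ ≤ _ := by linarith
    · exact (integrable_norm_sq g).const_mul _
    · filter_upwards [hlim] with x hx
      have := ((hx.sub_const (f x)).norm.pow 2)
      simpa using this
  have := h.sqrt
  simpa [Real.sqrt_sq (norm_nonneg _)] using this

end Lebesgue

/-! ### Multiplication operators. -/

section Mult

variable {ι : Type} [Fintype ι]

theorem multOp_apply {V : Conf ι → ℂ} (h : MemLp V ⊤ volume) (ψ : L2 ι) :
    multOp V ψ =ᵐ[volume] fun x => V x * ψ x := by
  unfold multOp
  rw [dif_pos h]
  filter_upwards [ContinuousLinearMap.coeFn_holder (r := 2) (ContinuousLinearMap.mul ℂ ℂ)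
    (h.toLp V) ψ, h.coeFn_toLp] with x hx h2
  rw [← h2]
  exact hx

theorem memLp_top_of_norm_le {V : Conf ι → ℂ} (hV : Measurable V) {C : ℝ} (h : ∀ x, ‖V x‖ ≤ C) :
    MemLp V ⊤ volume :=
  memLp_top_of_bound hV.aestronglyMeasurable C (Filter.Eventually.of_forall h)

theorem multOp_apply_of_norm_le {V : Conf ι → ℂ} (hV : Measurable V) {C : ℝ}
    (h : ∀ x, ‖V x‖ ≤ C) (ψ : L2 ι) : multOp V ψ =ᵐ[volume] fun x => V x * ψ x :=
  multOp_apply (memLp_top_of_norm_le hV h) ψ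

theorem norm_multOp_apply_of_norm_eq_one {V : Conf ι → ℂ} (hV : Measurable V)
    (h : ∀ x, ‖V x‖ = 1) (ψ : L2 ι) : ‖multOp V ψ‖ = ‖ψ‖ := by
  refine (Lp.norm_le_norm_of_ae_le ?_).antisymm (Lp.norm_le_norm_of_ae_le ?_) <;>
  · filter_upwards [multOp_apply_of_norm_le hV (fun x => (h x).le) ψ] with x hx
    rw [hx, norm_mul, h, one_mul]

end Mult

/-! ### Fourier transform: `L²` versus integral, inversion, injectivity. -/

section Fourier

variable {E : Type*} [NormedAddCommGroup E] [InnerProductSpace ℝ E] [FiniteDimensional ℝ E]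
  [MeasurableSpace E] [BorelSpace E]

theorem ae_eq_of_forall_integral_schwartz {f g : E → ℂ} (hf : LocallyIntegrable f)
    (hg : LocallyIntegrable g)
    (h : ∀ φ : 𝓢(E, ℂ), ∫ x, φ x * f x = ∫ x, φ x * g x) : f =ᵐ[volume] g := by
  refine ae_eq_of_integral_contDiff_smul_eq hf hg fun φ hφ hc => ?_
  have hg₁ : HasCompactSupport (Complex.ofRealCLM ∘ φ) := hc.comp_left rfl
  have hg₂ : ContDiff ℝ ((⊤ : ℕ∞) : WithTop ℕ∞) (Complex.ofRealCLM ∘ φ) := by fun_prop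
  simpa using h (hg₁.toSchwartzMap hg₂)

theorem integral_fourier_mul_eq_flip {f g : E → ℂ} (hf : Integrable f) (hg : Integrable g) :
    ∫ x, 𝓕 f x * g x = ∫ x, f x * 𝓕 g x := by
  have := VectorFourier.integral_fourierIntegral_smul_eq_flip (L := innerₗ E)
    (μ := (volume : Measure E)) (ν := (volume : Measure E)) Real.continuous_fourierChar
    continuous_inner hf hg
  simp only [smul_eq_mul, flip_innerₗ] at this
  exact this

/-- The `L²` Fourier transform of an integrable function is given by the Fourier integral. -/
theorem coeFn_fourier_of_integrable (ψ : Lp ℂ 2 (volume : Measure E)) (h : Integrable ψ) :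
    Lp.fourierTransformₗᵢ E ℂ ψ =ᵐ[volume] 𝓕 (ψ : E → ℂ) := by
  have hc : Continuous (𝓕 (ψ : E → ℂ)) := VectorFourier.fourierIntegral_continuous
    Real.continuous_fourierChar continuous_inner h
  refine ae_eq_of_forall_integral_schwartz ((Lp.memLp _).locallyIntegrable (by norm_num))
    hc.locallyIntegrable fun φ => ?_
  have h1 := congrArg (fun T => T φ) (Lp.fourier_toTemperedDistribution_eq ψ)
  simp only [TemperedDistribution.fourier_apply, Lp.toTemperedDistribution_apply,
    smul_eq_mul] at h1
  rw [SchwartzMap.fourier_coe] at h1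
  refine h1.symm.trans ?_
  exact integral_fourier_mul_eq_flip φ.integrable h

/-- Fourier inversion almost everywhere, for integrable functions with integrable transform. -/
theorem fourierInv_fourier_ae_eq {f : E → ℂ} (hf : Integrable f) (h : Integrable (𝓕 f)) :
    𝓕⁻ (𝓕 f) =ᵐ[volume] f := by
  have hc : Continuous (𝓕⁻ (𝓕 f)) := by
    have : 𝓕⁻ (𝓕 f) = fun x => 𝓕 (𝓕 f) (-x) := by
      ext x; exact Real.fourierInv_eq_fourier_neg _ _
    rw [this]
    exact (VectorFourier.fourierIntegral_continuous
      Real.continuous_fourierChar continuous_inner h).comp continuous_neg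
  refine ae_eq_of_forall_integral_schwartz hc.locallyIntegrable hf.locallyIntegrable fun φ => ?_
  -- Both transforms are moved onto the test function by duality, and inversion is used only for
  -- Schwartz functions.
  have h1 : ∫ x, φ x * 𝓕⁻ (𝓕 f) x = ∫ x, φ (-x) * 𝓕 (𝓕 f) x := by
    rw [← integral_neg_eq_self]
    simp [Real.fourierInv_eq_fourier_neg]
  have hφ : Integrable (fun x => φ (-x)) := φ.integrable.comp_neg
  rw [h1, ← integral_fourier_mul_eq_flip hφ h, ← integral_fourier_mul_eq_flip _ hf]
  · congr 1; ext x; congr 1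
    have : (𝓕 fun x => φ (-x)) = (𝓕⁻ φ : 𝓢(E, ℂ)) := by
      ext y
      rw [SchwartzMap.fourierInv_coe, Real.fourierInv_eq_fourier_comp_neg]
    rw [this, ← SchwartzMap.fourier_coe, FourierTransform.fourier_fourierInv_eq]
  · have : (𝓕 fun x => φ (-x)) = (𝓕⁻ φ : 𝓢(E, ℂ)) := by
      ext y
      rw [SchwartzMap.fourierInv_coe, Real.fourierInv_eq_fourier_comp_neg]
    rw [this]
    exact SchwartzMap.integrable _

theorem ae_eq_zero_of_fourier_eq_zero {f : E → ℂ} (hf : Integrable f) (h : ∀ x, 𝓕 f x = 0) :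
    f =ᵐ[volume] 0 := by
  have h0 : 𝓕 f = fun _ => 0 := funext h
  have := fourierInv_fourier_ae_eq hf (by rw [h0]; exact integrable_zero _ _ _)
  refine this.symm.trans (Filter.Eventually.of_forall fun x => ?_)
  rw [Real.fourierInv_eq', h0]
  simp

end Fourier

/-! ### The free Schrödinger group as a Fourier multiplier. -/

section FreeGroup

variable {ι : Type} [Fintype ι]

/-- Multiplication by `exp(-i t m)`. -/
def phaseOp (m : Conf ι → ℝ) (t : ℝ) : L2 ι →L[ℂ] L2 ι :=
  multOp fun k => Complex.exp (-(I * ((t * m k : ℝ) : ℂ)))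

variable {m : Conf ι → ℝ}

theorem norm_phase (r : ℝ) : ‖Complex.exp (-(I * (r : ℂ)))‖ = 1 := by
  rw [Complex.norm_exp]; simp

theorem phaseOp_apply (hm : Measurable m) (t : ℝ) (g : L2 ι) :
    phaseOp m t g =ᵐ[volume] fun k => Complex.exp (-(I * ((t * m k : ℝ) : ℂ))) * g k :=
  multOp_apply_of_norm_le (by fun_prop) (fun x => (norm_phase _).le) g

theorem norm_phaseOp (hm : Measurable m) (t : ℝ) (g : L2 ι) : ‖phaseOp m t g‖ = ‖g‖ :=
  norm_multOp_apply_of_norm_eq_one (by fun_prop) (fun x => norm_phase _) g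

theorem phaseOp_zero (hm : Measurable m) : phaseOp m 0 = 1 := by
  ext g
  filter_upwards [phaseOp_apply hm 0 g] with k hk
  rw [hk]; simp

theorem phaseOp_add (hm : Measurable m) (s t : ℝ) :
    phaseOp m (s + t) = phaseOp m s * phaseOp m t := by
  ext g
  filter_upwards [phaseOp_apply hm (s + t) g, phaseOp_apply hm s (phaseOp m t g),
    phaseOp_apply hm t g] with k h1 h2 h3
  rw [h1, mul_apply_eq_comp, h2, h3, ← mul_assoc, ← Complex.exp_add]
  congr 2; push_cast; ring

theorem continuous_phaseOp (hm : Measurable m) (g : L2 ι) : Continuous fun t => phaseOp m t g := by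
  rw [continuous_iff_continuousAt]
  intro t
  refine Filter.tendsto_of_seq_tendsto fun u hu => ?_
  refine tendsto_L2_of_dominated (g := g) (C := 1) (fun s => ?_) ?_ ?_
  · filter_upwards [phaseOp_apply hm (u s) g] with k hk
    rw [Function.comp_apply, hk, norm_mul, norm_phase]
  · have h := ae_all_iff.mpr fun n => phaseOp_apply hm (u n) g
    filter_upwards [h, phaseOp_apply hm t g] with k hk h2
    simp only [Function.comp_apply, hk, h2]
    have hc : Continuous fun s : ℝ => Complex.exp (-(I * ((s * m k : ℝ) : ℂ))) * g k := by fun_prop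
    exact (hc.tendsto t).comp hu
  · filter_upwards [phaseOp_apply hm t g] with k hk
    rw [hk, norm_mul, norm_phase]

theorem hasDerivAt_phase (r : ℝ) : HasDerivAt (fun t : ℝ => Complex.exp (-(I * ((t * r : ℝ) : ℂ))))
    (-(I * r)) 0 := by
  have h : HasDerivAt (fun t : ℝ => (t : ℂ)) 1 0 := Complex.ofRealCLM.hasDerivAt
  have h2 := ((h.mul_const (r : ℂ)).const_mul I).neg.cexp
  simpa using h2

theorem norm_phase_sub_one_le (r : ℝ) : ‖Complex.exp (-(I * (r : ℂ))) - 1‖ ≤ |r| := by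
  have h := Real.norm_exp_I_mul_ofReal_sub_one_le (x := -r)
  have e : I * ((-r : ℝ) : ℂ) = -(I * (r : ℂ)) := by push_cast; ring
  rw [e] at h
  simpa using h

/-- The generator of multiplication by `exp(-i t m)` is multiplication by `m` on its maximal
domain. -/
theorem hasDerivAt_phaseOp_iff (hm : Measurable m) (g f : L2 ι) :
    HasDerivAt (fun t => phaseOp m t g) (-I • f) 0 ↔ f =ᵐ[volume] fun k => (m k : ℂ) * g k := by
  have hslope : ∀ t : ℝ, slope (fun t => phaseOp m t g) 0 t =ᵐ[volume] fun k =>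
      (t⁻¹ : ℝ) • ((Complex.exp (-(I * ((t * m k : ℝ) : ℂ))) - 1) * g k) := by
    intro t
    have e : slope (fun t => phaseOp m t g) 0 t = (t⁻¹ : ℝ) • (phaseOp m t g - g) := by
      simp [slope, phaseOp_zero hm]
    rw [e]
    filter_upwards [Lp.coeFn_smul (t⁻¹ : ℝ) (phaseOp m t g - g), Lp.coeFn_sub (phaseOp m t g) g,
      phaseOp_apply hm t g] with k h1 h2 h3
    rw [h1, Pi.smul_apply, h2, Pi.sub_apply, h3, sub_mul, one_mul]
  have hpt : ∀ k, Filter.Tendsto (fun t : ℝ =>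
      (t⁻¹ : ℝ) • ((Complex.exp (-(I * ((t * m k : ℝ) : ℂ))) - 1) * g k)) (nhdsWithin 0 {0}ᶜ)
      (nhds (-(I * m k) * g k)) := by
    intro k
    have h := (hasDerivAt_iff_tendsto_slope.mp (hasDerivAt_phase (m k))).mul_const (g k)
    refine h.congr fun t => ?_
    simp [slope, mul_assoc]
  constructor
  · intro h
    rw [hasDerivAt_iff_tendsto_slope] at h
    -- Convergence in `L²` gives almost everywhere convergence along a sequence, and the pointwise
    -- limit of the difference quotients is already known.
    obtain ⟨ns, hns, hae⟩ := (tendstoInMeasure_of_tendsto_Lp h).exists_seq_tendsto_ae'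
    filter_upwards [hae, ae_all_iff.mpr fun n => hslope (ns n), Lp.coeFn_smul (-I) f] with k h1 h2 h3
    simp only [h2] at h1
    have h4 := tendsto_nhds_unique h1 ((hpt k).comp hns)
    rw [h3, Pi.smul_apply, smul_eq_mul] at h4
    have : -I * (f k - m k * g k) = 0 := by linear_combination h4
    simpa [sub_eq_zero] using this
  · intro h
    rw [hasDerivAt_iff_tendsto_slope]
    refine Filter.tendsto_of_seq_tendsto fun u hu => ?_
    have hf : (-I • f : L2 ι) =ᵐ[volume] fun k => -(I * m k) * g k := by
      filter_upwards [Lp.coeFn_smul (-I) f, h] with k h1 h2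
      rw [h1, Pi.smul_apply, h2, smul_eq_mul]; ring
    -- Since `|e^{-itm} - 1| ≤ |t m|`, the quotients are dominated by `|m g| = |f|`, which is square
    -- integrable by assumption.
    refine tendsto_L2_of_dominated (g := f) (C := 1) (fun n => ?_) ?_ ?_
    · filter_upwards [hslope (u n), h] with k h1 h2
      simp only [Function.comp_apply]
      rw [h1, h2, norm_smul, norm_mul, norm_mul, one_mul, ← mul_assoc]
      gcongr
      by_cases h0 : u n = 0
      · simp [h0]
      calc ‖(u n)⁻¹‖ * _ ≤ ‖(u n)⁻¹‖ * |u n * m k| := by gcongr; exact norm_phase_sub_one_le _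
        _ = _ := by
          rw [norm_inv, Real.norm_eq_abs, abs_mul, inv_mul_cancel_left₀ (abs_ne_zero.mpr h0)]
          simp
    · filter_upwards [ae_all_iff.mpr fun n => hslope (u n), hf] with k h1 h2
      simp only [Function.comp_apply, h1, h2]
      exact (hpt k).comp hu
    · filter_upwards [hf, h] with k h1 h2
      rw [h1, h2]; simp

/-- Dispersion relation of the free evolution, divided by `ħ`, in the variable dual to the Fourier
kernel `e^{-2πi k·x}`. -/
def dispersion (ħ : ℝ) (k : Conf ι) : ℝ := ħ / 2 * (2 * Real.pi) ^ 2 * ‖k‖ ^ 2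

theorem measurable_dispersion (ħ : ℝ) : Measurable (dispersion (ι := ι) ħ) := by
  unfold dispersion; fun_prop

/-- The Fourier transform on `L²` as a bounded operator. -/
abbrev fourierOp (ι : Type) [Fintype ι] : L2 ι →L[ℂ] L2 ι :=
  ((Lp.fourierTransformₗᵢ (Conf ι) ℂ).toContinuousLinearEquiv : L2 ι →L[ℂ] L2 ι)

/-- The inverse Fourier transform on `L²` as a bounded operator. -/
abbrev fourierInvOp (ι : Type) [Fintype ι] : L2 ι →L[ℂ] L2 ι :=
  ((Lp.fourierTransformₗᵢ (Conf ι) ℂ).symm.toContinuousLinearEquiv : L2 ι →L[ℂ] L2 ι)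

/-- The free Schrödinger group as a Fourier multiplier. -/
def freeMultiplier (ι : Type) [Fintype ι] (ħ t : ℝ) : L2 ι →L[ℂ] L2 ι :=
  fourierInvOp ι * phaseOp (dispersion ħ) t * fourierOp ι

theorem freeMultiplier_apply (ħ t : ℝ) (ψ : L2 ι) : freeMultiplier ι ħ t ψ =
    (Lp.fourierTransformₗᵢ (Conf ι) ℂ).symm
      (phaseOp (dispersion ħ) t (Lp.fourierTransformₗᵢ (Conf ι) ℂ ψ)) := rfl

/-- On the Fourier side the generator is multiplication by `dispersion ħ` on its maximal domain, and
square integrability of `‖k‖² ψ̂` is exactly the definition of `sobolevTwo`. The constants match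
because `ħ * dispersion ħ k` equals `(ħ²/2)(2π)²‖k‖²`. -/
theorem isSchrodingerGroup_freeMultiplier {ħ : ℝ} (hħ : ħ ≠ 0) :
    IsSchrodingerGroup ħ (kinetic ι ħ) (freeMultiplier ι ħ) := by
  have hm := measurable_dispersion (ι := ι) ħ
  set 𝔉 := Lp.fourierTransformₗᵢ (Conf ι) ℂ
  refine ⟨?_, fun s t => ?_, fun t ψ => ?_, fun ψ => ?_, fun ψ φ => ?_⟩
  · refine ContinuousLinearMap.ext fun ψ => ?_
    rw [freeMultiplier_apply, phaseOp_zero hm]; simp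
  · refine ContinuousLinearMap.ext fun ψ => ?_
    simp only [freeMultiplier_apply, phaseOp_add hm, mul_apply_eq_comp,
      LinearIsometryEquiv.apply_symm_apply]
  · rw [freeMultiplier_apply, LinearIsometryEquiv.norm_map, norm_phaseOp hm,
      LinearIsometryEquiv.norm_map]
  · exact 𝔉.symm.continuous.comp (continuous_phaseOp hm (𝔉 ψ))
  · have hħ' : (ħ : ℂ) ≠ 0 := by exact_mod_cast hħ
    have h1 : HasDerivAt (fun t => freeMultiplier ι ħ t ψ) (-(I / (ħ : ℂ)) • φ) 0 ↔
        HasDerivAt (fun t => phaseOp (dispersion ħ) t (𝔉 ψ)) (-I • ((1 / (ħ : ℂ)) • 𝔉 φ)) 0 := by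
      have e : -I • ((1 / (ħ : ℂ)) • 𝔉 φ) = 𝔉 (-(I / (ħ : ℂ)) • φ) := by
        rw [map_smul, smul_smul]; congr 1; ring
      rw [e]
      constructor
      · intro h
        have := (((𝔉.toContinuousLinearEquiv : L2 ι →L[ℂ] L2 ι).restrictScalars
          ℝ).hasFDerivAt).comp_hasDerivAt 0 h
        refine this.congr_of_eventuallyEq (Filter.Eventually.of_forall fun t => ?_)
        exact (𝔉.apply_symm_apply _).symm
      · intro h
        have := (((𝔉.symm.toContinuousLinearEquiv : L2 ι →L[ℂ] L2 ι).restrictScalars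
          ℝ).hasFDerivAt).comp_hasDerivAt 0 h
        have e2 : -(I / (ħ : ℂ)) • φ = 𝔉.symm (𝔉 (-(I / (ħ : ℂ)) • φ)) :=
          (𝔉.symm_apply_apply _).symm
        rw [e2]
        exact this
    refine (hasDerivAt_complexToReal_iff.trans h1).trans ?_
    rw [hasDerivAt_phaseOp_iff hm]
    set c : ℝ := ħ ^ 2 / 2 * (2 * Real.pi) ^ 2 with hc
    have hc0 : (c : ℂ) ≠ 0 := by
      have : c ≠ 0 := by rw [hc]; have := Real.pi_ne_zero; positivity
      exact_mod_cast this
    have h2 : ((1 / (ħ : ℂ)) • 𝔉 φ =ᵐ[volume] fun k => ((dispersion ħ k : ℝ) : ℂ) * 𝔉 ψ k) ↔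
        𝔉 φ =ᵐ[volume] fun k => (c : ℂ) * sqFourier ψ k := by
      constructor
      · intro h
        filter_upwards [h, Lp.coeFn_smul (1 / (ħ : ℂ)) (𝔉 φ)] with k h1 h2
        rw [h2, Pi.smul_apply, smul_eq_mul] at h1
        have : 𝔉 φ k = ħ * (1 / ħ * 𝔉 φ k) := by field_simp
        rw [this, h1, hc, sqFourier, dispersion]; push_cast; ring
      · intro h
        filter_upwards [h, Lp.coeFn_smul (1 / (ħ : ℂ)) (𝔉 φ)] with k h1 h2
        rw [h2, Pi.smul_apply, smul_eq_mul, h1, hc, sqFourier, dispersion]; push_cast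
        field_simp
        rfl
    rw [h2]
    constructor
    · intro h
      have hmem : ψ ∈ sobolevTwo ι := by
        have h3 : MemLp (fun k => (c : ℂ)⁻¹ * 𝔉 φ k) 2 volume := (Lp.memLp (𝔉 φ)).const_mul _
        refine (memLp_congr_ae ?_).mp h3
        filter_upwards [h] with k hk
        rw [hk, inv_mul_cancel_left₀ hc0]
      refine ⟨hmem, ?_⟩
      apply 𝔉.injective
      change 𝔉 ((c : ℂ) • 𝔉.symm (MemLp.toLp (sqFourier ψ) hmem)) = _
      rw [map_smul, 𝔉.apply_symm_apply]
      refine Lp.ext ?_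
      filter_upwards [h, Lp.coeFn_smul (c : ℂ) (MemLp.toLp (sqFourier ψ) hmem),
        MemLp.coeFn_toLp (f := sqFourier ψ) hmem] with k h1 h2 h3
      rw [h2, h1, Pi.smul_apply, h3, smul_eq_mul]
    · rintro ⟨hmem, rfl⟩
      have e : 𝔉 (kinetic ι ħ ⟨ψ, hmem⟩) = (c : ℂ) • MemLp.toLp (sqFourier ψ) hmem := by
        change 𝔉 ((c : ℂ) • 𝔉.symm (MemLp.toLp (sqFourier ψ) hmem)) = _
        rw [map_smul, 𝔉.apply_symm_apply]
      rw [e]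
      filter_upwards [Lp.coeFn_smul (c : ℂ) (MemLp.toLp (sqFourier ψ) hmem),
        MemLp.coeFn_toLp (f := sqFourier ψ) hmem] with k h2 h3
      rw [h2, Pi.smul_apply, h3, smul_eq_mul]

theorem isSchrodingerGroup_freeGroup {ħ : ℝ} (hħ : ħ ≠ 0) :
    IsSchrodingerGroup ħ (kinetic ι ħ) (freeGroup ι ħ) :=
  expGroup_spec ⟨_, isSchrodingerGroup_freeMultiplier hħ⟩

theorem freeGroup_eq {ħ : ℝ} (hħ : ħ ≠ 0) : freeGroup ι ħ = freeMultiplier ι ħ :=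
  (isSchrodingerGroup_freeGroup hħ).unique (isSchrodingerGroup_freeMultiplier hħ) hħ

end FreeGroup


/-! ### Weyl operators: commutation relations, free evolution, permutations. -/

section Weyl

variable {ι : Type} [Fintype ι] {ħ : ℝ}

/-- Translation `ψ ↦ ψ(· + a)`. -/
def translOp (a : Conf ι) : L2 ι →L[ℂ] L2 ι :=
  (Lp.compMeasurePreservingₗᵢ ℂ (fun x => x + a)
    (measurePreserving_add_right volume a)).toContinuousLinearMap

theorem translOp_apply (a : Conf ι) (ψ : L2 ι) :
    translOp a ψ =ᵐ[volume] fun x => ψ (x + a) :=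
  Lp.coeFn_compMeasurePreserving ψ (measurePreserving_add_right volume a)

theorem norm_translOp (a : Conf ι) (ψ : L2 ι) : ‖translOp a ψ‖ = ‖ψ‖ :=
  (Lp.compMeasurePreservingₗᵢ ℂ (fun x => x + a)
    (measurePreserving_add_right volume a)).norm_map ψ

theorem continuous_translOp (ψ : L2 ι) : Continuous fun a : Conf ι => translOp a ψ := by
  rw [continuous_iff_continuousAt]
  intro a
  refine ContinuousAt.compMeasurePreservingLp (f := fun _ : Conf ι => ψ)
    (g := fun a : Conf ι => (⟨fun x => x + a, by fun_prop⟩ : C(Conf ι, Conf ι)))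
    continuousAt_const ?_ (fun a => measurePreserving_add_right volume a) (by norm_num)
  refine Continuous.continuousAt ?_
  refine ContinuousMap.continuous_of_continuous_uncurry _ ?_
  simp only [Function.uncurry_def, ContinuousMap.coe_mk]
  fun_prop

/-- The phase `exp(i (u·x + ħ u·q / 2))`. -/
def weylPhase (ħ : ℝ) (v : Conf ι × Conf ι) (x : Conf ι) : ℂ :=
  Complex.exp (I * ((inner ℝ v.1 x + ħ / 2 * inner ℝ v.1 v.2 : ℝ) : ℂ))

theorem norm_weylPhase (v : Conf ι × Conf ι) (x : Conf ι) : ‖weylPhase ħ v x‖ = 1 := by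
  rw [weylPhase, Complex.norm_exp]; simp

theorem measurable_weylPhase (v : Conf ι × Conf ι) : Measurable (weylPhase ħ v) := by
  unfold weylPhase; fun_prop

/-- The Weyl operator `exp(i (u·x + q·p))` with `p = -iħ∇`:
`ψ ↦ exp(i (u·x + ħ u·q / 2)) ψ(x + ħ q)`. -/
def weyl (ħ : ℝ) (v : Conf ι × Conf ι) : L2 ι →L[ℂ] L2 ι :=
  multOp (weylPhase ħ v) ∘L translOp (ħ • v.2)

theorem ae_add_right {P : Conf ι → Prop} (a : Conf ι) (h : ∀ᵐ x, P x) : ∀ᵐ x, P (x + a) :=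
  (measurePreserving_add_right (volume : Measure (Conf ι)) a).quasiMeasurePreserving.ae h

theorem weyl_apply_of_ae {ψ : L2 ι} {g : Conf ι → ℂ} (h : ψ =ᵐ[volume] g)
    (v : Conf ι × Conf ι) :
    weyl ħ v ψ =ᵐ[volume] fun x => weylPhase ħ v x * g (x + ħ • v.2) := by
  filter_upwards [multOp_apply_of_norm_le (measurable_weylPhase v)
    (fun x => (norm_weylPhase (ħ := ħ) v x).le) (translOp (ħ • v.2) ψ),
    translOp_apply (ħ • v.2) ψ, ae_add_right (ħ • v.2) h] with x h1 h2 h3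
  rw [weyl, ContinuousLinearMap.comp_apply, h1, h2, h3]

theorem weyl_apply (v : Conf ι × Conf ι) (ψ : L2 ι) :
    weyl ħ v ψ =ᵐ[volume] fun x => weylPhase ħ v x * ψ (x + ħ • v.2) :=
  weyl_apply_of_ae Filter.EventuallyEq.rfl v

theorem norm_weyl_apply (v : Conf ι × Conf ι) (ψ : L2 ι) : ‖weyl ħ v ψ‖ = ‖ψ‖ := by
  rw [weyl, ContinuousLinearMap.comp_apply,
    norm_multOp_apply_of_norm_eq_one (measurable_weylPhase v) (norm_weylPhase v), norm_translOp]

theorem continuous_weyl (ψ : L2 ι) : Continuous fun v => weyl ħ v ψ := by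
  have h : ∀ φ : L2 ι, Continuous fun v => multOp (weylPhase ħ v) φ := by
    intro φ
    rw [continuous_iff_continuousAt]
    intro v
    have ha := fun v => multOp_apply_of_norm_le (measurable_weylPhase v)
      (fun x => (norm_weylPhase (ħ := ħ) v x).le) φ
    refine Filter.tendsto_of_seq_tendsto fun u hu => ?_
    refine tendsto_L2_of_dominated (g := φ) (C := 1) (fun s => ?_) ?_ ?_
    · filter_upwards [ha (u s)] with k hk
      rw [Function.comp_apply, hk, norm_mul, norm_weylPhase]
    · filter_upwards [ae_all_iff.mpr fun n => ha (u n), ha v] with k hk h2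
      simp only [Function.comp_apply, hk, h2]
      have hc : Continuous fun v => weylPhase ħ v k * φ k := by
        unfold weylPhase; fun_prop
      exact (hc.tendsto v).comp hu
    · filter_upwards [ha v] with k hk
      rw [hk, norm_mul, norm_weylPhase]
  exact continuous_clm_apply_of_bounded (T := fun v => multOp (weylPhase ħ v)) (C := 1) h
    (fun v => ContinuousLinearMap.opNorm_le_bound _ zero_le_one fun ψ => by
      rw [norm_multOp_apply_of_norm_eq_one (measurable_weylPhase v) (norm_weylPhase v), one_mul])
    ((continuous_translOp ψ).comp (by fun_prop))

/-- The symplectic form. -/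
def sympl (v v' : Conf ι × Conf ι) : ℝ := inner ℝ v'.1 v.2 - inner ℝ v.1 v'.2

theorem sympl_swap (v v' : Conf ι × Conf ι) : sympl v' v = -sympl v v' := by
  unfold sympl; rw [neg_sub]

/-- The term `ħ u·q/2` in `weylPhase` makes the cocycle antisymmetric in the two arguments. -/
theorem weyl_mul (v v' : Conf ι × Conf ι) : weyl ħ v * weyl ħ v' =
    Complex.exp (I * ((ħ / 2 * sympl v v' : ℝ) : ℂ)) • weyl ħ (v + v') := by
  refine ContinuousLinearMap.ext fun ψ => ?_
  refine Lp.ext ?_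
  filter_upwards [weyl_apply_of_ae (weyl_apply (ħ := ħ) v' ψ) v, weyl_apply (ħ := ħ) (v + v') ψ,
    Lp.coeFn_smul (Complex.exp (I * ((ħ / 2 * sympl v v' : ℝ) : ℂ))) (weyl ħ (v + v') ψ)]
    with x h1 h2 h3
  rw [mul_apply_eq_comp, h1, smul_apply, h3, Pi.smul_apply, h2, smul_eq_mul, ← mul_assoc,
    ← mul_assoc, Prod.snd_add, smul_add, add_assoc]
  congr 1
  simp only [weylPhase, ← Complex.exp_add]
  congr 1
  rw [← mul_add, ← mul_add, ← Complex.ofReal_add, ← Complex.ofReal_add]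
  congr 2
  simp only [sympl, Prod.fst_add, Prod.snd_add, inner_add_left, inner_add_right, inner_smul_right,
    real_inner_comm]
  ring

/-- Both orders of the product are the same Weyl operator up to conjugate phases, whose difference
is a sine. -/
theorem weyl_commutator (v v' : Conf ι × Conf ι) : ⁅weyl ħ v, weyl ħ v'⁆ =
    (2 * I * Real.sin (ħ / 2 * sympl v v') : ℂ) • weyl ħ (v + v') := by
  rw [Ring.lie_def, weyl_mul, weyl_mul, sympl_swap v v', add_comm v' v, ← sub_smul]
  congr 1
  rw [mul_comm I, mul_comm I, Complex.exp_mul_I, Complex.exp_mul_I]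
  push_cast
  rw [mul_neg, Complex.cos_neg, Complex.sin_neg]
  ring

/-- The sine is of order `ħ` and absorbs the prefactor `1/ħ` of the Heisenberg equation. All
uniformity in `ħ` rests on this. -/
theorem norm_commutator_coeff_le (hħ : 0 < ħ) (v v' : Conf ι × Conf ι) :
    ‖I / (ħ : ℂ) * (2 * I * Real.sin (ħ / 2 * sympl v v') : ℂ)‖ ≤ |sympl v v'| := by
  have h := Real.abs_sin_le_abs (x := ħ / 2 * sympl v v')
  rw [abs_mul, abs_of_pos (by positivity : 0 < ħ / 2)] at h
  simp only [norm_mul, norm_div, Complex.norm_I, Complex.norm_real, Real.norm_eq_abs,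
    abs_of_pos hħ, Complex.norm_ofNat]
  calc _ = 2 / ħ * |Real.sin (ħ / 2 * sympl v v')| := by ring
    _ ≤ 2 / ħ * (ħ / 2 * |sympl v v'|) := by gcongr
    _ = _ := by field_simp

/-! ### Fourier transform and free evolution -/

theorem fourier_congr_ae {f g : Conf ι → ℂ} (h : f =ᵐ[volume] g) : 𝓕 f = 𝓕 g := by
  ext k
  rw [Real.fourier_eq', Real.fourier_eq']
  refine integral_congr_ae ?_
  filter_upwards [h] with x hx
  rw [hx]

theorem fourier_comp_eq_of_schwartz {A B : L2 ι →L[ℂ] L2 ι}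
    (h : ∀ f : 𝓢(Conf ι, ℂ), Lp.fourierTransformₗᵢ (Conf ι) ℂ (A (f.toLp 2)) =
      B (Lp.fourierTransformₗᵢ (Conf ι) ℂ (f.toLp 2))) (ψ : L2 ι) :
    Lp.fourierTransformₗᵢ (Conf ι) ℂ (A ψ) = B (Lp.fourierTransformₗᵢ (Conf ι) ℂ ψ) := by
  have hd : DenseRange (SchwartzMap.toLpCLM ℝ ℂ 2 (volume : Measure (Conf ι))) :=
    SchwartzMap.denseRange_toLpCLM ENNReal.ofNat_ne_top
  refine hd.induction_on (p := fun ψ => Lp.fourierTransformₗᵢ (Conf ι) ℂ (A ψ) =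
    B (Lp.fourierTransformₗᵢ (Conf ι) ℂ ψ)) ψ ?_ h
  exact isClosed_eq ((LinearIsometryEquiv.continuous _).comp A.continuous)
    (B.continuous.comp (LinearIsometryEquiv.continuous _))

theorem coeFn_fourier_schwartz (f : 𝓢(Conf ι, ℂ)) :
    Lp.fourierTransformₗᵢ (Conf ι) ℂ (f.toLp 2) =ᵐ[volume] 𝓕 (f : Conf ι → ℂ) := by
  have h := SchwartzMap.toLp_fourier_eq f
  have h2 : Lp.fourierTransformₗᵢ (Conf ι) ℂ (f.toLp 2) = (𝓕 f).toLp 2 := h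
  rw [h2, ← SchwartzMap.fourier_coe]
  exact SchwartzMap.coeFn_toLp (𝓕 f) 2 volume

/-- Fourier transformation exchanges translations and modulations. Writing the result again in the
format of `weyl` with the same `ħ` produces the factor `2πħ` and its inverse. -/
theorem fourier_weylPhase_mul (hħ : ħ ≠ 0) (v : Conf ι × Conf ι) (f : Conf ι → ℂ) (k : Conf ι) :
    𝓕 (fun x => weylPhase ħ v x * f (x + ħ • v.2)) k =
      weylPhase ħ ((2 * Real.pi * ħ) • v.2, -((2 * Real.pi * ħ)⁻¹ • v.1)) k *
        𝓕 f (k + ħ • -((2 * Real.pi * ħ)⁻¹ • v.1)) := by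
  have hπ := Real.pi_ne_zero
  have hphase : ∀ y, Complex.exp (((-2 * Real.pi * inner ℝ (y - ħ • v.2) k : ℝ) : ℂ) * I) *
      weylPhase ħ v (y - ħ • v.2) =
      weylPhase ħ ((2 * Real.pi * ħ) • v.2, -((2 * Real.pi * ħ)⁻¹ • v.1)) k *
      Complex.exp (((-2 * Real.pi * inner ℝ y (k + ħ • -((2 * Real.pi * ħ)⁻¹ • v.1)) : ℝ) : ℂ)
        * I) := by
    intro y
    simp only [weylPhase, ← Complex.exp_add]
    congr 1
    rw [mul_comm I, mul_comm I, ← add_mul, ← add_mul, ← Complex.ofReal_add, ← Complex.ofReal_add]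
    congr 2
    simp only [inner_sub_left, inner_sub_right, inner_add_right, inner_smul_left,
      inner_smul_right, inner_neg_right, conj_trivial, smul_neg]
    rw [real_inner_comm v.1 y, real_inner_comm v.1 v.2]
    field_simp
    ring
  rw [Real.fourier_eq', Real.fourier_eq', ← integral_const_mul,
    ← integral_add_right_eq_self _ (-(ħ • v.2))]
  congr 1
  ext y
  simp only [smul_eq_mul, ← sub_eq_add_neg, sub_add_cancel]
  rw [← mul_assoc, hphase, mul_assoc]

theorem coeFn_fourier_of_ae_eq {ψ : L2 ι} {g : Conf ι → ℂ} (h : ψ =ᵐ[volume] g)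
    (hg : Integrable g) : Lp.fourierTransformₗᵢ (Conf ι) ℂ ψ =ᵐ[volume] 𝓕 g := by
  rw [← fourier_congr_ae h]
  exact coeFn_fourier_of_integrable ψ ((integrable_congr h).mpr hg)

theorem integrable_unimodular_mul_translate {g f : Conf ι → ℂ} (hg : Measurable g)
    (h : ∀ x, ‖g x‖ = 1) (hf : Integrable f) (a : Conf ι) :
    Integrable fun x => g x * f (x + a) :=
  (hf.comp_add_right a).bdd_mul (c := 1) hg.aestronglyMeasurable
    (Filter.Eventually.of_forall fun x => (h x).le)

theorem fourier_weyl_schwartz (hħ : ħ ≠ 0) (v : Conf ι × Conf ι) (f : 𝓢(Conf ι, ℂ)) :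
    Lp.fourierTransformₗᵢ (Conf ι) ℂ (weyl ħ v (f.toLp 2)) =
      weyl ħ ((2 * Real.pi * ħ) • v.2, -((2 * Real.pi * ħ)⁻¹ • v.1))
        (Lp.fourierTransformₗᵢ (Conf ι) ℂ (f.toLp 2)) := by
  have h1 := weyl_apply_of_ae (ħ := ħ) (SchwartzMap.coeFn_toLp f 2 volume) v
  have h2 := coeFn_fourier_of_ae_eq h1 (integrable_unimodular_mul_translate
    (measurable_weylPhase v) (norm_weylPhase v) f.integrable _)
  have h3 := weyl_apply_of_ae (ħ := ħ) (coeFn_fourier_schwartz f)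
    ((2 * Real.pi * ħ) • v.2, -((2 * Real.pi * ħ)⁻¹ • v.1))
  refine Lp.ext ?_
  refine h2.trans (Filter.EventuallyEq.trans (Filter.Eventually.of_forall fun k => ?_) h3.symm)
  exact fourier_weylPhase_mul hħ v f k

theorem fourier_weyl (hħ : ħ ≠ 0) (v : Conf ι × Conf ι) (ψ : L2 ι) :
    Lp.fourierTransformₗᵢ (Conf ι) ℂ (weyl ħ v ψ) =
      weyl ħ ((2 * Real.pi * ħ) • v.2, -((2 * Real.pi * ħ)⁻¹ • v.1))
        (Lp.fourierTransformₗᵢ (Conf ι) ℂ ψ) :=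
  fourier_comp_eq_of_schwartz (fourier_weyl_schwartz hħ v) ψ

/-- The difference of `‖x‖²` at `x + ħ q` and at `x` is affine in `x`: its linear part shifts the
modulation vector and its constant part is the matching half-phase. -/
theorem phaseOp_weyl (t : ℝ) (v : Conf ι × Conf ι) :
    phaseOp (dispersion ħ) (-t) * weyl ħ v * phaseOp (dispersion ħ) t =
      weyl ħ (v.1 - (t * ħ ^ 2 * (2 * Real.pi) ^ 2) • v.2, v.2) := by
  have hm := measurable_dispersion (ι := ι) ħ
  refine ContinuousLinearMap.ext fun ψ => ?_
  refine Lp.ext ?_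
  filter_upwards [phaseOp_apply hm (-t) (weyl ħ v (phaseOp (dispersion ħ) t ψ)),
    weyl_apply_of_ae (ħ := ħ) (phaseOp_apply hm t ψ) v,
    weyl_apply (ħ := ħ) (v.1 - (t * ħ ^ 2 * (2 * Real.pi) ^ 2) • v.2, v.2) ψ] with x h1 h2 h3
  simp only [mul_apply_eq_comp]
  rw [h1, h2, h3, ← mul_assoc, ← mul_assoc]
  congr 1
  simp only [weylPhase, ← Complex.exp_add]
  congr 1
  rw [← mul_neg, ← mul_neg, ← mul_add, ← mul_add, ← Complex.ofReal_neg, ← Complex.ofReal_neg,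
    ← Complex.ofReal_add, ← Complex.ofReal_add]
  congr 2
  simp only [dispersion, ← real_inner_self_eq_norm_sq, inner_sub_left, inner_add_left,
    inner_add_right, inner_smul_left, inner_smul_right, conj_trivial, real_inner_comm]
  rw [real_inner_comm]
  ring

/-- The free evolution on phase space. -/
def freeFlow (t : ℝ) (v : Conf ι × Conf ι) : Conf ι × Conf ι := (v.1, v.2 + t • v.1)

/-- For a quadratic Hamiltonian quantum and classical evolution of Weyl operators coincide exactly:
`x` becomes `x + t p` with `p = -iħ∇`, so the flow on phase space is free of `ħ`. -/
theorem heisenberg_free_weyl (hħ : ħ ≠ 0) (t : ℝ) (v : Conf ι × Conf ι) :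
    heisenberg (freeGroup ι ħ) t (weyl ħ v) = weyl ħ (freeFlow t v) := by
  have hπ := Real.pi_ne_zero
  refine ContinuousLinearMap.ext fun ψ => ?_
  apply (Lp.fourierTransformₗᵢ (Conf ι) ℂ).injective
  rw [heisenberg_apply, freeGroup_eq hħ, freeMultiplier_apply, freeMultiplier_apply,
    LinearIsometryEquiv.apply_symm_apply, fourier_weyl hħ, fourier_weyl hħ,
    LinearIsometryEquiv.apply_symm_apply]
  have h := congrArg (fun T : L2 ι →L[ℂ] L2 ι => T (Lp.fourierTransformₗᵢ (Conf ι) ℂ ψ))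
    (phaseOp_weyl (ħ := ħ) t ((2 * Real.pi * ħ) • v.2, -((2 * Real.pi * ħ)⁻¹ • v.1)))
  simp only [mul_apply_eq_comp] at h
  rw [h, freeFlow]
  congr 3
  simp only [smul_neg, sub_neg_eq_add, smul_add, smul_smul]
  congr 2
  field_simp

/-! ### Permutations -/

theorem permuteL2_apply_of_ae (π : Equiv.Perm ι) {ψ : L2 ι} {g : Conf ι → ℂ}
    (h : ψ =ᵐ[volume] g) : permuteL2 π ψ =ᵐ[volume] fun x => g (permute π x) := by
  have h1 : permuteL2 π ψ =ᵐ[volume] ψ ∘ permute π :=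
    Lp.coeFn_compMeasurePreserving ψ (permute π).measurePreserving
  filter_upwards [h1, (permute π).measurePreserving.quasiMeasurePreserving.ae h] with x h2 h3
  rw [h2, Function.comp_apply, h3]

theorem permuteL2_apply (π : Equiv.Perm ι) (ψ : L2 ι) :
    permuteL2 π ψ =ᵐ[volume] fun x => ψ (permute π x) :=
  permuteL2_apply_of_ae π Filter.EventuallyEq.rfl

theorem permute_apply (π : Equiv.Perm ι) (x : Conf ι) (j : ι) (c : Fin 3) :
    permute π x (j, c) = x (π.symm j, c) := rfl

theorem permute_symm (π : Equiv.Perm ι) : (permute π).symm = permute π.symm := by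
  rw [permute, permute, LinearIsometryEquiv.piLpCongrLeft_symm]; rfl

theorem inner_permute (π : Equiv.Perm ι) (x y : Conf ι) :
    inner ℝ x (permute π y) = inner ℝ (permute π.symm x) y := by
  rw [← permute_symm, ← (permute π).inner_map_map ((permute π).symm x),
    LinearIsometryEquiv.apply_symm_apply]

theorem permuteL2_weyl (π : Equiv.Perm ι) (v : Conf ι × Conf ι) (ψ : L2 ι) :
    permuteL2 π (weyl ħ v ψ) =
      weyl ħ (permute π.symm v.1, permute π.symm v.2) (permuteL2 π ψ) := by
  refine Lp.ext ?_
  filter_upwards [permuteL2_apply_of_ae π (weyl_apply (ħ := ħ) v ψ),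
    weyl_apply_of_ae (ħ := ħ) (permuteL2_apply π ψ)
      (permute π.symm v.1, permute π.symm v.2)] with x h1 h2
  rw [h1, h2]
  simp only [map_add, map_smul, ← permute_symm, LinearIsometryEquiv.apply_symm_apply]
  congr 1
  simp only [weylPhase, inner_permute, permute_symm, ← (permute π.symm).inner_map_map v.1 v.2]

theorem fourier_permuteL2 (π : Equiv.Perm ι) (ψ : L2 ι) :
    Lp.fourierTransformₗᵢ (Conf ι) ℂ (permuteL2 π ψ) =
      permuteL2 π (Lp.fourierTransformₗᵢ (Conf ι) ℂ ψ) := by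
  refine fourier_comp_eq_of_schwartz (A := (permuteL2 π).toContinuousLinearMap)
    (B := (permuteL2 π).toContinuousLinearMap) (fun f => ?_) ψ
  simp only [LinearIsometry.coe_toContinuousLinearMap]
  have h1 := permuteL2_apply_of_ae π (SchwartzMap.coeFn_toLp f 2 volume)
  have hint : Integrable (fun x => f (permute π x)) :=
    (permute π).measurePreserving.integrable_comp_of_integrable f.integrable
  have h2 := coeFn_fourier_of_integrable (permuteL2 π (f.toLp 2)) ((integrable_congr h1).mpr hint)
  refine Lp.ext ?_
  filter_upwards [h2, permuteL2_apply_of_ae π (coeFn_fourier_schwartz f)] with k h3 h4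
  rw [h3, h4, ← Real.fourier_comp_linearIsometry]
  exact congrFun (fourier_congr_ae h1) k

theorem phaseOp_permuteL2 (π : Equiv.Perm ι) (t : ℝ) (ψ : L2 ι) :
    phaseOp (dispersion ħ) t (permuteL2 π ψ) = permuteL2 π (phaseOp (dispersion ħ) t ψ) := by
  have hm := measurable_dispersion (ι := ι) ħ
  refine Lp.ext ?_
  filter_upwards [phaseOp_apply hm t (permuteL2 π ψ), permuteL2_apply π ψ,
    permuteL2_apply_of_ae π (phaseOp_apply hm t ψ)] with x h1 h2 h3
  rw [h1, h2, h3]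
  simp only [dispersion, LinearIsometryEquiv.norm_map]

theorem freeGroup_permuteL2 (hħ : ħ ≠ 0) (π : Equiv.Perm ι) (t : ℝ) (ψ : L2 ι) :
    freeGroup ι ħ t (permuteL2 π ψ) = permuteL2 π (freeGroup ι ħ t ψ) := by
  apply (Lp.fourierTransformₗᵢ (Conf ι) ℂ).injective
  rw [freeGroup_eq hħ, fourier_permuteL2, freeMultiplier_apply, freeMultiplier_apply,
    LinearIsometryEquiv.apply_symm_apply, LinearIsometryEquiv.apply_symm_apply,
    fourier_permuteL2, phaseOp_permuteL2]

end Weyl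


/-! ### Tensor products, totality of product functions, ampliation. -/

section Tensor

variable {m N : ℕ} (h : m ≤ N) {ħ : ℝ}

/-- Splitting of the coordinates of `N` particles into those of the first `m` and the others. -/
def splitEquiv : (Fin m × Fin 3) ⊕ ({j : Fin N // m ≤ j.val} × Fin 3) ≃ Fin N × Fin 3 :=
  Equiv.ofBijective (Sum.elim (fun q => (Fin.castLE h q.1, q.2)) fun q => (q.1.1, q.2)) <| by
    constructor
    · rintro (⟨a, c⟩ | ⟨⟨a, ha⟩, c⟩) (⟨b, d⟩ | ⟨⟨b, hb⟩, d⟩) hab <;>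
        simp only [Sum.elim_inl, Sum.elim_inr, Prod.mk.injEq, Fin.ext_iff, Fin.val_castLE] at hab
      · simp [Fin.ext_iff, hab]
      · exact absurd hab.1 (by omega)
      · exact absurd hab.1 (by omega)
      · simp [Fin.ext_iff, hab]
    · rintro ⟨j, c⟩
      by_cases hj : j.val < m
      · exact ⟨Sum.inl (⟨j, hj⟩, c), rfl⟩
      · exact ⟨Sum.inr (⟨j, not_lt.mp hj⟩, c), rfl⟩

theorem sum_split {M : Type*} [AddCommMonoid M] (f : Fin N × Fin 3 → M) :
    ∑ q, f q = (∑ q : Fin m × Fin 3, f (Fin.castLE h q.1, q.2)) +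
      ∑ q : {j : Fin N // m ≤ j.val} × Fin 3, f (q.1.1, q.2) := by
  rw [← (splitEquiv h).sum_comp, Fintype.sum_sum_type]
  rfl

theorem inner_split (x y : Conf (Fin N)) :
    inner ℝ x y = inner ℝ (firstPart h x) (firstPart h y) + inner ℝ (restPart m x) (restPart m y) := by
  simp only [PiLp.inner_apply]
  exact sum_split h _

theorem norm_sq_split (x : Conf (Fin N)) :
    ‖x‖ ^ 2 = ‖firstPart h x‖ ^ 2 + ‖restPart m x‖ ^ 2 := by
  simp only [← real_inner_self_eq_norm_sq]
  exact inner_split h x x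

theorem measurePreserving_split :
    MeasurePreserving (fun x : Conf (Fin N) => (firstPart h x, restPart m x)) volume
      (volume.prod volume) := by
  have h1 := PiLp.volume_preserving_ofLp (Fin N × Fin 3)
  have h2 := volume_preserving_arrowCongr' (splitEquiv h).symm (MeasurableEquiv.refl ℝ)
    (MeasurePreserving.id volume)
  have h3 := volume_measurePreserving_sumPiEquivProdPi
    (fun _ : (Fin m × Fin 3) ⊕ ({j : Fin N // m ≤ j.val} × Fin 3) => ℝ)
  have h4 := (PiLp.volume_preserving_toLp (Fin m × Fin 3)).prod
    (PiLp.volume_preserving_toLp ({j : Fin N // m ≤ j.val} × Fin 3))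
  exact h4.comp (h3.comp (h2.comp h1))

theorem integrable_split_mul {f : Conf (Fin m) → ℝ} {g : Conf {j : Fin N // m ≤ j.val} → ℝ}
    (hf : Integrable f) (hg : Integrable g) :
    Integrable fun x : Conf (Fin N) => f (firstPart h x) * g (restPart m x) :=
  (measurePreserving_split h).integrable_comp_of_integrable (hf.mul_prod hg)

theorem ae_firstPart {P : Conf (Fin m) → Prop} (hP : ∀ᵐ x, P x) :
    ∀ᵐ x : Conf (Fin N), P (firstPart h x) :=
  (measurePreserving_split h).quasiMeasurePreserving.ae
    (Measure.quasiMeasurePreserving_fst.ae hP)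

theorem ae_restPart (h : m ≤ N) {P : Conf {j : Fin N // m ≤ j.val} → Prop} (hP : ∀ᵐ x, P x) :
    ∀ᵐ x : Conf (Fin N), P (restPart m x) :=
  (measurePreserving_split h).quasiMeasurePreserving.ae
    (Measure.quasiMeasurePreserving_snd.ae hP)

theorem memLp_split_mul (f : L2 (Fin m)) (g : L2 {j : Fin N // m ≤ j.val}) :
    MemLp (fun x : Conf (Fin N) => f (firstPart h x) * g (restPart m x)) 2 volume := by
  have hm : AEStronglyMeasurable (fun x : Conf (Fin N) => f (firstPart h x) * g (restPart m x))
      volume :=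
    (((Lp.aestronglyMeasurable f).comp_fst.mul
      (Lp.aestronglyMeasurable g).comp_snd).comp_measurePreserving (measurePreserving_split h))
  rw [memLp_two_iff_integrable_sq_norm hm]
  simp only [norm_mul, mul_pow]
  exact integrable_split_mul h (integrable_norm_sq f) (integrable_norm_sq g)

theorem norm_sq_split_mul (f : L2 (Fin m)) (g : L2 {j : Fin N // m ≤ j.val}) :
    ‖(memLp_split_mul h f g).toLp‖ ^ 2 = ‖f‖ ^ 2 * ‖g‖ ^ 2 := by
  rw [norm_sq_eq_integral, norm_sq_eq_integral, norm_sq_eq_integral, ← integral_prod_mul]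
  have h1 : AEStronglyMeasurable (fun z : Conf (Fin m) × Conf {j : Fin N // m ≤ j.val} =>
      ‖f z.1‖ ^ 2 * ‖g z.2‖ ^ 2)
      (Measure.map (fun x : Conf (Fin N) => (firstPart h x, restPart m x)) volume) := by
    rw [(measurePreserving_split h).map_eq]
    exact ((integrable_norm_sq f).mul_prod (integrable_norm_sq g)).aestronglyMeasurable
  rw [← (measurePreserving_split h).map_eq,
    integral_map (measurePreserving_split h).measurable.aemeasurable h1]
  refine integral_congr_ae ?_
  filter_upwards [(memLp_split_mul h f g).coeFn_toLp] with x hx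
  rw [hx, norm_mul, mul_pow]

/-- `f ↦ f ⊗ g`. -/
def tens (g : L2 {j : Fin N // m ≤ j.val}) : L2 (Fin m) →L[ℂ] L2 (Fin N) :=
  LinearMap.mkContinuous
    { toFun := fun f => (memLp_split_mul h f g).toLp
      map_add' := fun f f' => by
        refine Lp.ext ?_
        filter_upwards [(memLp_split_mul h (f + f') g).coeFn_toLp,
          (memLp_split_mul h f g).coeFn_toLp, (memLp_split_mul h f' g).coeFn_toLp,
          Lp.coeFn_add (memLp_split_mul h f g).toLp (memLp_split_mul h f' g).toLp,
          ae_firstPart h (Lp.coeFn_add f f')] with x h1 h2 h3 h4 h5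
        rw [h1, h4, Pi.add_apply, h2, h3, h5, Pi.add_apply, add_mul]
      map_smul' := fun c f => by
        refine Lp.ext ?_
        filter_upwards [(memLp_split_mul h (c • f) g).coeFn_toLp,
          (memLp_split_mul h f g).coeFn_toLp,
          Lp.coeFn_smul c (memLp_split_mul h f g).toLp,
          ae_firstPart h (Lp.coeFn_smul c f)] with x h1 h2 h4 h5
        rw [h1, RingHom.id_apply, h4, Pi.smul_apply, h2, h5, Pi.smul_apply, smul_eq_mul,
          smul_eq_mul, mul_assoc] }
    ‖g‖ fun f => le_of_eq <| by
      have := norm_sq_split_mul h f g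
      rw [← mul_pow] at this
      rw [mul_comm]
      exact (pow_left_inj₀ (norm_nonneg _) (by positivity) two_ne_zero).mp this

theorem tens_apply (f : L2 (Fin m)) (g : L2 {j : Fin N // m ≤ j.val}) :
    tens h g f =ᵐ[volume] fun x => f (firstPart h x) * g (restPart m x) :=
  (memLp_split_mul h f g).coeFn_toLp

theorem isAmpliation_iff {a : L2 (Fin m) →L[ℂ] L2 (Fin m)} {T : L2 (Fin N) →L[ℂ] L2 (Fin N)} :
    IsAmpliation h a T ↔ ∀ f g, T (tens h g f) = tens h g (a f) := by
  constructor
  · intro hT f g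
    refine Lp.ext ?_
    exact (hT f g _ (tens_apply h f g)).trans (tens_apply h (a f) g).symm
  · intro hT f g Ψ hΨ
    have : Ψ = tens h g f := Lp.ext (hΨ.trans (tens_apply h f g).symm)
    rw [this, hT]
    exact tens_apply h (a f) g

/-- The Gaussian `exp(-‖x‖²)` times the plane wave `exp(2πi k·x)`. -/
def gaussWave {ι : Type} [Fintype ι] (k x : Conf ι) : ℂ :=
  Complex.exp (-1 * (‖x‖ : ℂ) ^ 2 + (2 * Real.pi * I) * ((inner ℝ k x : ℝ) : ℂ))

theorem norm_gaussWave {ι : Type} [Fintype ι] (k x : Conf ι) :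
    ‖gaussWave k x‖ = Real.exp (-‖x‖ ^ 2) := by
  have : (-1 * (‖x‖ : ℂ) ^ 2 + (2 * Real.pi * I) * ((inner ℝ k x : ℝ) : ℂ)) =
      ((-‖x‖ ^ 2 : ℝ) : ℂ) + ((2 * Real.pi * inner ℝ k x : ℝ) : ℂ) * I := by push_cast; ring
  rw [gaussWave, this, Complex.norm_exp]
  simp only [add_re, ofReal_re, mul_re, I_re, ofReal_im, I_im]
  congr 1; ring

theorem continuous_gaussWave {ι : Type} [Fintype ι] (k : Conf ι) : Continuous (gaussWave k) := by
  unfold gaussWave; fun_prop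

theorem memLp_gaussWave {ι : Type} [Fintype ι] (k : Conf ι) : MemLp (gaussWave k) 2 volume := by
  rw [memLp_two_iff_integrable_sq_norm (continuous_gaussWave k).aestronglyMeasurable]
  have h1 := (GaussianFourier.integrable_cexp_neg_mul_sq_norm_add (V := Conf ι) (b := 2)
    (by simp) 0 0).norm
  refine h1.congr (Filter.Eventually.of_forall fun x => ?_)
  simp only [norm_gaussWave, zero_mul, add_zero, Complex.norm_exp, ← Real.exp_nat_mul]
  congr 1
  have : (-2 * (‖x‖ : ℂ) ^ 2) = ((-2 * ‖x‖ ^ 2 : ℝ) : ℂ) := by push_cast; ring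
  rw [this, Complex.ofReal_re]; push_cast; ring

/-- Product functions are total. -/
theorem eq_zero_of_inner_tens {φ : L2 (Fin N)} (hφ : ∀ f g, inner ℂ (tens h g f) φ = 0) :
    φ = 0 := by
  have hint : Integrable (fun x => gaussWave 0 x * φ x) := by
    have := L2.integrable_inner (𝕜 := ℂ) (memLp_gaussWave (0 : Conf (Fin N))).toLp φ
    refine this.congr ?_
    filter_upwards [(memLp_gaussWave (0 : Conf (Fin N))).coeFn_toLp] with x hx
    rw [hx, RCLike.inner_apply, mul_comm]
    congr 1
    have : gaussWave (0 : Conf (Fin N)) x = ((Real.exp (-‖x‖ ^ 2) : ℝ) : ℂ) := by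
      rw [gaussWave]; push_cast; simp
    rw [this, Complex.conj_ofReal]
  -- A Gaussian times a plane wave factorizes along the splitting of the particles, so orthogonality
  -- to all products kills the Fourier transform of the Gaussian times `φ` at every frequency.
  have hF : ∀ k, 𝓕 (fun x => gaussWave 0 x * φ x) k = 0 := by
    intro k
    have h1 := hφ (memLp_gaussWave (firstPart h k)).toLp (memLp_gaussWave (restPart m k)).toLp
    rw [L2.inner_def] at h1
    rw [Real.fourier_eq', ← h1]
    refine integral_congr_ae ?_
    filter_upwards [tens_apply h (memLp_gaussWave (firstPart h k)).toLp
      (memLp_gaussWave (restPart m k)).toLp,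
      ae_firstPart h (memLp_gaussWave (firstPart h k)).coeFn_toLp,
      ae_restPart h (memLp_gaussWave (restPart m k)).coeFn_toLp] with x h2 h3 h4
    rw [h2, h3, h4, RCLike.inner_apply, smul_eq_mul, ← mul_assoc, mul_comm (φ x)]
    congr 1
    simp only [gaussWave, ← Complex.exp_add, ← Complex.exp_conj]
    congr 1
    have e1 := inner_split h x k
    have e2 := norm_sq_split h x
    have e2' : (‖x‖ : ℂ) ^ 2 = (‖firstPart h x‖ : ℂ) ^ 2 + (‖restPart m x‖ : ℂ) ^ 2 := by
      exact_mod_cast e2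
    rw [e1, e2']
    simp only [real_inner_comm, inner_zero_right, map_add, map_mul, map_neg, map_one,
      Complex.conj_ofReal, map_pow, Complex.conj_I, map_ofNat]
    push_cast
    ring
  have h0 := ae_eq_zero_of_fourier_eq_zero hint hF
  refine Lp.ext ?_
  filter_upwards [h0, Lp.coeFn_zero ℂ 2 (volume : Measure (Conf (Fin N)))] with x h1 h2
  rw [h2]
  exact (mul_eq_zero.mp h1).resolve_left (Complex.exp_ne_zero _)

theorem dense_span_tens :
    Dense (Submodule.span ℂ {Ψ : L2 (Fin N) | ∃ f g, Ψ = tens h g f} : Set (L2 (Fin N))) := by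
  rw [Submodule.dense_iff_topologicalClosure_eq_top, Submodule.topologicalClosure_eq_top_iff,
    Submodule.eq_bot_iff]
  intro φ hφ
  exact eq_zero_of_inner_tens h fun f g =>
    (Submodule.mem_orthogonal _ _).mp hφ _ (Submodule.subset_span ⟨f, g, rfl⟩)

variable {h} in
theorem IsAmpliation.unique {a : L2 (Fin m) →L[ℂ] L2 (Fin m)}
    {T T' : L2 (Fin N) →L[ℂ] L2 (Fin N)} (hT : IsAmpliation h a T) (hT' : IsAmpliation h a T') :
    T = T' := by
  refine ContinuousLinearMap.ext_on (dense_span_tens h) ?_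
  rintro _ ⟨f, g, rfl⟩
  rw [(isAmpliation_iff h).mp hT, (isAmpliation_iff h).mp hT']

variable {h} in
theorem IsAmpliation.ampliation_eq {a : L2 (Fin m) →L[ℂ] L2 (Fin m)}
    {T : L2 (Fin N) →L[ℂ] L2 (Fin N)} (hT : IsAmpliation h a T) : ampliation h a = T := by
  have hex : ∃ T, IsAmpliation h a T := ⟨T, hT⟩
  unfold ampliation
  rw [dif_pos hex]
  exact hex.choose_spec.unique hT

/-! ### Extension of phase space vectors by zero -/

/-- Extension by zero of a configuration of the first `m` particles. -/
def extZero (m N : ℕ) (x : Conf (Fin m)) : Conf (Fin N) :=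
  WithLp.toLp 2 fun q => if hq : q.1.val < m then x (⟨q.1, hq⟩, q.2) else 0

theorem firstPart_extZero (x : Conf (Fin m)) : firstPart h (extZero m N x) = x := by
  ext ⟨j, c⟩
  simp [firstPart, extZero]

theorem restPart_extZero (x : Conf (Fin m)) : restPart m (extZero m N x) = 0 := by
  ext ⟨⟨j, hj⟩, c⟩
  simp only [restPart, extZero]
  rw [dif_neg (not_lt.mpr hj)]; rfl

theorem firstPart_add_smul (x y : Conf (Fin N)) (c : ℝ) :
    firstPart h (x + c • y) = firstPart h x + c • firstPart h y := rfl

theorem restPart_add_smul (x y : Conf (Fin N)) (c : ℝ) :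
    restPart m (x + c • y) = restPart m x + c • restPart m y := rfl

theorem continuous_extZero : Continuous (extZero m N) := by
  unfold extZero
  refine (PiLp.continuous_toLp 2 _).comp (continuous_pi fun q => ?_)
  split_ifs <;> fun_prop

/-- Extension by zero of a phase space vector of the first `m` particles. -/
def extPhase (m N : ℕ) (v : Conf (Fin m) × Conf (Fin m)) : Conf (Fin N) × Conf (Fin N) :=
  (extZero m N v.1, extZero m N v.2)

theorem continuous_extPhase : Continuous (extPhase m N) :=
  (continuous_extZero.comp continuous_fst).prodMk (continuous_extZero.comp continuous_snd)

theorem weyl_extPhase_tens (v : Conf (Fin m) × Conf (Fin m)) (f : L2 (Fin m))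
    (g : L2 {j : Fin N // m ≤ j.val}) :
    weyl ħ (extPhase m N v) (tens h g f) = tens h g (weyl ħ v f) := by
  refine Lp.ext ?_
  filter_upwards [weyl_apply_of_ae (ħ := ħ) (tens_apply h f g) (extPhase m N v),
    tens_apply h (weyl ħ v f) g, ae_firstPart h (weyl_apply (ħ := ħ) v f)] with x h1 h2 h3
  rw [h1, h2, h3, mul_assoc, firstPart_add_smul, restPart_add_smul]
  simp only [extPhase, firstPart_extZero, restPart_extZero, smul_zero, add_zero]
  congr 1
  simp only [weylPhase, inner_split h, firstPart_extZero, restPart_extZero, inner_zero_left,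
    add_zero]

end Tensor

/-! ### Strong continuity tested on a total set. -/

section Density

/-- Strong continuity of a bounded family of operators may be checked on a total set. -/
theorem continuous_of_dense_span {X E F : Type*} [TopologicalSpace X] [NormedAddCommGroup E]
    [NormedSpace ℂ E] [NormedAddCommGroup F] [NormedSpace ℂ F] {T : X → E →L[ℂ] F} {C : ℝ}
    (hC : ∀ x, ‖T x‖ ≤ C) {S : Set E} (hS : Dense (Submodule.span ℂ S : Set E))
    (h : ∀ ψ ∈ S, Continuous fun x => T x ψ) (ψ : E) : Continuous fun x => T x ψ := by
  have hspan : ∀ φ ∈ Submodule.span ℂ S, Continuous fun x => T x φ := by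
    intro φ hφ
    induction hφ using Submodule.span_induction with
    | mem x hx => exact h x hx
    | zero => simpa using continuous_const
    | add x y _ _ hx hy => simp only [map_add]; exact hx.add hy
    | smul c x _ hx => simp only [map_smul]; exact hx.const_smul c
  refine continuous_of_uniform_approx_of_continuous fun u hu => ?_
  obtain ⟨ε, hε, hεu⟩ := Metric.mem_uniformity_dist.mp hu
  have hpos : 0 < |C| + 1 := by positivity
  obtain ⟨φ, hφ, hd⟩ := hS.exists_dist_lt ψ (div_pos hε hpos)
  refine ⟨fun x => T x φ, hspan φ hφ, fun x => hεu ?_⟩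
  rw [dist_eq_norm, ← map_sub]
  rw [dist_eq_norm, lt_div_iff₀ hpos] at hd
  calc ‖T x (ψ - φ)‖ ≤ C * ‖ψ - φ‖ := (T x).le_of_opNorm_le (hC x) _
    _ ≤ ‖ψ - φ‖ * (|C| + 1) := by
        rw [mul_comm]; gcongr; linarith [le_abs_self C]
    _ < ε := hd

end Density


/-! ### Superpositions of Weyl operators and their algebra. -/

section Rep

variable {ι : Type} [Fintype ι] {ħ : ℝ} {Z Z' : Type} [MeasurableSpace Z] [MeasurableSpace Z']
  {μ : Measure Z} {μ' : Measure Z'} {c : Z → ℂ} {c' : Z' → ℂ} {v : Z → Conf ι × Conf ι}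
  {v' : Z' → Conf ι × Conf ι} {T T' : L2 ι →L[ℂ] L2 ι}

/-- `T = ∫ c(z) W(v(z)) dμ(z)`: the operator `T` is a superposition of Weyl operators. -/
structure IsWeylIntegral (ħ : ℝ) (μ : Measure Z) (c : Z → ℂ) (v : Z → Conf ι × Conf ι)
    (T : L2 ι →L[ℂ] L2 ι) : Prop where
  measurable : Measurable v
  integrable : Integrable c μ
  apply_eq : ∀ ψ, T ψ = ∫ z, c z • weyl ħ (v z) ψ ∂μ

theorem aestronglyMeasurable_weyl (hv : Measurable v) (ψ : L2 ι) :
    AEStronglyMeasurable (fun z => weyl ħ (v z) ψ) μ :=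
  ((continuous_weyl ψ).stronglyMeasurable.comp_measurable hv).aestronglyMeasurable

theorem integrable_smul_weyl (hv : Measurable v) (hc : Integrable c μ) (ψ : L2 ι) :
    Integrable (fun z => c z • weyl ħ (v z) ψ) μ :=
  (hc.norm.mul_const ‖ψ‖).mono' (hc.1.smul (aestronglyMeasurable_weyl hv ψ))
    (Filter.Eventually.of_forall fun z => by rw [norm_smul, norm_weyl_apply])

theorem norm_integral_smul_weyl_le (ψ : L2 ι) :
    ‖∫ z, c z • weyl ħ (v z) ψ ∂μ‖ ≤ (∫ z, ‖c z‖ ∂μ) * ‖ψ‖ := by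
  refine (norm_integral_le_integral_norm _).trans (le_of_eq ?_)
  rw [← integral_mul_const]
  simp only [norm_smul, norm_weyl_apply]

theorem exists_isWeylIntegral (hv : Measurable v) (hc : Integrable c μ) :
    ∃ T, IsWeylIntegral ħ μ c v T := by
  refine ⟨LinearMap.mkContinuous
    { toFun := fun ψ => ∫ z, c z • weyl ħ (v z) ψ ∂μ
      map_add' := fun ψ φ => by
        rw [← integral_add (integrable_smul_weyl hv hc ψ) (integrable_smul_weyl hv hc φ)]
        simp only [map_add, smul_add]
      map_smul' := fun r ψ => by
        rw [RingHom.id_apply, ← integral_smul]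
        simp only [map_smul, smul_comm r] }
    (∫ z, ‖c z‖ ∂μ) norm_integral_smul_weyl_le, hv, hc, fun ψ => rfl⟩

namespace IsWeylIntegral

theorem unique (h : IsWeylIntegral ħ μ c v T) (h' : IsWeylIntegral ħ μ c v T') : T = T' :=
  ContinuousLinearMap.ext fun ψ => by rw [h.apply_eq, h'.apply_eq]

theorem norm_le (h : IsWeylIntegral ħ μ c v T) : ‖T‖ ≤ ∫ z, ‖c z‖ ∂μ :=
  ContinuousLinearMap.opNorm_le_bound _ (integral_nonneg fun _ => norm_nonneg _) fun ψ => by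
    rw [h.apply_eq]; exact norm_integral_smul_weyl_le ψ

theorem const_smul (h : IsWeylIntegral ħ μ c v T) (r : ℂ) :
    IsWeylIntegral ħ μ (fun z => r * c z) v (r • T) :=
  ⟨h.measurable, h.integrable.const_mul r, fun ψ => by
    rw [smul_apply, h.apply_eq, ← integral_smul]
    simp only [mul_smul]⟩

/-- The common mechanism behind free evolution and permutations: a conjugation sending Weyl
operators to Weyl operators passes under the integral, moves `v` and leaves the amplitude `c` alone.
-/
theorem map_of_conj {κ : Type} [Fintype κ] {T' : L2 κ →L[ℂ] L2 κ} {v' : Z → Conf κ × Conf κ}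
    (h : IsWeylIntegral ħ μ c v T) (hv' : Measurable v') (A : L2 ι →L[ℂ] L2 κ)
    (B : L2 κ →L[ℂ] L2 ι) (hT : ∀ ψ, T' ψ = A (T (B ψ)))
    (hW : ∀ z ψ, A (weyl ħ (v z) (B ψ)) = weyl ħ (v' z) ψ) : IsWeylIntegral ħ μ c v' T' :=
  ⟨hv', h.integrable, fun ψ => by
    rw [hT, h.apply_eq, ← ContinuousLinearMap.integral_comp_comm _
      (integrable_smul_weyl h.measurable h.integrable _)]
    simp only [map_smul, hW]⟩

theorem continuous_freeFlow (t : ℝ) : Continuous (freeFlow (ι := ι) t) := by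
  unfold freeFlow; fun_prop

theorem heisenberg_free (hħ : ħ ≠ 0) (h : IsWeylIntegral ħ μ c v T) (t : ℝ) :
    IsWeylIntegral ħ μ c (fun z => freeFlow t (v z)) (heisenberg (freeGroup ι ħ) t T) :=
  h.map_of_conj ((continuous_freeFlow t).measurable.comp h.measurable) (freeGroup ι ħ (-t))
    (freeGroup ι ħ t) (fun _ => rfl) fun z ψ => by
      rw [← heisenberg_free_weyl hħ]; rfl

theorem permuteL2_apply_symm (π : Equiv.Perm ι) (ψ : L2 ι) :
    permuteL2 π (permuteL2 π.symm ψ) = ψ := by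
  refine Lp.ext ?_
  filter_upwards [permuteL2_apply_of_ae π (permuteL2_apply π.symm ψ)] with x hx
  rw [hx, ← permute_symm, LinearIsometryEquiv.symm_apply_apply]

theorem conj_permute (h : IsWeylIntegral ħ μ c v T) (π : Equiv.Perm ι)
    (hT' : ∀ ψ, T' ψ = permuteL2 π (T (permuteL2 π.symm ψ))) :
    IsWeylIntegral ħ μ c (fun z => (permute π.symm (v z).1, permute π.symm (v z).2)) T' :=
  h.map_of_conj (((permute π.symm).continuous.measurable.comp h.measurable.fst).prodMk
    ((permute π.symm).continuous.measurable.comp h.measurable.snd))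
    (permuteL2 π).toContinuousLinearMap (permuteL2 π.symm).toContinuousLinearMap hT' fun z ψ => by
      simp only [LinearIsometry.coe_toContinuousLinearMap]
      rw [permuteL2_weyl, permuteL2_apply_symm]

theorem isAmpliation_of_ext {m N : ℕ} (hmN : m ≤ N) {v : Z → Conf (Fin m) × Conf (Fin m)}
    {T : L2 (Fin m) →L[ℂ] L2 (Fin m)} {T' : L2 (Fin N) →L[ℂ] L2 (Fin N)}
    (h : IsWeylIntegral ħ μ c v T)
    (h' : IsWeylIntegral ħ μ c (fun z => extPhase m N (v z)) T') : IsAmpliation hmN T T' := by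
  rw [isAmpliation_iff]
  intro f g
  rw [h.apply_eq, h'.apply_eq, ← ContinuousLinearMap.integral_comp_comm _
      (integrable_smul_weyl h.measurable h.integrable _)]
  simp only [map_smul, weyl_extPhase_tens]

/-- The superposition with zero-extended vectors acts correctly on product functions; this gives
existence of the ampliation, and totality of products identifies it with the chosen operator. -/
theorem ampliation {m N : ℕ} (hmN : m ≤ N) {v : Z → Conf (Fin m) × Conf (Fin m)}
    {T : L2 (Fin m) →L[ℂ] L2 (Fin m)} (h : IsWeylIntegral ħ μ c v T) :
    IsWeylIntegral ħ μ c (fun z => extPhase m N (v z)) (MeanField.ampliation hmN T) := by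
  obtain ⟨T', hT'⟩ := exists_isWeylIntegral (ħ := ħ)
    (continuous_extPhase.measurable.comp h.measurable) h.integrable
  rw [(isAmpliation_of_ext hmN h hT').ampliation_eq]
  exact hT'

theorem isAmpliation {m N : ℕ} (hmN : m ≤ N) {v : Z → Conf (Fin m) × Conf (Fin m)}
    {T : L2 (Fin m) →L[ℂ] L2 (Fin m)} (h : IsWeylIntegral ħ μ c v T) :
    IsAmpliation hmN T (MeanField.ampliation hmN T) :=
  isAmpliation_of_ext hmN h (h.ampliation hmN)

theorem continuous_sympl :
    Continuous fun p : (Conf ι × Conf ι) × (Conf ι × Conf ι) => sympl p.1 p.2 := by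
  unfold sympl; fun_prop

theorem measurable_sympl {v v' : Z → Conf ι × Conf ι} (hv : Measurable v) (hv' : Measurable v') :
    Measurable fun z => sympl (v z) (v' z) :=
  continuous_sympl.measurable.comp (hv.prodMk hv')

theorem measurable_exp_sympl {v v' : Z → Conf ι × Conf ι} (hv : Measurable v)
    (hv' : Measurable v') :
    Measurable fun z => Complex.exp (I * ((ħ / 2 * sympl (v z) (v' z) : ℝ) : ℂ)) := by
  have := measurable_sympl hv hv'
  fun_prop

theorem integrable_prod_weyl [SFinite μ] [SFinite μ'] (h : IsWeylIntegral ħ μ c v T)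
    (h' : IsWeylIntegral ħ μ' c' v' T') (ψ : L2 ι) :
    Integrable (fun z : Z × Z' => c z.1 • c' z.2 • weyl ħ (v z.1) (weyl ħ (v' z.2) ψ))
      (μ.prod μ') := by
  have hb : Integrable (fun z : Z × Z' => ‖c z.1‖ * ‖c' z.2‖ * ‖ψ‖) (μ.prod μ') :=
    (h.integrable.norm.mul_prod h'.integrable.norm).mul_const _
  refine hb.mono' ?_ (Filter.Eventually.of_forall fun z => ?_)
  · refine h.integrable.1.comp_fst.smul (h'.integrable.1.comp_snd.smul ?_)
    have e : ∀ z : Z × Z', weyl ħ (v z.1) (weyl ħ (v' z.2) ψ) =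
        Complex.exp (I * ((ħ / 2 * sympl (v z.1) (v' z.2) : ℝ) : ℂ)) •
          weyl ħ (v z.1 + v' z.2) ψ := fun z => by
      rw [← mul_apply_eq_comp, weyl_mul]; rfl
    simp only [e]
    have hv1 : Measurable fun z : Z × Z' => v z.1 := h.measurable.comp measurable_fst
    have hv2 : Measurable fun z : Z × Z' => v' z.2 := h'.measurable.comp measurable_snd
    have hadd : Measurable fun z : Z × Z' => v z.1 + v' z.2 := hv1.add hv2
    exact (measurable_exp_sympl hv1 hv2).aestronglyMeasurable.smul
      (aestronglyMeasurable_weyl hadd ψ)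
  · rw [norm_smul, norm_smul, norm_weyl_apply, norm_weyl_apply, mul_assoc]

theorem mul_apply [SFinite μ] [SFinite μ'] (h : IsWeylIntegral ħ μ c v T)
    (h' : IsWeylIntegral ħ μ' c' v' T') (ψ : L2 ι) : T (T' ψ) =
      ∫ z : Z × Z', c z.1 • c' z.2 • weyl ħ (v z.1) (weyl ħ (v' z.2) ψ) ∂(μ.prod μ') := by
  rw [integral_prod _ (h.integrable_prod_weyl h' ψ), h.apply_eq]
  refine integral_congr_ae (Filter.Eventually.of_forall fun z => ?_)
  simp only
  rw [h'.apply_eq, ← ContinuousLinearMap.integral_comp_comm _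
    (integrable_smul_weyl h'.measurable h'.integrable _), ← integral_smul]
  simp only [map_smul]

theorem commutator [SFinite μ] [SFinite μ'] (h : IsWeylIntegral ħ μ c v T)
    (h' : IsWeylIntegral ħ μ' c' v' T') :
    IsWeylIntegral ħ (μ.prod μ')
      (fun z => c z.1 * c' z.2 * (2 * I * Real.sin (ħ / 2 * sympl (v z.1) (v' z.2)) : ℂ))
      (fun z => v z.1 + v' z.2) ⁅T, T'⁆ := by
  have hv1 : Measurable fun z : Z × Z' => v z.1 := h.measurable.comp measurable_fst
  have hv2 : Measurable fun z : Z × Z' => v' z.2 := h'.measurable.comp measurable_snd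
  refine ⟨hv1.add hv2, ?_, fun ψ => ?_⟩
  · have hs := measurable_sympl hv1 hv2
    refine Integrable.mul_bdd (c := 2) (h.integrable.mul_prod h'.integrable)
      (Measurable.aestronglyMeasurable (by fun_prop)) (Filter.Eventually.of_forall fun z => ?_)
    rw [norm_mul, norm_mul, Complex.norm_real, Complex.norm_I, Complex.norm_ofNat]
    have := Real.abs_sin_le_one (ħ / 2 * sympl (v z.1) (v' z.2))
    rw [Real.norm_eq_abs]; linarith
  · have e : T' (T ψ) = ∫ z : Z × Z', c z.1 • c' z.2 • weyl ħ (v' z.2) (weyl ħ (v z.1) ψ)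
        ∂(μ.prod μ') := by
      rw [h'.mul_apply h, ← integral_prod_swap]
      refine integral_congr_ae (Filter.Eventually.of_forall fun z => ?_)
      simp only [Prod.fst_swap, Prod.snd_swap]
      rw [smul_comm]
    have hi : Integrable (fun z : Z × Z' => c z.1 • c' z.2 • weyl ħ (v' z.2) (weyl ħ (v z.1) ψ))
        (μ.prod μ') := by
      have := (h'.integrable_prod_weyl h ψ).swap
      refine this.congr (Filter.Eventually.of_forall fun z => ?_)
      simp only [Function.comp_apply, Prod.fst_swap, Prod.snd_swap]
      rw [smul_comm]
    rw [Ring.lie_def, sub_apply, mul_apply_eq_comp, mul_apply_eq_comp, h.mul_apply h', e,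
      ← integral_sub (h.integrable_prod_weyl h' ψ) hi]
    refine integral_congr_ae (Filter.Eventually.of_forall fun z => ?_)
    simp only
    have hw := congrArg (fun A : L2 ι →L[ℂ] L2 ι => A ψ)
      (weyl_commutator (ħ := ħ) (v z.1) (v' z.2))
    simp only [Ring.lie_def, sub_apply, mul_apply_eq_comp, smul_apply] at hw
    rw [← smul_sub, ← smul_sub, hw, smul_smul, smul_smul]

/-- A finite sum is encoded as one superposition over `Z × κ` with counting measure on `κ`.
Estimates can then sum over `κ` pointwise in `z` before integrating, which keeps the dependence on
the number of particles linear. -/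
theorem sum {κ : Type} [Fintype κ] [MeasurableSpace κ] [DiscreteMeasurableSpace κ] [SFinite μ]
    {c : κ → Z → ℂ} {v : κ → Z → Conf ι × Conf ι} {T : κ → L2 ι →L[ℂ] L2 ι}
    (h : ∀ k, IsWeylIntegral ħ μ (c k) (v k) (T k)) :
    IsWeylIntegral ħ (μ.prod (Measure.count : Measure κ)) (fun z => c z.2 z.1)
      (fun z => v z.2 z.1) (∑ k, T k) := by
  have hv : Measurable fun z : Z × κ => v z.2 z.1 :=
    measurable_from_prod_countable_left fun k => (h k).measurable
  have hc : AEStronglyMeasurable (fun z : Z × κ => c z.2 z.1)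
      (μ.prod (Measure.count : Measure κ)) := by
    choose g hg hcg using fun k => (h k).integrable.1
    refine ⟨fun z => g z.2 z.1, (measurable_from_prod_countable_left fun k =>
      (hg k).measurable).stronglyMeasurable, ?_⟩
    have : ∀ᵐ z ∂(μ.prod (Measure.count : Measure κ)), ∀ k, c k z.1 = g k z.1 :=
      Measure.quasiMeasurePreserving_fst.ae (ae_all_iff.mpr hcg)
    filter_upwards [this] with z hz
    exact hz z.2
  have hint : Integrable (fun z : Z × κ => c z.2 z.1) (μ.prod (Measure.count : Measure κ)) := by
    rw [integrable_prod_iff' hc]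
    exact ⟨Filter.Eventually.of_forall fun k => (h k).integrable, Integrable.of_finite⟩
  refine ⟨hv, hint, fun ψ => ?_⟩
  rw [integral_prod_symm _ (integrable_smul_weyl hv hint ψ), integral_count, sum_apply]
  exact Finset.sum_congr rfl fun k _ => (h k).apply_eq ψ

end IsWeylIntegral

theorem measurable_weylPhase_comp {g : Z → Conf ι} (hv : Measurable v) (hg : Measurable g) :
    Measurable fun z => weylPhase ħ (v z) (g z) := by
  have h1 := hv.fst
  have h2 := hv.snd
  unfold weylPhase
  fun_prop

theorem measurable_weyl_kernel (hv : Measurable v) {g : Conf ι → ℂ} (hg : Measurable g) :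
    Measurable fun p : Conf ι × Z => weylPhase ħ (v p.2) p.1 * g (p.1 + ħ • (v p.2).2) := by
  have h0 : Measurable fun p : Conf ι × Z => v p.2 := hv.comp measurable_snd
  have h1 : Measurable fun p : Conf ι × Z => weylPhase ħ (v p.2) p.1 :=
    measurable_weylPhase_comp h0 measurable_fst
  have h3 : Measurable fun p : Conf ι × Z => p.1 + ħ • (v p.2).2 :=
    measurable_fst.add (h0.snd.const_smul ħ)
  exact h1.mul (hg.comp h3)

theorem integral_norm_mul_le (φ ψ : L2 ι) :
    ∫ x, ‖φ x * (starRingEnd ℂ) (ψ x)‖ ≤ (‖φ‖ ^ 2 + ‖ψ‖ ^ 2) / 2 := by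
  rw [norm_sq_eq_integral, norm_sq_eq_integral, ← integral_add (integrable_norm_sq _)
    (integrable_norm_sq _), ← integral_div]
  refine integral_mono_ae ?_ (((integrable_norm_sq _).add (integrable_norm_sq _)).div_const _) ?_
  · refine (L2.integrable_inner (𝕜 := ℂ) ψ φ).norm.congr (Filter.Eventually.of_forall fun x => ?_)
    simp only [RCLike.inner_apply]
  · refine Filter.Eventually.of_forall fun x => ?_
    simp only
    rw [norm_mul, RCLike.norm_conj]
    nlinarith [sq_nonneg (‖φ x‖ - ‖ψ x‖)]

/-- Exchange of a pairing with a superposition given pointwise by a kernel. -/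
theorem integral_integral_kernel_swap [SFinite μ] (hc : Integrable c μ) {K : Conf ι → Z → ℂ}
    (hK : Measurable fun p : Conf ι × Z => K p.1 p.2) {A : Z → L2 ι} {r : ℝ}
    (hA : ∀ z, ‖A z‖ = r) (hKA : ∀ z, A z =ᵐ[volume] fun x => K x z) (χ : L2 ι) :
    ∫ x, ∫ z, c z * (K x z * (starRingEnd ℂ) (χ x)) ∂μ = ∫ z, c z * inner ℂ χ (A z) ∂μ := by
  have hin : ∀ z, ∫ x, K x z * (starRingEnd ℂ) (χ x) = inner ℂ χ (A z) := fun z => by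
    rw [L2.inner_def]
    refine integral_congr_ae ?_
    filter_upwards [hKA z] with x hx
    rw [hx, RCLike.inner_apply]
  have hmeas : AEStronglyMeasurable (fun p : Conf ι × Z =>
      c p.2 * (K p.1 p.2 * (starRingEnd ℂ) (χ p.1))) (volume.prod μ) :=
    hc.1.comp_snd.mul (hK.aestronglyMeasurable.mul (Lp.aestronglyMeasurable χ).comp_fst.star)
  have hint1 : ∀ z, Integrable (fun x => K x z * (starRingEnd ℂ) (χ x)) volume := by
    intro z
    refine (L2.integrable_inner (𝕜 := ℂ) χ (A z)).congr ?_
    filter_upwards [hKA z] with x hx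
    rw [hx, RCLike.inner_apply]
  have hb : ∀ z, ∫ x, ‖c z * (K x z * (starRingEnd ℂ) (χ x))‖ ≤
      ‖c z‖ * ((r ^ 2 + ‖χ‖ ^ 2) / 2) := by
    intro z
    have h1 : ∫ x, ‖c z * (K x z * (starRingEnd ℂ) (χ x))‖ =
        ‖c z‖ * ∫ x, ‖A z x * (starRingEnd ℂ) (χ x)‖ := by
      rw [← integral_const_mul]
      refine integral_congr_ae ?_
      filter_upwards [hKA z] with x hx
      rw [hx, norm_mul]
    rw [h1, ← hA z]
    gcongr
    exact integral_norm_mul_le _ _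
  have hint : Integrable (fun p : Conf ι × Z => c p.2 * (K p.1 p.2 * (starRingEnd ℂ) (χ p.1)))
      (volume.prod μ) := by
    rw [integrable_prod_iff' hmeas]
    refine ⟨Filter.Eventually.of_forall fun z => (hint1 z).const_mul (c z), ?_⟩
    refine (hc.norm.mul_const ((r ^ 2 + ‖χ‖ ^ 2) / 2)).mono'
      hmeas.norm.prod_swap.integral_prod_right' (Filter.Eventually.of_forall fun z => ?_)
    rw [Real.norm_of_nonneg (integral_nonneg fun _ => norm_nonneg _)]
    exact hb z
  rw [integral_integral_swap hint]
  simp only [integral_const_mul, hin]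

/-- A pointwise superposition formula gives the superposition in `L²`. -/
theorem eq_integral_smul_weyl_of_ae [SFinite μ] (hv : Measurable v) (hc : Integrable c μ)
    {ψ φ : L2 ι} {g : Conf ι → ℂ} (hgm : Measurable g) (hg : ψ =ᵐ[volume] g)
    (hφ : φ =ᵐ[volume] fun x =>
      ∫ z, c z * (weylPhase ħ (v z) x * g (x + ħ • (v z).2)) ∂μ) :
    φ = ∫ z, c z • weyl ħ (v z) ψ ∂μ := by
  refine ext_inner_left ℂ fun χ => ?_
  have h1 := integral_integral_kernel_swap hc (measurable_weyl_kernel (ħ := ħ) hv hgm)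
    (fun z => norm_weyl_apply (v z) ψ) (fun z => weyl_apply_of_ae hg (v z)) χ
  rw [← integral_inner (integrable_smul_weyl hv hc ψ) χ]
  simp only [inner_smul_right]
  rw [← h1, L2.inner_def]
  refine integral_congr_ae ?_
  filter_upwards [hφ] with x hx
  rw [hx, RCLike.inner_apply, ← integral_mul_const]
  simp only [mul_assoc]

end Rep


/-! ### Fourier inversion in the normalization of the symbols. -/

section Hat

variable {E : Type*} [NormedAddCommGroup E] [InnerProductSpace ℝ E] [FiniteDimensional ℝ E]
  [MeasurableSpace E] [BorelSpace E]

theorem integral_exp_inner_eq_fourier (f : E → ℂ) (η : E) :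
    ∫ x, Complex.exp (-(I * ((inner ℝ η x : ℝ) : ℂ))) * f x = 𝓕 f ((2 * Real.pi)⁻¹ • η) := by
  have hπ := Real.pi_ne_zero
  rw [Real.fourier_eq']
  congr 1; ext x
  rw [smul_eq_mul]
  congr 2
  rw [inner_smul_right, real_inner_comm]
  have : -2 * Real.pi * ((2 * Real.pi)⁻¹ * inner ℝ x η) = - inner ℝ x η := by field_simp
  rw [this, real_inner_comm]; push_cast; ring

theorem integrable_fourier_of_integrable_exp_inner {f : E → ℂ}
    (h : Integrable fun η : E => ∫ x, Complex.exp (-(I * ((inner ℝ η x : ℝ) : ℂ))) * f x) :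
    Integrable (𝓕 f) := by
  simp only [integral_exp_inner_eq_fourier] at h
  rwa [integrable_comp_smul_iff volume (𝓕 f) (by positivity)] at h

theorem integral_fourier_scale (g : E → ℂ) : ∫ k, g k =
    (((2 * Real.pi) ^ Module.finrank ℝ E)⁻¹ : ℝ) * ∫ η, g ((2 * Real.pi)⁻¹ • η) := by
  rw [Measure.integral_comp_smul, Complex.real_smul, ← mul_assoc, ← Complex.ofReal_mul]
  have : ((2 * Real.pi) ^ Module.finrank ℝ E)⁻¹ *
      |((2 * Real.pi)⁻¹ ^ Module.finrank ℝ E)⁻¹| = 1 := by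
    rw [abs_of_pos (by positivity), inv_pow, inv_inv, inv_mul_cancel₀ (by positivity)]
  rw [this]; simp

/-- Fourier inversion in the normalization `f(x) = ∫ f̂(η) e^{iη·x} dη`, almost everywhere. -/
theorem ae_eq_integral_hat {f : E → ℂ} (hf : Integrable f)
    (h : Integrable fun η : E => ∫ x, Complex.exp (-(I * ((inner ℝ η x : ℝ) : ℂ))) * f x) :
    f =ᵐ[volume] fun x => ∫ η, ((((2 * Real.pi) ^ Module.finrank ℝ E)⁻¹ : ℝ) *
      ∫ y, Complex.exp (-(I * ((inner ℝ η y : ℝ) : ℂ))) * f y) *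
        Complex.exp (I * ((inner ℝ η x : ℝ) : ℂ)) := by
  have hπ := Real.pi_ne_zero
  refine (fourierInv_fourier_ae_eq hf (integrable_fourier_of_integrable_exp_inner h)).symm.trans
    (Filter.Eventually.of_forall fun x => ?_)
  simp only
  rw [Real.fourierInv_eq', integral_fourier_scale]
  simp only [integral_exp_inner_eq_fourier]
  rw [← integral_const_mul]
  congr 1; ext η
  have : 2 * Real.pi * ((2 * Real.pi)⁻¹ * inner ℝ η x) = inner ℝ η x := by field_simp
  rw [smul_eq_mul, inner_smul_left, conj_trivial, this]
  rw [mul_comm I]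
  ring

/-- Fourier inversion at the origin. -/
theorem integral_integral_exp_inner {k : E → ℂ} (hk : Integrable k) (hc : Continuous k)
    (h : Integrable fun η : E => ∫ x, Complex.exp (-(I * ((inner ℝ η x : ℝ) : ℂ))) * k x) :
    ∫ η : E, ∫ x, Complex.exp (-(I * ((inner ℝ η x : ℝ) : ℂ))) * k x =
      (((2 * Real.pi) ^ Module.finrank ℝ E : ℝ) : ℂ) * k 0 := by
  have h1 := hk.fourierInv_fourier_eq (integrable_fourier_of_integrable_exp_inner h)
    (hc.continuousAt (x := 0))
  rw [Real.fourierInv_eq'] at h1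
  simp only [inner_zero_right, mul_zero, Complex.ofReal_zero, zero_mul, Complex.exp_zero,
    one_smul] at h1
  simp only [integral_exp_inner_eq_fourier]
  rw [← h1, integral_fourier_scale (𝓕 k), ← mul_assoc, ← Complex.ofReal_mul,
    mul_inv_cancel₀ (by positivity), Complex.ofReal_one, one_mul]

end Hat

/-! ### Pair potentials as superpositions of Weyl operators. -/

section Potential

variable {σ : ℝ} {w : E3 → ℝ}

theorem norm_exp_mul (r : ℝ) (z : ℂ) : ‖(Real.exp r : ℂ) * z‖ = ‖z‖ * Real.exp r := by
  rw [norm_mul, Complex.norm_real, Real.norm_of_nonneg (Real.exp_pos _).le, mul_comm]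

theorem integrable_of_integrable_exp_mul {Z : Type*} [MeasurableSpace Z] {μ : Measure Z}
    {f : Z → ℂ} {s : Z → ℝ} (hs : Measurable s) (hs0 : ∀ z, 0 ≤ s z)
    (h : Integrable (fun z => (Real.exp (s z) : ℂ) * f z) μ) : Integrable f μ := by
  have h1 : Integrable (fun z => (Real.exp (-s z) : ℂ) * ((Real.exp (s z) : ℂ) * f z)) μ := by
    refine h.bdd_mul (c := 1) (Measurable.aestronglyMeasurable (by fun_prop))
      (Filter.Eventually.of_forall fun z => ?_)
    rw [Complex.norm_real, Real.norm_of_nonneg (Real.exp_pos _).le]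
    exact Real.exp_le_one_iff.mpr (neg_nonpos.mpr (hs0 z))
  refine h1.congr (Filter.Eventually.of_forall fun z => ?_)
  simp only
  rw [← mul_assoc, ← Complex.ofReal_mul, ← Real.exp_add, neg_add_cancel]
  simp

theorem IsPotential.integrable_potentialHat (hσ : 0 < σ) (hw : IsPotential σ w) :
    Integrable (potentialHat w) :=
  integrable_of_integrable_exp_mul (s := fun η => σ * ‖η‖) (by fun_prop)
    (fun _ => by positivity) hw.integrable_hat

theorem IsPotential.integrable_weight (hw : IsPotential σ w) :
    Integrable fun η => ‖potentialHat w η‖ * Real.exp (σ * ‖η‖) :=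
  hw.integrable_hat.norm.congr (Filter.Eventually.of_forall fun η => norm_exp_mul _ _)

theorem IsPotential.ae_eq (hσ : 0 < σ) (hw : IsPotential σ w) : (fun x => (w x : ℂ)) =ᵐ[volume]
    fun x => ∫ η, potentialHat w η * Complex.exp (I * ((inner ℝ η x : ℝ) : ℂ)) := by
  have h1 := hw.integrable_potentialHat hσ
  unfold potentialHat at h1
  have h2 : Integrable fun η : E3 =>
      ∫ x : E3, Complex.exp (-(I * ((inner ℝ η x : ℝ) : ℂ))) * (w x : ℂ) := by
    have := h1.const_mul ((((2 * Real.pi) ^ 3 : ℝ)) : ℂ)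
    refine this.congr (Filter.Eventually.of_forall fun η => ?_)
    simp only
    rw [← mul_assoc, ← Complex.ofReal_mul, mul_inv_cancel₀ (by positivity)]
    simp
  have h3 := ae_eq_integral_hat hw.integrable.ofReal h2
  simp only [finrank_euclideanSpace_fin] at h3
  exact h3

theorem IsPotential.norm_le (hσ : 0 < σ) (hw : IsPotential σ w) :
    ∀ᵐ x, ‖w x‖ ≤ ∫ η, ‖potentialHat w η‖ := by
  filter_upwards [hw.ae_eq hσ] with x hx
  rw [← Complex.norm_real, hx]
  refine (norm_integral_le_integral_norm _).trans (le_of_eq ?_)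
  congr 1; ext η
  rw [norm_mul, mul_comm I, Complex.norm_exp_ofReal_mul_I, mul_one]

variable {ι : Type} [Fintype ι] {i j : ι}

theorem measurable_pos (j : ι) : Measurable fun x : Conf ι => pos x j := by
  unfold pos
  refine (PiLp.continuous_toLp 2 _).measurable.comp (measurable_pi_iff.mpr fun c => ?_)
  exact (PiLp.continuous_apply 2 _ (j, c)).measurable

theorem pos_add (x y : Conf ι) (j : ι) : pos (x + y) j = pos x j + pos y j := rfl

theorem pos_smul (r : ℝ) (x : Conf ι) (j : ι) : pos (r • x) j = r • pos x j := rfl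

open Classical in
/-- The configuration with particle `i` at `η` and all others at the origin. -/
def single (i : ι) (η : E3) : Conf ι := WithLp.toLp 2 fun q => if q.1 = i then η q.2 else 0

theorem pos_single_self (i : ι) (η : E3) : pos (single i η) i = η := by
  ext c; simp [pos, single]

theorem pos_single_of_ne (h : j ≠ i) (η : E3) : pos (single i η) j = 0 := by
  ext c; simp [pos, single, h]

theorem inner_eq_sum_pos (x y : Conf ι) : inner ℝ x y = ∑ j, inner ℝ (pos x j) (pos y j) := by
  simp only [PiLp.inner_apply, pos, Fintype.sum_prod_type]

theorem inner_single (i : ι) (η : E3) (x : Conf ι) : inner ℝ (single i η) x = inner ℝ η (pos x i) := by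
  rw [inner_eq_sum_pos, Finset.sum_eq_single i, pos_single_self]
  · intro j _ hj
    rw [pos_single_of_ne hj, inner_zero_left]
  · simp

theorem continuous_single (i : ι) : Continuous (single (ι := ι) i) := by
  unfold single
  refine (PiLp.continuous_toLp 2 _).comp (continuous_pi fun q => ?_)
  split_ifs <;> fun_prop

/-- The momentum transfer `η` between particles `i` and `j`. -/
def transfer (i j : ι) (η : E3) : Conf ι := single i η - single j η

theorem continuous_transfer (i j : ι) : Continuous (transfer (ι := ι) i j) :=
  (continuous_single i).sub (continuous_single j)

theorem inner_transfer (i j : ι) (η : E3) (x : Conf ι) :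
    inner ℝ (transfer i j η) x = inner ℝ η (pos x i - pos x j) := by
  rw [transfer, inner_sub_left, inner_single, inner_single, inner_sub_right]

/-- A surjective linear map pulls null sets back to null sets. Thus evenness, boundedness and
Fourier inversion of `w`, known only almost everywhere on ℝ³, hold for `w (xᵢ - xⱼ)` almost
everywhere on configuration space. -/
theorem quasiMeasurePreserving_relative (hij : i ≠ j) :
    Measure.QuasiMeasurePreserving (fun x : Conf ι => pos x i - pos x j) volume volume := by
  let L : Conf ι →ₗ[ℝ] E3 :=
    { toFun := fun x => pos x i - pos x j
      map_add' := fun x y => by rw [pos_add, pos_add]; abel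
      map_smul' := fun r x => by rw [pos_smul, pos_smul, ← smul_sub]; rfl }
  have hs : Function.Surjective L := fun η => ⟨single i η, by
    change pos (single i η) i - pos (single i η) j = η
    rw [pos_single_self, pos_single_of_ne hij.symm, sub_zero]⟩
  obtain ⟨c, -, h⟩ := L.exists_map_addHaar_eq_smul_addHaar volume volume hs
  refine ⟨(measurable_pos i).sub (measurable_pos j), ?_⟩
  change Measure.map L volume ≪ volume
  rw [h]
  exact Measure.smul_absolutelyContinuous

theorem pairOp_apply (hσ : 0 < σ) (hw : IsPotential σ w) (hij : i ≠ j) (ψ : L2 ι) :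
    pairOp w i j ψ =ᵐ[volume] fun x => (w (pos x i - pos x j) : ℂ) * ψ x := by
  refine multOp_apply ?_ ψ
  have hq := quasiMeasurePreserving_relative hij
  refine memLp_top_of_bound (C := ∫ η, ‖potentialHat w η‖) ?_ ?_
  · exact Complex.continuous_ofReal.comp_aestronglyMeasurable
      (hw.integrable.aestronglyMeasurable.comp_quasiMeasurePreserving hq)
  · filter_upwards [hq.ae (hw.norm_le hσ)] with x hx
    rw [Complex.norm_real]; exact hx

theorem pairOp_swap (hσ : 0 < σ) (hw : IsPotential σ w) (hij : i ≠ j) :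
    pairOp w i j = pairOp w j i := by
  refine ContinuousLinearMap.ext fun ψ => Lp.ext ?_
  filter_upwards [pairOp_apply hσ hw hij ψ, pairOp_apply hσ hw hij.symm ψ,
    (quasiMeasurePreserving_relative hij).ae hw.even] with x h1 h2 h3
  rw [h1, h2, ← h3, neg_sub]

theorem inner_pairOp (hσ : 0 < σ) (hw : IsPotential σ w) (hij : i ≠ j) (φ ψ : L2 ι) :
    inner ℂ (pairOp w i j φ) ψ = inner ℂ φ (pairOp w i j ψ) := by
  rw [L2.inner_def, L2.inner_def]
  refine integral_congr_ae ?_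
  filter_upwards [pairOp_apply hσ hw hij φ, pairOp_apply hσ hw hij ψ] with x h1 h2
  rw [h1, h2, RCLike.inner_apply, RCLike.inner_apply, map_mul, Complex.conj_ofReal]
  ring

theorem measurable_transfer (i j : ι) :
    Measurable fun η : E3 => ((transfer i j η, 0) : Conf ι × Conf ι) :=
  (continuous_transfer i j).measurable.prodMk measurable_const

/-- Fourier inversion of `w`: the character `e^{iη·(xᵢ - xⱼ)}` is a Weyl operator without
translation part. -/
theorem isWeylIntegral_pairOp (hσ : 0 < σ) (hw : IsPotential σ w) (hij : i ≠ j) (ħ : ℝ) :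
    IsWeylIntegral ħ volume (potentialHat w) (fun η => ((transfer i j η, 0) : Conf ι × Conf ι))
      (pairOp w i j) := by
  refine ⟨measurable_transfer i j, hw.integrable_potentialHat hσ, fun ψ => ?_⟩
  refine eq_integral_smul_weyl_of_ae (measurable_transfer i j) (hw.integrable_potentialHat hσ)
    (Lp.stronglyMeasurable ψ).measurable Filter.EventuallyEq.rfl ?_
  filter_upwards [pairOp_apply hσ hw hij ψ,
    (quasiMeasurePreserving_relative hij).ae (hw.ae_eq hσ)] with x h1 h2
  rw [h1, h2, ← integral_mul_const]
  congr 1; ext η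
  rw [smul_zero, add_zero, mul_assoc]
  congr 2
  rw [weylPhase, inner_zero_right, mul_zero, add_zero, inner_transfer]

end Potential


theorem norm_exp_I_mul (r : ℝ) : ‖Complex.exp (I * (r : ℂ))‖ = 1 := by
  rw [mul_comm, Complex.norm_exp_ofReal_mul_I]

theorem norm_exp_neg_I_mul (r : ℝ) : ‖Complex.exp (-(I * (r : ℂ)))‖ = 1 := by
  rw [← mul_neg, ← Complex.ofReal_neg, norm_exp_I_mul]

/-! ### The oscillatory integral behind Weyl quantization. -/

section Shear

variable {V : Type*} [NormedAddCommGroup V] [InnerProductSpace ℝ V] [FiniteDimensional ℝ V]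
  [MeasurableSpace V] [BorelSpace V] {S : Type*} [MeasurableSpace S] {μ : Measure S} [SFinite μ]
  {c : S → ℂ} {q : S → V} {G : S → V → ℂ} {φ : V → ℂ}

omit [SFinite μ] in
theorem integrable_shear (hc : Integrable c μ) (hq : Measurable q)
    (hG : Measurable fun z : S × V => G z.1 z.2) (hφ : Integrable φ)
    (hGφ : ∀ s u, ‖G s u‖ ≤ ‖φ u‖) :
    Integrable (fun z : S × V => c z.1 * G z.1 (z.2 + q z.1)) (μ.prod volume) := by
  have hq' : Measurable fun z : S × V => q z.1 := hq.comp measurable_fst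
  have hp : Measurable fun z : S × V => (z.1, z.2 + q z.1) :=
    measurable_fst.prodMk (measurable_snd.add hq')
  have hm : AEStronglyMeasurable (fun z : S × V => c z.1 * G z.1 (z.2 + q z.1))
      (μ.prod volume) := hc.1.comp_fst.mul (hG.comp hp).aestronglyMeasurable
  have hGs : ∀ s, Measurable (G s) := fun s => hG.comp measurable_prodMk_left
  have hi : ∀ s, Integrable (fun u => G s (u + q s)) := fun s =>
    ((hφ.mono (hGs s).aestronglyMeasurable
      (Filter.Eventually.of_forall (hGφ s))).comp_add_right (q s))
  rw [integrable_prod_iff hm]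
  refine ⟨Filter.Eventually.of_forall fun s => (hi s).const_mul (c s), ?_⟩
  refine (hc.norm.mul_const (∫ u, ‖φ u‖)).mono' hm.norm.integral_prod_right'
    (Filter.Eventually.of_forall fun s => ?_)
  rw [Real.norm_of_nonneg (integral_nonneg fun _ => norm_nonneg _)]
  simp only [norm_mul]
  rw [integral_const_mul]
  refine mul_le_mul_of_nonneg_left ?_ (norm_nonneg _)
  rw [← integral_add_right_eq_self (fun u => ‖φ u‖) (q s)]
  exact integral_mono (hi s).norm (hφ.comp_add_right (q s)).norm fun u => hGφ s _

omit [SFinite μ] in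
theorem integrable_exp_inner_mul {f : S × V → ℂ} (hf : Integrable f (μ.prod volume)) (ξ : V) :
    Integrable (fun z => Complex.exp (-(I * ((inner ℝ ξ z.2 : ℝ) : ℂ))) * f z)
      (μ.prod volume) := by
  have h1 : Measurable fun z : S × V => inner ℝ ξ z.2 := measurable_snd.const_inner
  exact hf.bdd_mul (c := 1) (Measurable.aestronglyMeasurable (by fun_prop))
    (Filter.Eventually.of_forall fun z => (norm_exp_neg_I_mul _).le)

/-- Fourier transform of a superposition of modulated functions, as a superposition of
translates. -/
theorem integral_exp_shear (hc : Integrable c μ) (hq : Measurable q)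
    (hG : Measurable fun z : S × V => G z.1 z.2) (hφ : Integrable φ)
    (hGφ : ∀ s u, ‖G s u‖ ≤ ‖φ u‖) (ξ : V) :
    ∫ u, Complex.exp (-(I * ((inner ℝ ξ u : ℝ) : ℂ))) *
        ∫ s, c s * (Complex.exp (I * ((inner ℝ ξ (q s) : ℝ) : ℂ)) * G s u) ∂μ =
      ∫ r, Complex.exp (-(I * ((inner ℝ ξ r : ℝ) : ℂ))) * ∫ s, c s * G s (r + q s) ∂μ := by
  have hc' : Integrable (fun s => c s * Complex.exp (I * ((inner ℝ ξ (q s) : ℝ) : ℂ))) μ := by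
    have h1 : Measurable fun s => inner ℝ ξ (q s) := hq.const_inner
    exact hc.mul_bdd (c := 1) (Measurable.aestronglyMeasurable (by fun_prop))
      (Filter.Eventually.of_forall fun z => (norm_exp_I_mul _).le)
  have i1 := integrable_exp_inner_mul (integrable_shear hc' measurable_const hG hφ hGφ
    (q := fun _ => (0 : V))) ξ
  have i2 := integrable_exp_inner_mul (integrable_shear hc hq hG hφ hGφ) ξ
  simp only [add_zero] at i1
  have e1 : ∀ u, Complex.exp (-(I * ((inner ℝ ξ u : ℝ) : ℂ))) *
      ∫ s, c s * (Complex.exp (I * ((inner ℝ ξ (q s) : ℝ) : ℂ)) * G s u) ∂μ =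
      ∫ s, Complex.exp (-(I * ((inner ℝ ξ u : ℝ) : ℂ))) *
        (c s * Complex.exp (I * ((inner ℝ ξ (q s) : ℝ) : ℂ)) * G s u) ∂μ := fun u => by
    rw [integral_const_mul]; simp only [mul_assoc]
  simp only [e1, ← integral_const_mul]
  refine (integral_integral_swap (f := fun s u => Complex.exp (-(I * ((inner ℝ ξ u : ℝ) : ℂ))) *
    (c s * Complex.exp (I * ((inner ℝ ξ (q s) : ℝ) : ℂ)) * G s u)) i1).symm.trans
    (Eq.trans ?_ (integral_integral_swap (f := fun s r =>
      Complex.exp (-(I * ((inner ℝ ξ r : ℝ) : ℂ))) * (c s * G s (r + q s))) i2))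
  refine integral_congr_ae (Filter.Eventually.of_forall fun s => ?_)
  simp only
  -- The substitution `u = r + q s` removes the modulation `e^{i⟨ξ, q s⟩}`.
  rw [← integral_add_right_eq_self _ (q s)]
  congr 1; ext r
  have : Complex.exp (-(I * ((inner ℝ ξ (r + q s) : ℝ) : ℂ))) *
      Complex.exp (I * ((inner ℝ ξ (q s) : ℝ) : ℂ)) =
      Complex.exp (-(I * ((inner ℝ ξ r : ℝ) : ℂ))) := by
    rw [← Complex.exp_add, inner_add_right]
    congr 1
    push_cast; ring
  rw [← this]
  ring

/-- A rigorous form of `∫ e^{-iξ·(u - q)} dξ = (2π)^d δ(u - q)`. Turning modulations into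
translations exhibits the `u`-integral as the Fourier transform of one continuous integrable
function, and inversion at the origin evaluates the `ξ`-integral. -/
theorem integral_integral_exp_shear (hc : Integrable c μ) (hq : Measurable q)
    (hG : Measurable fun z : S × V => G z.1 z.2) (hGc : ∀ s, Continuous (G s))
    (hφ : Integrable φ) {C : ℝ} (hC : ∀ u, ‖φ u‖ ≤ C) (hGφ : ∀ s u, ‖G s u‖ ≤ ‖φ u‖)
    (hint : Integrable fun ξ => ∫ u, Complex.exp (-(I * ((inner ℝ ξ u : ℝ) : ℂ))) *
        ∫ s, c s * (Complex.exp (I * ((inner ℝ ξ (q s) : ℝ) : ℂ)) * G s u) ∂μ) :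
    ∫ ξ, ∫ u, Complex.exp (-(I * ((inner ℝ ξ u : ℝ) : ℂ))) *
        ∫ s, c s * (Complex.exp (I * ((inner ℝ ξ (q s) : ℝ) : ℂ)) * G s u) ∂μ =
      (((2 * Real.pi) ^ Module.finrank ℝ V : ℝ) : ℂ) * ∫ s, c s * G s (q s) ∂μ := by
  simp only [integral_exp_shear hc hq hG hφ hGφ] at hint ⊢
  have hk := (integrable_shear hc hq hG hφ hGφ).integral_prod_right
  have hm : ∀ r, AEStronglyMeasurable (fun s => c s * G s (r + q s)) μ := fun r =>
    hc.1.mul (hG.comp (measurable_id.prodMk (hq.const_add r))).aestronglyMeasurable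
  have hcont : Continuous fun r => ∫ s, c s * G s (r + q s) ∂μ := by
    refine continuous_of_dominated hm (bound := fun s => ‖c s‖ * C)
      (fun r => Filter.Eventually.of_forall fun s => ?_) (hc.norm.mul_const C)
      (Filter.Eventually.of_forall fun s => ?_)
    · rw [norm_mul]
      exact mul_le_mul_of_nonneg_left ((hGφ _ _).trans (hC _)) (norm_nonneg _)
    · exact continuous_const.mul ((hGc s).comp (by fun_prop))
  rw [integral_integral_exp_inner hk hcont hint]
  simp only [zero_add]

end Shear

/-! ### Weyl quantizations as superpositions of Weyl operators. -/

section Symbol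

variable {p : ℕ} {σ : ℝ} {τ : Phase p → ℂ}

theorem measurable_phaseNorm : Measurable (phaseNorm (p := p)) := by
  unfold phaseNorm
  refine Finset.measurable_sum _ fun j _ => ?_
  exact ((measurable_pos j).comp measurable_fst).norm.add
    ((measurable_pos j).comp measurable_snd).norm

theorem phaseNorm_nonneg (s : Phase p) : 0 ≤ phaseNorm s :=
  Finset.sum_nonneg fun _ _ => by positivity

theorem IsSymbol.integrable_symbolHat (hσ : 0 < σ) (hτ : IsSymbol σ τ) :
    Integrable (symbolHat τ) :=
  integrable_of_integrable_exp_mul (s := fun s => σ * phaseNorm s)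
    (measurable_phaseNorm.const_mul σ) (fun s => mul_nonneg hσ.le (phaseNorm_nonneg s)) hτ.2

theorem IsSymbol.integrable_weight (hτ : IsSymbol σ τ) :
    Integrable fun s => ‖symbolHat τ s‖ * Real.exp (σ * phaseNorm s) :=
  hτ.2.norm.congr (Filter.Eventually.of_forall fun _ => norm_exp_mul _ _)

theorem finrank_conf (ι : Type) [Fintype ι] : Module.finrank ℝ (Conf ι) = 3 * Fintype.card ι := by
  rw [finrank_euclideanSpace, Fintype.card_prod, Fintype.card_fin, mul_comm]

theorem finrank_withLp_phase (p : ℕ) :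
    Module.finrank ℝ (WithLp 2 (Conf (Fin p) × Conf (Fin p))) = 6 * p := by
  rw [(WithLp.linearEquiv 2 ℝ (Conf (Fin p) × Conf (Fin p))).finrank_eq, Module.finrank_prod,
    finrank_conf, Fintype.card_fin]
  ring

/-- `Phase p` is a plain product without inner product; the measure-preserving passage to `WithLp 2`
makes Fourier inversion applicable. -/
theorem symbolHat_withLp (s : WithLp 2 (Conf (Fin p) × Conf (Fin p))) :
    symbolHat τ (WithLp.ofLp s) = (((2 * Real.pi) ^ (6 * p))⁻¹ : ℝ) *
      ∫ z : WithLp 2 (Conf (Fin p) × Conf (Fin p)),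
        Complex.exp (-(I * ((inner ℝ s z : ℝ) : ℂ))) * τ (WithLp.ofLp z) := by
  rw [symbolHat]
  congr 1
  exact ((WithLp.volume_preserving_symm_measurableEquiv_toLp_prod (Conf (Fin p))
    (Conf (Fin p))).integral_comp' (fun z : Phase p => Complex.exp (-(I *
      ((inner ℝ s.fst z.1 + inner ℝ s.snd z.2 : ℝ) : ℂ))) * τ z)).symm

theorem IsSymbol.ae_eq (hσ : 0 < σ) (hτ : IsSymbol σ τ) : τ =ᵐ[volume] fun z =>
    ∫ s, symbolHat τ s * Complex.exp (I * ((inner ℝ s.1 z.1 + inner ℝ s.2 z.2 : ℝ) : ℂ)) := by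
  have hv := WithLp.volume_preserving_symm_measurableEquiv_toLp_prod (Conf (Fin p)) (Conf (Fin p))
  have h1 : Integrable fun z : WithLp 2 (Conf (Fin p) × Conf (Fin p)) => τ (WithLp.ofLp z) :=
    hv.integrable_comp_of_integrable hτ.1
  have h2 : Integrable fun s : WithLp 2 (Conf (Fin p) × Conf (Fin p)) =>
      symbolHat τ (WithLp.ofLp s) := hv.integrable_comp_of_integrable (hτ.integrable_symbolHat hσ)
  have h3 := h2.const_mul ((((2 * Real.pi) ^ (6 * p) : ℝ)) : ℂ)
  simp only [symbolHat_withLp, ← mul_assoc, ← Complex.ofReal_mul] at h3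
  rw [mul_inv_cancel₀ (by positivity)] at h3
  simp only [Complex.ofReal_one, one_mul] at h3
  have h4 := ae_eq_integral_hat h1 h3
  simp only [finrank_withLp_phase, ← symbolHat_withLp] at h4
  have hv' := WithLp.volume_preserving_toLp (Conf (Fin p)) (Conf (Fin p))
  filter_upwards [hv'.quasiMeasurePreserving.ae h4] with z hz
  refine hz.trans ?_
  exact hv.integral_comp' (fun s : Phase p => symbolHat τ s *
    Complex.exp (I * ((inner ℝ s.1 z.1 + inner ℝ s.2 z.2 : ℝ) : ℂ)))

/-- For every fixed `x`, integrability of `τ` and almost everywhere identities for `τ` pass to the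
Weyl kernel at the midpoint. -/
theorem map_midpoint (x : Conf (Fin p)) : ∃ C : ℝ≥0∞, C ≠ ⊤ ∧
    MeasurePreserving (fun q : Phase p => ((2⁻¹ : ℝ) • (x + q.1), q.2)) volume (C • volume) := by
  refine ⟨ENNReal.ofReal |((2⁻¹ : ℝ) ^ Module.finrank ℝ (Conf (Fin p)))⁻¹|,
    ENNReal.ofReal_ne_top, ?_⟩
  have h1 : MeasurePreserving (fun y : Conf (Fin p) => (2⁻¹ : ℝ) • (x + y)) volume
      (ENNReal.ofReal |((2⁻¹ : ℝ) ^ Module.finrank ℝ (Conf (Fin p)))⁻¹| • volume) := by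
    have h2 : MeasurePreserving (fun y : Conf (Fin p) => (2⁻¹ : ℝ) • y) volume
        (ENNReal.ofReal |((2⁻¹ : ℝ) ^ Module.finrank ℝ (Conf (Fin p)))⁻¹| • volume) :=
      ⟨measurable_const_smul _, Measure.map_addHaar_smul volume (by norm_num)⟩
    exact h2.comp (measurePreserving_add_left volume x)
  have h3 := h1.prod (MeasurePreserving.id (volume : Measure (Conf (Fin p))))
  rw [Measure.prod_smul_left] at h3
  exact h3

theorem integral_comp_affine {V : Type*} [NormedAddCommGroup V] [InnerProductSpace ℝ V]
    [FiniteDimensional ℝ V] [MeasurableSpace V] [BorelSpace V] {r : ℝ} (hr : 0 < r) (x : V)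
    (f : V → ℂ) : ∫ y, f y = ((r ^ Module.finrank ℝ V : ℝ) : ℂ) * ∫ u, f (x + r • u) := by
  rw [Measure.integral_comp_smul volume (fun u => f (x + u)) r, integral_add_left_eq_self,
    Complex.real_smul, ← mul_assoc, ← Complex.ofReal_mul, abs_of_pos (by positivity),
    mul_inv_cancel₀ (by positivity), Complex.ofReal_one, one_mul]

/-- The integrand of the Weyl quantization at the point `x`. -/
def weylIntegrand (ħ : ℝ) (τ : Phase p → ℂ) (ψ : Conf (Fin p) → ℂ) (x : Conf (Fin p))
    (q : Phase p) : ℂ :=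
  τ ((2⁻¹ : ℝ) • (x + q.1), q.2) *
    Complex.exp (I * ((inner ℝ (x - q.1) q.2 / ħ : ℝ) : ℂ)) * ψ q.1

theorem integrable_weylIntegrand (ħ : ℝ) (hτ : Integrable τ) (ψ : 𝓢(Conf (Fin p), ℂ))
    (x : Conf (Fin p)) : Integrable (weylIntegrand ħ τ ψ x) := by
  obtain ⟨C, hC, hm⟩ := map_midpoint x
  have h1 := hm.integrable_comp_of_integrable (hτ.smul_measure hC)
  have hD := ψ.toBoundedContinuousFunction.norm_coe_le_norm
  have h2 : Continuous fun q : Phase p =>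
      Complex.exp (I * ((inner ℝ (x - q.1) q.2 / ħ : ℝ) : ℂ)) * ψ q.1 := by
    have := ψ.continuous
    fun_prop
  have h3 := h1.mul_bdd (c := ‖ψ.toBoundedContinuousFunction‖) h2.aestronglyMeasurable
    (Filter.Eventually.of_forall fun q => by
      rw [norm_mul, norm_exp_I_mul, one_mul]; exact hD _)
  refine h3.congr (Filter.Eventually.of_forall fun q => ?_)
  simp only [weylIntegrand, Function.comp_apply, mul_assoc]

theorem weylIntegrand_congr (ħ : ℝ) {τ' : Phase p → ℂ} (h : τ =ᵐ[volume] τ')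
    (ψ : Conf (Fin p) → ℂ) (x : Conf (Fin p)) :
    weylIntegrand ħ τ ψ x =ᵐ[volume] weylIntegrand ħ τ' ψ x := by
  obtain ⟨C, -, hm⟩ := map_midpoint x
  have hq := hm.quasiMeasurePreserving.mono_right (Measure.smul_absolutelyContinuous)
  filter_upwards [hq.ae h] with q hq
  simp only [weylIntegrand, hq]

/-- Insert `τ(z) = ∫ τ̂(s) e^{i⟨s,z⟩} ds` and put `y = x + ħ u`: the momentum integral forces `u =
s.2`. The midpoint `x + (ħ/2) u` leaves the half-phase of `weylPhase`, and the constant is `ħ^{3p}`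
from the substitution times `(2π)^{3p}` from inversion. -/
theorem integral_weylIntegrand {ħ : ℝ} (hħ : 0 < ħ) (hσ : 0 < σ) (hτ : IsSymbol σ τ)
    (ψ : 𝓢(Conf (Fin p), ℂ)) (x : Conf (Fin p)) :
    ∫ q, weylIntegrand ħ τ ψ x q = (((2 * Real.pi * ħ) ^ (3 * p) : ℝ) : ℂ) *
      ∫ s, symbolHat τ s * (weylPhase ħ s x * ψ (x + ħ • s.2)) := by
  set τ' : Phase p → ℂ := fun z => ∫ s, symbolHat τ s *
    Complex.exp (I * ((inner ℝ s.1 z.1 + inner ℝ s.2 z.2 : ℝ) : ℂ)) with hτ'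
  have hi := integrable_weylIntegrand ħ hτ.1 ψ x
  have he := weylIntegrand_congr ħ (hτ.ae_eq hσ) ψ x
  have hi' : Integrable (weylIntegrand ħ τ' ψ x) := hi.congr he
  -- What is left of the integrand once the plane waves in the momentum `ξ` are split off.
  let G : Phase p → Conf (Fin p) → ℂ := fun s u =>
    Complex.exp (I * ((inner ℝ s.1 (x + (ħ / 2) • u) : ℝ) : ℂ)) * ψ (x + ħ • u)
  have hGc : Continuous fun z : Phase p × Conf (Fin p) => G z.1 z.2 := by
    have := ψ.continuous
    fun_prop
  have hF : ∀ ξ u, weylIntegrand ħ τ' ψ x (x + ħ • u, ξ) =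
      Complex.exp (-(I * ((inner ℝ ξ u : ℝ) : ℂ))) * ∫ s, symbolHat τ s *
        (Complex.exp (I * ((inner ℝ ξ s.2 : ℝ) : ℂ)) * G s u) := by
    intro ξ u
    have e1 : inner ℝ (x - (x + ħ • u)) ξ / ħ = -inner ℝ ξ u := by
      rw [sub_add_cancel_left, inner_neg_left, inner_smul_left, real_inner_comm, conj_trivial]
      field_simp
    have e2 : (2⁻¹ : ℝ) • (x + (x + ħ • u)) = x + (ħ / 2) • u := by
      rw [← add_assoc, ← two_smul ℝ x, smul_add, smul_smul, smul_smul]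
      norm_num
      congr 1; ring
    simp only [weylIntegrand, e1, e2, hτ']
    rw [Complex.ofReal_neg, mul_neg, mul_assoc, mul_comm, mul_assoc]
    congr 1
    rw [← integral_const_mul]
    congr 1; ext s
    have e3 : Complex.exp (I * ((inner ℝ s.1 (x + (ħ / 2) • u) + inner ℝ s.2 ξ : ℝ) : ℂ)) =
        Complex.exp (I * ((inner ℝ ξ s.2 : ℝ) : ℂ)) *
          Complex.exp (I * ((inner ℝ s.1 (x + (ħ / 2) • u) : ℝ) : ℂ)) := by
      rw [← Complex.exp_add, real_inner_comm ξ s.2]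
      congr 1; push_cast; ring
    rw [e3]
    simp only [G]
    ring
  have hφ : Integrable fun u => ψ (x + ħ • u) :=
    (integrable_comp_smul_iff volume (fun u => ψ (x + u)) hħ.ne').mpr
      (ψ.integrable.comp_add_left x)
  have hmain := integral_integral_exp_shear (hτ.integrable_symbolHat hσ) (q := fun s => s.2)
    measurable_snd (G := G) hGc.measurable (fun s => by fun_prop) hφ
    (fun u => ψ.toBoundedContinuousFunction.norm_coe_le_norm _)
    (fun s u => by rw [norm_mul, norm_exp_I_mul, one_mul])
  have hslice : ∀ ξ, ∫ y, weylIntegrand ħ τ' ψ x (y, ξ) =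
      ((ħ ^ Module.finrank ℝ (Conf (Fin p)) : ℝ) : ℂ) *
        ∫ u, weylIntegrand ħ τ' ψ x (x + ħ • u, ξ) := fun ξ =>
    integral_comp_affine hħ x fun y => weylIntegrand ħ τ' ψ x (y, ξ)
  have hint : Integrable fun ξ => ∫ u, weylIntegrand ħ τ' ψ x (x + ħ • u, ξ) := by
    have h1 := hi'.integral_prod_right.const_mul
      (((ħ ^ Module.finrank ℝ (Conf (Fin p)) : ℝ) : ℂ)⁻¹)
    refine h1.congr (Filter.Eventually.of_forall fun ξ => ?_)
    simp only
    rw [hslice, inv_mul_cancel_left₀]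
    exact_mod_cast (pow_pos hħ _).ne'
  simp only [hF] at hint
  rw [integral_congr_ae he]
  refine (integral_prod_symm _ hi').trans ?_
  simp only [hslice, hF]
  rw [integral_const_mul, hmain hint, ← mul_assoc, ← Complex.ofReal_mul, ← mul_pow, finrank_conf,
    Fintype.card_fin]
  congr 2
  · congr 1; ring
  · ext s
    congr 2
    simp only [G]
    rw [weylPhase, inner_add_right, inner_smul_right]

/-- A Weyl quantization is the superposition of Weyl operators with amplitude `τ̂`. -/
theorem IsWeylQuantization.isWeylIntegral {ħ : ℝ} (hħ : 0 < ħ) (hσ : 0 < σ)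
    (hτ : IsSymbol σ τ) {a : L2 (Fin p) →L[ℂ] L2 (Fin p)} (ha : IsWeylQuantization ħ τ a) :
    IsWeylIntegral ħ volume (symbolHat τ) (fun s : Phase p => (s : Conf (Fin p) × Conf (Fin p)))
      a := by
  obtain ⟨T, hT⟩ := exists_isWeylIntegral (ħ := ħ) (ι := Fin p)
    (v := fun s : Phase p => (s : Conf (Fin p) × Conf (Fin p))) measurable_id
    (hτ.integrable_symbolHat hσ)
  suffices a = T by rw [this]; exact hT
  have hd : DenseRange (SchwartzMap.toLpCLM ℝ ℂ 2 (volume : Measure (Conf (Fin p)))) :=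
    SchwartzMap.denseRange_toLpCLM ENNReal.ofNat_ne_top
  refine ContinuousLinearMap.ext fun ψ => hd.induction_on (p := fun ψ => a ψ = T ψ) ψ
    (isClosed_eq a.continuous T.continuous) fun f => ?_
  change a (f.toLp 2) = T (f.toLp 2)
  rw [hT.apply_eq]
  refine eq_integral_smul_weyl_of_ae measurable_id (hτ.integrable_symbolHat hσ)
    f.continuous.measurable (SchwartzMap.coeFn_toLp f 2 volume) ?_
  filter_upwards [ha f] with x hx
  rw [hx]
  have h := integral_weylIntegrand hħ hσ hτ f x
  simp only [weylIntegrand] at h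
  rw [h, ← mul_assoc, ← Complex.ofReal_mul, inv_mul_cancel₀ (by positivity), Complex.ofReal_one,
    one_mul]
  rfl

end Symbol


/-! ### Sizes of phase space vectors. -/

section Size

variable {ι : Type} [Fintype ι]

/-- The size of the `j`-th component of a phase space vector. -/
def psize (v : Conf ι × Conf ι) (j : ι) : ℝ := ‖pos v.1 j‖ + ‖pos v.2 j‖

/-- The size of a phase space vector, summed over the particles. -/
def wsize (v : Conf ι × Conf ι) : ℝ := ∑ j, psize v j

theorem psize_nonneg (v : Conf ι × Conf ι) (j : ι) : 0 ≤ psize v j := by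
  unfold psize; positivity

theorem wsize_nonneg (v : Conf ι × Conf ι) : 0 ≤ wsize v :=
  Finset.sum_nonneg fun j _ => psize_nonneg v j

theorem measurable_wsize : Measurable (wsize (ι := ι)) := by
  unfold wsize psize
  refine Finset.measurable_sum _ fun j _ => ?_
  exact ((measurable_pos j).comp measurable_fst).norm.add
    ((measurable_pos j).comp measurable_snd).norm

theorem wsize_add_le (v v' : Conf ι × Conf ι) : wsize (v + v') ≤ wsize v + wsize v' := by
  unfold wsize
  rw [← Finset.sum_add_distrib]
  refine Finset.sum_le_sum fun j _ => ?_
  unfold psize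
  rw [Prod.fst_add, Prod.snd_add, pos_add, pos_add]
  have h1 := norm_add_le (pos v.1 j) (pos v'.1 j)
  have h2 := norm_add_le (pos v.2 j) (pos v'.2 j)
  linarith

theorem psize_freeFlow_le (t : ℝ) (v : Conf ι × Conf ι) (j : ι) :
    psize (freeFlow t v) j ≤ (1 + |t|) * psize v j := by
  unfold psize freeFlow
  rw [pos_add, pos_smul]
  have h := norm_add_le (pos v.2 j) (t • pos v.1 j)
  rw [norm_smul, Real.norm_eq_abs] at h
  nlinarith [norm_nonneg (pos v.1 j), norm_nonneg (pos v.2 j), abs_nonneg t]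

theorem wsize_freeFlow_le (t : ℝ) (v : Conf ι × Conf ι) :
    wsize (freeFlow t v) ≤ (1 + |t|) * wsize v := by
  unfold wsize
  rw [Finset.mul_sum]
  exact Finset.sum_le_sum fun j _ => psize_freeFlow_le t v j

theorem pos_sub (x y : Conf ι) (j : ι) : pos (x - y) j = pos x j - pos y j := rfl

theorem sum_norm_pos_single (i : ι) (η : E3) : ∑ j, ‖pos (single i η) j‖ = ‖η‖ := by
  rw [Finset.sum_eq_single i, pos_single_self]
  · intro j _ hj
    rw [pos_single_of_ne hj, norm_zero]
  · simp

theorem wsize_transfer_le (i j : ι) (η : E3) : wsize (transfer i j η, 0) ≤ 2 * ‖η‖ := by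
  have h : ∀ k, psize (transfer i j η, 0) k ≤ ‖pos (single i η) k‖ + ‖pos (single j η) k‖ := by
    intro k
    have h0 : pos (0 : Conf ι) k = 0 := rfl
    unfold psize transfer
    rw [pos_sub, h0, norm_zero, add_zero]
    exact norm_sub_le _ _
  refine (Finset.sum_le_sum fun k _ => h k).trans ?_
  rw [Finset.sum_add_distrib, sum_norm_pos_single, sum_norm_pos_single]
  linarith

/-- A momentum transfer between `i` and `j` pairs only with the components of `v` at these two
particles. Summed over `i` with a partner of size zero, this costs only `wsize v`, not a number of
particles. -/
theorem abs_sympl_transfer_le {κ s : ℝ} (hκ : 1 + |s| ≤ κ) (i j : ι) (η : E3)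
    (v : Conf ι × Conf ι) : |sympl (freeFlow s (transfer i j η, 0)) v| ≤
      κ * ‖η‖ * (psize v i + psize v j) := by
  unfold sympl freeFlow psize
  rw [zero_add, inner_smul_right, real_inner_comm, inner_transfer, inner_transfer]
  have h1 := (abs_real_inner_le_norm η (pos v.1 i - pos v.1 j)).trans
    (mul_le_mul_of_nonneg_left (norm_sub_le _ _) (norm_nonneg η))
  have h2 := (abs_real_inner_le_norm η (pos v.2 i - pos v.2 j)).trans
    (mul_le_mul_of_nonneg_left (norm_sub_le _ _) (norm_nonneg η))
  have h3 := abs_sub (s * inner ℝ η (pos v.1 i - pos v.1 j)) (inner ℝ η (pos v.2 i - pos v.2 j))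
  rw [abs_mul] at h3
  have hs := abs_nonneg s
  have h4 := mul_le_mul_of_nonneg_left h1 hs
  have hη := norm_nonneg η
  have n1 := norm_nonneg (pos v.1 i)
  have n2 := norm_nonneg (pos v.1 j)
  have n3 := norm_nonneg (pos v.2 i)
  have n4 := norm_nonneg (pos v.2 j)
  refine h3.trans ((add_le_add h4 h2).trans ?_)
  have h5 : |s| * (‖η‖ * (‖pos v.1 i‖ + ‖pos v.1 j‖)) ≤
      κ * (‖η‖ * (‖pos v.1 i‖ + ‖pos v.1 j‖)) :=
    mul_le_mul_of_nonneg_right (by linarith) (by positivity)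
  have h6 : 1 * (‖η‖ * (‖pos v.2 i‖ + ‖pos v.2 j‖)) ≤
      κ * (‖η‖ * (‖pos v.2 i‖ + ‖pos v.2 j‖)) :=
    mul_le_mul_of_nonneg_right (by linarith) (by positivity)
  linarith

variable {m N : ℕ}

theorem psize_extPhase_castLE (h : m ≤ N) (v : Conf (Fin m) × Conf (Fin m)) (j : Fin m) :
    psize (extPhase m N v) (Fin.castLE h j) = psize v j := by
  have e : ∀ x : Conf (Fin m), pos (extZero m N x) (Fin.castLE h j) = pos x j := fun x => by
    ext c
    simp [pos, extZero]
  simp only [psize, extPhase, e]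

theorem psize_extPhase_of_le (v : Conf (Fin m) × Conf (Fin m)) (j : Fin N) (hj : m ≤ j.val) :
    psize (extPhase m N v) j = 0 := by
  have e : ∀ x : Conf (Fin m), pos (extZero m N x) j = 0 := fun x => by
    ext c
    simp [pos, extZero, hj]
  simp only [psize, extPhase, e, norm_zero, add_zero]

theorem wsize_extPhase (h : m ≤ N) (v : Conf (Fin m) × Conf (Fin m)) :
    wsize (extPhase m N v) = wsize v := by
  unfold wsize
  have hinj : Function.Injective (Fin.castLE h) := Fin.castLE_injective h
  simp only [← psize_extPhase_castLE h v]
  symm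
  rw [← Finset.sum_image (s := Finset.univ) (g := Fin.castLE h)
    (f := fun j => psize (extPhase m N v) j) (fun a _ b _ hab => hinj hab)]
  refine Finset.sum_subset (Finset.subset_univ _) fun j _ hj => ?_
  refine psize_extPhase_of_le v j (not_lt.mp fun hlt => hj ?_)
  exact Finset.mem_image.mpr ⟨⟨j, hlt⟩, Finset.mem_univ _, rfl⟩

end Size

/-! ### Weighted norms of superpositions. -/

section Bound

variable {ι : Type} [Fintype ι] {ħ ρ ρ' B B' : ℝ} {T T' : L2 ι →L[ℂ] L2 ι}

/-- `T` is a superposition `∫ c(z) W(v(z)) dz` of Weyl operators with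
`∫ |c(z)| e^{ρ |v(z)|} dz ≤ B`. -/
def WeylBound (ħ ρ B : ℝ) (T : L2 ι →L[ℂ] L2 ι) : Prop :=
  ∃ (Z : Type) (_ : MeasurableSpace Z) (μ : Measure Z) (_ : SFinite μ) (c : Z → ℂ)
    (v : Z → Conf ι × Conf ι), IsWeylIntegral ħ μ c v T ∧
      Integrable (fun z => ‖c z‖ * Real.exp (ρ * wsize (v z))) μ ∧
      ∫ z, ‖c z‖ * Real.exp (ρ * wsize (v z)) ∂μ ≤ B

namespace WeylBound

theorem integrable_of_le {Z : Type} [MeasurableSpace Z] {μ : Measure Z} {c : Z → ℂ}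
    (hc : AEStronglyMeasurable c μ) {s s' : Z → ℝ} (hs' : Measurable s') (h : ∀ z, s' z ≤ s z)
    (hi : Integrable (fun z => ‖c z‖ * Real.exp (s z)) μ) :
    Integrable (fun z => ‖c z‖ * Real.exp (s' z)) μ ∧
      ∫ z, ‖c z‖ * Real.exp (s' z) ∂μ ≤ ∫ z, ‖c z‖ * Real.exp (s z) ∂μ := by
  have hle : ∀ z, ‖c z‖ * Real.exp (s' z) ≤ ‖c z‖ * Real.exp (s z) := fun z =>
    mul_le_mul_of_nonneg_left (Real.exp_le_exp.mpr (h z)) (norm_nonneg _)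
  have hi' : Integrable (fun z => ‖c z‖ * Real.exp (s' z)) μ := by
    refine hi.mono' (hc.norm.mul (Real.measurable_exp.comp hs').aestronglyMeasurable)
      (Filter.Eventually.of_forall fun z => ?_)
    rw [Real.norm_of_nonneg (by positivity)]
    exact hle z
  exact ⟨hi', integral_mono hi' hi hle⟩

theorem mono (h : WeylBound ħ ρ B T) (hρ : ρ' ≤ ρ) (hB : B ≤ B') : WeylBound ħ ρ' B' T := by
  obtain ⟨Z, _, μ, _, c, v, hT, hi, hb⟩ := h
  obtain ⟨hi', hb'⟩ := integrable_of_le hT.integrable.1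
    ((measurable_wsize.comp hT.measurable).const_mul ρ')
    (fun z => mul_le_mul_of_nonneg_right hρ (wsize_nonneg _)) hi
  exact ⟨Z, _, μ, ‹_›, c, v, hT, hi', hb'.trans (hb.trans hB)⟩

theorem norm_le (h : WeylBound ħ ρ B T) (hρ : 0 ≤ ρ) : ‖T‖ ≤ B := by
  obtain ⟨Z, _, μ, _, c, v, hT, hi, hb⟩ := h.mono hρ le_rfl
  simp only [zero_mul, Real.exp_zero, mul_one] at hb
  exact hT.norm_le.trans hb

/-- The flow stretches sizes by at most `1 + |t|`; shrinking the weight by this factor keeps the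
bound `B`. -/
theorem heisenberg_free (h : WeylBound ħ ρ B T) (hħ : ħ ≠ 0) {t : ℝ} (hρ0 : 0 ≤ ρ')
    (hρ : ρ' * (1 + |t|) ≤ ρ) : WeylBound ħ ρ' B (heisenberg (freeGroup ι ħ) t T) := by
  obtain ⟨Z, _, μ, _, c, v, hT, hi, hb⟩ := h
  have hT' := hT.heisenberg_free hħ t
  have hle : ∀ z, ρ' * wsize (freeFlow t (v z)) ≤ ρ * wsize (v z) := fun z =>
    calc ρ' * wsize (freeFlow t (v z)) ≤ ρ' * ((1 + |t|) * wsize (v z)) :=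
        mul_le_mul_of_nonneg_left (wsize_freeFlow_le t _) hρ0
      _ ≤ ρ * wsize (v z) := by
        rw [← mul_assoc]
        exact mul_le_mul_of_nonneg_right hρ (wsize_nonneg _)
  obtain ⟨hi', hb'⟩ := integrable_of_le hT.integrable.1
    ((measurable_wsize.comp hT'.measurable).const_mul ρ') hle hi
  exact ⟨Z, _, μ, ‹_›, c, _, hT', hi', hb'.trans hb⟩

theorem ampliation {m N : ℕ} {T : L2 (Fin m) →L[ℂ] L2 (Fin m)} (h : WeylBound ħ ρ B T)
    (hmN : m ≤ N) : WeylBound ħ ρ B (MeanField.ampliation hmN T) := by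
  obtain ⟨Z, _, μ, _, c, v, hT, hi, hb⟩ := h
  refine ⟨Z, _, μ, ‹_›, c, _, hT.ampliation hmN, ?_, ?_⟩ <;>
    simpa only [wsize_extPhase hmN]

theorem isAmpliation {m N : ℕ} {T : L2 (Fin m) →L[ℂ] L2 (Fin m)} (h : WeylBound ħ ρ B T)
    (hmN : m ≤ N) : IsAmpliation hmN T (MeanField.ampliation hmN T) := by
  obtain ⟨Z, _, μ, _, c, v, hT, -, -⟩ := h
  exact hT.isAmpliation hmN

theorem const_smul (h : WeylBound ħ ρ B T) (r : ℂ) : WeylBound ħ ρ (‖r‖ * B) (r • T) := by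
  obtain ⟨Z, _, μ, _, c, v, hT, hi, hb⟩ := h
  refine ⟨Z, _, μ, ‹_›, _, v, hT.const_smul r, ?_, ?_⟩ <;> simp only [norm_mul, mul_assoc]
  · exact hi.const_mul _
  · rw [integral_const_mul]
    exact mul_le_mul_of_nonneg_left hb (norm_nonneg _)

theorem _root_.MeanField.IsWeylIntegral.integral_norm_commutator_le {Z Z' : Type}
    [MeasurableSpace Z] [MeasurableSpace Z'] {μ : Measure Z} {μ' : Measure Z'} [SFinite μ]
    [SFinite μ'] {c : Z → ℂ} {c' : Z' → ℂ} {v : Z → Conf ι × Conf ι} {v' : Z' → Conf ι × Conf ι}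
    (hT : IsWeylIntegral ħ μ c v T) (hT' : IsWeylIntegral ħ μ' c' v' T') :
    ∫ z : Z × Z', ‖c z.1 * c' z.2 * (2 * I * Real.sin (ħ / 2 * sympl (v z.1) (v' z.2)) : ℂ)‖
      ∂(μ.prod μ') ≤ 2 * ((∫ z, ‖c z‖ ∂μ) * ∫ z, ‖c' z‖ ∂μ') := by
  have hle : ∀ z : Z × Z', ‖c z.1 * c' z.2 *
      (2 * I * Real.sin (ħ / 2 * sympl (v z.1) (v' z.2)) : ℂ)‖ ≤ 2 * (‖c z.1‖ * ‖c' z.2‖) := by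
    intro z
    rw [norm_mul, norm_mul, norm_mul, norm_mul, Complex.norm_real, Complex.norm_I,
      Complex.norm_ofNat, Real.norm_eq_abs]
    nlinarith [Real.abs_sin_le_one (ħ / 2 * sympl (v z.1) (v' z.2)),
      mul_nonneg (norm_nonneg (c z.1)) (norm_nonneg (c' z.2))]
  refine (integral_mono (hT.commutator hT').integrable.norm
    ((hT.integrable.norm.mul_prod hT'.integrable.norm).const_mul 2) hle).trans ?_
  rw [integral_const_mul, integral_prod_mul (fun z => ‖c z‖) (fun z => ‖c' z‖)]

/-- Uses only `|sin| ≤ 1`, so it is not uniform in `ħ` after division by `ħ`. It serves existence,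
continuity and algebra for fixed `ħ`. -/
theorem commutator (h : WeylBound ħ 0 B T) (h' : WeylBound ħ 0 B' T') :
    WeylBound ħ 0 (2 * (B * B')) ⁅T, T'⁆ := by
  have hB : 0 ≤ B := by
    obtain ⟨Z, _, μ, _, c, v, hT, hi, hb⟩ := h
    exact (integral_nonneg fun _ => by positivity).trans hb
  obtain ⟨Z, _, μ, _, c, v, hT, hi, hb⟩ := h
  obtain ⟨Z', _, μ', _, c', v', hT', hi', hb'⟩ := h'
  simp only [zero_mul, Real.exp_zero, mul_one] at hb hb'
  refine ⟨_, _, _, inferInstance, _, _, hT.commutator hT', ?_, ?_⟩ <;>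
    simp only [zero_mul, Real.exp_zero, mul_one]
  · exact (hT.commutator hT').integrable.norm
  · exact (hT.integral_norm_commutator_le hT').trans (mul_le_mul_of_nonneg_left
      (mul_le_mul hb hb' (integral_nonneg fun _ => norm_nonneg _) hB) zero_le_two)

theorem zero_le (h : WeylBound ħ ρ B T) : 0 ≤ B := by
  obtain ⟨Z, _, μ, _, c, v, hT, hi, hb⟩ := h
  exact (integral_nonneg fun _ => by positivity).trans hb

end WeylBound

theorem IsPotential.weylBound_pairOp {σ : ℝ} {w : E3 → ℝ} (hσ : 0 < σ) (hw : IsPotential σ w)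
    {i j : ι} (hij : i ≠ j) (ħ : ℝ) : WeylBound ħ 0 (∫ η, ‖potentialHat w η‖) (pairOp w i j) := by
  refine ⟨E3, _, volume, inferInstance, _, _, isWeylIntegral_pairOp hσ hw hij ħ, ?_, ?_⟩ <;>
    simp only [zero_mul, Real.exp_zero, mul_one]
  · exact (hw.integrable_potentialHat hσ).norm
  · exact le_rfl

theorem weylBound_sum {κ Z : Type} [Fintype κ] [MeasurableSpace Z] {μ : Measure Z} [SFinite μ]
    {c : κ → Z → ℂ} {v : κ → Z → Conf ι × Conf ι} {T : κ → L2 ι →L[ℂ] L2 ι}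
    (h : ∀ k, IsWeylIntegral ħ μ (c k) (v k) (T k)) (hB : ∀ k, ∫ z, ‖c k z‖ ∂μ ≤ B) :
    WeylBound ħ 0 (Fintype.card κ * B) (∑ k, T k) := by
  let _ : MeasurableSpace κ := ⊤
  have hS := IsWeylIntegral.sum h
  refine ⟨_, _, _, inferInstance, _, _, hS, ?_, ?_⟩ <;>
    simp only [zero_mul, Real.exp_zero, mul_one]
  · exact hS.integrable.norm
  · rw [integral_prod_symm _ hS.integrable.norm, integral_count, ← nsmul_eq_mul]
    exact Finset.sum_le_card_nsmul _ _ _ fun k _ => hB k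

theorem IsPotential.weylBound_pairAt {σ : ℝ} {w : E3 → ℝ} (hσ : 0 < σ) (hw : IsPotential σ w)
    {i j : ι} (hij : i ≠ j) {ħ : ℝ} (hħ : ħ ≠ 0) (s : ℝ) :
    WeylBound ħ 0 (∫ η, ‖potentialHat w η‖) (pairAt ħ w s i j) :=
  (hw.weylBound_pairOp hσ hij ħ).heisenberg_free hħ le_rfl (by simp)

end Bound

/-! ### One commutator in the weighted norms. -/

section Step

variable {ι κ : Type} [Fintype ι] [Fintype κ] {ħ ρ δ σ K q s : ℝ} {w : E3 → ℝ} {i j : κ → ι}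
  {Z : Type} [MeasurableSpace Z] {μ : Measure Z} [SFinite μ] {c : Z → ℂ}
  {v : Z → Conf ι × Conf ι} {T : L2 ι →L[ℂ] L2 ι}

/-- Gain of a factor linear in the sizes against a small loss in the exponential weight. -/
theorem commutator_weight_le (hħ : 0 < ħ) (hσ : 0 < σ) (hδ : 0 ≤ δ) (hρ : 0 ≤ ρ - δ)
    (hq : 1 + |s| ≤ q) (hqσ : 4 * ρ * q ≤ σ) (a b : ι) (η : E3) (u : Conf ι × Conf ι) (A C : ℂ) :
    ‖I / (ħ : ℂ) * (A * C * (2 * I * Real.sin (ħ / 2 *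
      sympl (freeFlow s (transfer a b η, 0)) u) : ℂ))‖ *
        Real.exp ((ρ - δ) * wsize (freeFlow s (transfer a b η, 0) + u)) ≤
      q * (2 / σ) * (‖A‖ * Real.exp (σ * ‖η‖)) *
        (‖C‖ * Real.exp ((ρ - δ) * wsize u) * (psize u a + psize u b)) := by
  have hq0 : 0 ≤ q := (by positivity : 0 ≤ 1 + |s|).trans hq
  have h1 : ‖I / (ħ : ℂ) * (A * C * (2 * I * Real.sin (ħ / 2 *
      sympl (freeFlow s (transfer a b η, 0)) u) : ℂ))‖ ≤
        ‖A‖ * ‖C‖ * (q * ‖η‖ * (psize u a + psize u b)) := by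
    rw [mul_left_comm, norm_mul, norm_mul A]
    exact mul_le_mul_of_nonneg_left ((norm_commutator_coeff_le hħ _ _).trans
      (abs_sympl_transfer_le hq a b η u)) (by positivity)
  -- The evolved transfer has size at most `2q‖η‖`; as `4ρq ≤ σ` it uses only half of the
  -- exponential weight `σ‖η‖` of the potential.
  have h2 : (ρ - δ) * wsize (freeFlow s (transfer a b η, 0) + u) ≤
      σ * ‖η‖ / 2 + (ρ - δ) * wsize u := by
    have e1 := wsize_add_le (freeFlow s (transfer a b η, 0)) u
    have e2 := (wsize_freeFlow_le s (transfer a b η, 0)).trans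
      (mul_le_mul hq (wsize_transfer_le a b η) (wsize_nonneg _) hq0)
    have e3 := mul_le_mul_of_nonneg_left (e1.trans (add_le_add e2 le_rfl)) hρ
    have e4 : (ρ - δ) * (q * (2 * ‖η‖)) ≤ ρ * (q * (2 * ‖η‖)) :=
      mul_le_mul_of_nonneg_right (by linarith) (by positivity)
    have e5 := mul_le_mul_of_nonneg_right hqσ (norm_nonneg η)
    nlinarith
  -- The other half of that weight pays for the factor `‖η‖` coming from the symplectic form.
  have h3 : ‖η‖ ≤ 2 / σ * Real.exp (σ * ‖η‖ / 2) := by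
    have := Real.add_one_le_exp (σ * ‖η‖ / 2)
    calc ‖η‖ = 2 / σ * (σ * ‖η‖ / 2) := by field_simp
      _ ≤ _ := mul_le_mul_of_nonneg_left (by linarith) (by positivity)
  have hp : 0 ≤ psize u a + psize u b := add_nonneg (psize_nonneg _ _) (psize_nonneg _ _)
  calc _ ≤ ‖A‖ * ‖C‖ * (q * ‖η‖ * (psize u a + psize u b)) *
        Real.exp (σ * ‖η‖ / 2 + (ρ - δ) * wsize u) :=
        mul_le_mul h1 (Real.exp_le_exp.mpr h2) (Real.exp_pos _).le (by positivity)
    _ ≤ ‖A‖ * ‖C‖ * (q * (2 / σ * Real.exp (σ * ‖η‖ / 2)) * (psize u a + psize u b)) *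
        Real.exp (σ * ‖η‖ / 2 + (ρ - δ) * wsize u) := by gcongr
    _ = _ := by
      have : Real.exp (σ * ‖η‖) = Real.exp (σ * ‖η‖ / 2) * Real.exp (σ * ‖η‖ / 2) := by
        rw [← Real.exp_add]; ring_nf
      rw [Real.exp_add, this]
      ring

/-- The linear factor is paid by lowering the weight: `x ≤ δ⁻¹ e^{δx}`. -/
theorem sum_weight_le (hδ : 0 < δ) (hK : 0 ≤ K) (u : Conf ι × Conf ι) (C : ℂ)
    (h : ∑ k, (psize u (i k) + psize u (j k)) ≤ K * wsize u) :
    ∑ k, ‖C‖ * Real.exp ((ρ - δ) * wsize u) * (psize u (i k) + psize u (j k)) ≤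
      K * δ⁻¹ * (‖C‖ * Real.exp (ρ * wsize u)) := by
  rw [← Finset.mul_sum]
  have h3 : wsize u ≤ δ⁻¹ * Real.exp (δ * wsize u) := by
    have := Real.add_one_le_exp (δ * wsize u)
    calc wsize u = δ⁻¹ * (δ * wsize u) := by field_simp
      _ ≤ _ := mul_le_mul_of_nonneg_left (by linarith) (by positivity)
  calc _ ≤ ‖C‖ * Real.exp ((ρ - δ) * wsize u) * (K * (δ⁻¹ * Real.exp (δ * wsize u))) := by
        gcongr
        exact h.trans (mul_le_mul_of_nonneg_left h3 hK)
    _ = _ := by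
      have : Real.exp (ρ * wsize u) = Real.exp ((ρ - δ) * wsize u) * Real.exp (δ * wsize u) := by
        rw [← Real.exp_add]; ring_nf
      rw [this]; ring

/-- The commutator with a sum of evolved pair interactions in the weighted norms. -/
theorem weylBound_sum_commutator (hħ : 0 < ħ) (hσ : 0 < σ) (hw : IsPotential σ w) (hδ : 0 < δ)
    (hρ : 0 ≤ ρ - δ) (hq : 1 + |s| ≤ q) (hqσ : 4 * ρ * q ≤ σ) (hij : ∀ k, i k ≠ j k)
    (hK : 0 ≤ K) (hT : IsWeylIntegral ħ μ c v T)
    (hi : Integrable (fun z => ‖c z‖ * Real.exp (ρ * wsize (v z))) μ)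
    (hv : ∀ z, ∑ k, (psize (v z) (i k) + psize (v z) (j k)) ≤ K * wsize (v z)) :
    WeylBound ħ (ρ - δ) (K * (q * (2 / σ) * potentialNorm σ w / δ *
      ∫ z, ‖c z‖ * Real.exp (ρ * wsize (v z)) ∂μ))
      ((I / (ħ : ℂ)) • ∑ k, ⁅pairAt ħ w s (i k) (j k), T⁆) := by
  let _ : MeasurableSpace κ := ⊤
  have hq0 : 0 ≤ q := (by positivity : 0 ≤ 1 + |s|).trans hq
  have hR : ∀ k, IsWeylIntegral ħ (volume.prod μ) _ _ ((I / (ħ : ℂ)) •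
      ⁅pairAt ħ w s (i k) (j k), T⁆) := fun k =>
    ((((isWeylIntegral_pairOp hσ hw (hij k) ħ).heisenberg_free hħ.ne' s).commutator hT).const_smul
      (I / (ħ : ℂ)))
  have hS := IsWeylIntegral.sum hR
  rw [← Finset.smul_sum] at hS
  set G : E3 × Z → ℝ := fun z => (q * (2 / σ)) * (K * δ⁻¹) *
    ((‖potentialHat w z.1‖ * Real.exp (σ * ‖z.1‖)) *
      (‖c z.2‖ * Real.exp (ρ * wsize (v z.2)))) with hG
  have hGi : Integrable G (volume.prod μ) := (hw.integrable_weight.mul_prod hi).const_mul _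
  set F : (E3 × Z) × κ → ℝ := fun z => ‖I / (ħ : ℂ) * (potentialHat w z.1.1 * c z.1.2 *
    (2 * I * Real.sin (ħ / 2 * sympl (freeFlow s (transfer (i z.2) (j z.2) z.1.1, 0))
      (v z.1.2)) : ℂ))‖ * Real.exp ((ρ - δ) * wsize
        (freeFlow s (transfer (i z.2) (j z.2) z.1.1, 0) + v z.1.2)) with hF
  have hF0 : ∀ z, 0 ≤ F z := fun z => by positivity
  -- The sum over the pairs is taken before integrating, so that `hv` applies.
  have hFG : ∀ z : E3 × Z, ∑ k, F (z, k) ≤ G z := by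
    intro z
    refine (Finset.sum_le_sum fun k _ => commutator_weight_le hħ hσ hδ.le hρ hq hqσ (i k) (j k)
      z.1 (v z.2) (potentialHat w z.1) (c z.2)).trans ?_
    rw [← Finset.mul_sum]
    refine (mul_le_mul_of_nonneg_left (sum_weight_le hδ hK (v z.2) (c z.2) (hv z.2))
      (by positivity)).trans (le_of_eq ?_)
    rw [hG]; ring
  have hFm : AEStronglyMeasurable F ((volume.prod μ).prod (Measure.count : Measure κ)) :=
    hS.integrable.1.norm.mul (Real.measurable_exp.comp
      ((measurable_wsize.comp hS.measurable).const_mul (ρ - δ))).aestronglyMeasurable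
  have hFk : ∀ k, Integrable (fun z => F (z, k)) (volume.prod μ) := by
    intro k
    refine hGi.mono' ?_ (Filter.Eventually.of_forall fun z => ?_)
    · exact (hR k).integrable.1.norm.mul (Real.measurable_exp.comp
        ((measurable_wsize.comp (hR k).measurable).const_mul (ρ - δ))).aestronglyMeasurable
    · rw [Real.norm_of_nonneg (hF0 _)]
      exact (Finset.single_le_sum (f := fun k => F (z, k)) (fun k _ => hF0 _)
        (Finset.mem_univ k)).trans (hFG z)
  have hFi : Integrable F ((volume.prod μ).prod (Measure.count : Measure κ)) := by
    rw [integrable_prod_iff' hFm]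
    exact ⟨Filter.Eventually.of_forall hFk, Integrable.of_finite⟩
  refine ⟨_, _, _, inferInstance, _, _, hS, hFi, ?_⟩
  change ∫ z, F z ∂_ ≤ _
  rw [integral_prod_symm _ hFi, integral_count, ← integral_finsetSum _ fun k _ => hFk k]
  refine (integral_mono (integrable_finsetSum _ fun k _ => hFk k) hGi hFG).trans (le_of_eq ?_)
  rw [hG, integral_const_mul, integral_prod_mul (fun η => ‖potentialHat w η‖ * Real.exp (σ * ‖η‖))
    (fun z => ‖c z‖ * Real.exp (ρ * wsize (v z))), potentialNorm]
  field_simp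

end Step


/-! ### Strong continuity of ampliations and commutators. -/

section Amplify

variable {X : Type*} [TopologicalSpace X] {m N : ℕ} {ħ B : ℝ}

theorem continuous_ampliation (h : m ≤ N) {T : X → L2 (Fin m) →L[ℂ] L2 (Fin m)}
    (hT : ∀ x, WeylBound ħ 0 B (T x)) (hc : ∀ ψ, Continuous fun x => T x ψ) (ψ : L2 (Fin N)) :
    Continuous fun x => ampliation h (T x) ψ := by
  refine continuous_of_dense_span (C := B) (fun x => ((hT x).ampliation h).norm_le le_rfl)
    (dense_span_tens h) ?_ ψ
  rintro _ ⟨f, g, rfl⟩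
  have h1 : ∀ x, ampliation h (T x) (tens h g f) = tens h g (T x f) := fun x =>
    (isAmpliation_iff h).mp ((hT x).isAmpliation h) f g
  simp only [h1]
  exact (tens h g).continuous.comp (hc f)

theorem continuous_commutator {E : Type*} [NormedAddCommGroup E] [NormedSpace ℂ E]
    {S T : X → E →L[ℂ] E} {C D : ℝ} (hS : ∀ x, ‖S x‖ ≤ C) (hT : ∀ x, ‖T x‖ ≤ D)
    (hSc : ∀ ψ, Continuous fun x => S x ψ) (hTc : ∀ ψ, Continuous fun x => T x ψ) (ψ : E) :
    Continuous fun x => ⁅S x, T x⁆ ψ := by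
  simp only [Ring.lie_def, sub_apply, mul_apply_eq_comp]
  exact (continuous_clm_apply_of_bounded hSc hS (hTc ψ)).sub
    (continuous_clm_apply_of_bounded hTc hT (hSc ψ))

end Amplify

/-! ### Sums over pairs of particles. -/

section Pairs

theorem sum_Ioi_eq_sum_subtype {M : Type*} [AddCommMonoid M] {m : ℕ} (f : Fin m → Fin m → M) :
    ∑ i, ∑ j ∈ Finset.Ioi i, f i j =
      ∑ q : {q : Fin m × Fin m // q.1 < q.2}, f q.1.1 q.1.2 := by
  rw [← Finset.sum_subtype (Finset.univ.filter fun q : Fin m × Fin m => q.1 < q.2)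
    (fun q => by simp) (fun q => f q.1 q.2), Finset.sum_filter, Fintype.sum_prod_type]
  refine Finset.sum_congr rfl fun i _ => ?_
  rw [← Finset.sum_filter]
  congr 1
  ext j; simp

/-- Each index lies in `m - 1` pairs; `m` suffices. This is the source of the factor `p + n` in the
loop terms. -/
theorem sum_pairs_le {m : ℕ} {f : Fin m → ℝ} (hf : ∀ i, 0 ≤ f i) :
    ∑ q : {q : Fin m × Fin m // q.1 < q.2}, (f q.1.1 + f q.1.2) ≤ m * ∑ i, f i := by
  have h1 : ∀ i : Fin m, ∀ g : Fin m → ℝ, ∑ j ∈ Finset.Ioi i, g j =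
      ∑ j, if i < j then g j else 0 := fun i g => by
    rw [← Finset.sum_filter]
    congr 1
    ext j; simp
  rw [← sum_Ioi_eq_sum_subtype fun i j => f i + f j]
  simp only [h1]
  have h2 : ∑ i : Fin m, ∑ j, (if i < j then f i + f j else 0) =
      ∑ i : Fin m, ∑ j, ((if i < j then f i else 0) + if j < i then f i else 0) := by
    have e : ∀ i j : Fin m, (if i < j then f i + f j else 0) =
        (if i < j then f i else 0) + if i < j then f j else 0 := fun i j => by
      split_ifs <;> simp
    simp only [e, Finset.sum_add_distrib]
    rw [Finset.sum_comm (f := fun i j => if i < j then f j else 0)]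
  rw [h2, Finset.mul_sum]
  refine Finset.sum_le_sum fun i _ => ?_
  calc _ ≤ ∑ _j : Fin m, f i := Finset.sum_le_sum fun j _ => by
        have := hf i
        rcases lt_trichotomy i j with h | h | h
        · simp [h, h.not_gt]
        · simp [h, h ▸ this]
        · simp [h, h.not_gt]
    _ = m * f i := by simp

end Pairs

/-! ### Tree and loop amplitudes: continuity and weighted bounds. -/

section Tree

variable {p : ℕ} {ħ σ t B : ℝ} {w : E3 → ℝ} {a : L2 (Fin p) →L[ℂ] L2 (Fin p)}

theorem weylBound_sum_commutator_zero {ι κ : Type} [Fintype ι] [Fintype κ] (hħ : ħ ≠ 0)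
    (hσ : 0 < σ) (hw : IsPotential σ w) {i j : κ → ι} (hij : ∀ k, i k ≠ j k) (s : ℝ)
    {T : L2 ι →L[ℂ] L2 ι} (hT : WeylBound ħ 0 B T) :
    WeylBound ħ 0 (Fintype.card κ * (2 * ((∫ η, ‖potentialHat w η‖) * B)))
      (∑ k, ⁅pairAt ħ w s (i k) (j k), T⁆) := by
  obtain ⟨Z, _, μ, _, c, v, hT, hi, hb⟩ := hT
  simp only [zero_mul, Real.exp_zero, mul_one] at hb
  have hP := fun k => (isWeylIntegral_pairOp hσ hw (hij k) ħ).heisenberg_free hħ s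
  refine weylBound_sum (fun k => (hP k).commutator hT) fun k =>
    ((hP k).integral_norm_commutator_le hT).trans ?_
  exact mul_le_mul_of_nonneg_left (mul_le_mul_of_nonneg_left hb
    (integral_nonneg fun _ => norm_nonneg _)) zero_le_two

theorem castSucc_ne_last {m : ℕ} (i : Fin m) : Fin.castSucc i ≠ Fin.last m :=
  (Fin.castSucc_lt_last i).ne

/-- A bound on the tree amplitudes which is uniform in the times, for fixed `ħ`. -/
theorem exists_weylBound_tree (hħ : ħ ≠ 0) (hσ : 0 < σ) (hw : IsPotential σ w) (t : ℝ)
    (ha : WeylBound ħ 0 B a) (n : ℕ) : ∃ C, ∀ s, WeylBound ħ 0 C (tree ħ w t a n s) := by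
  induction n with
  | zero => exact ⟨B, fun s => ha.heisenberg_free hħ le_rfl (by simp)⟩
  | succ n ih =>
    obtain ⟨C, hC⟩ := ih
    exact ⟨_, fun s => (weylBound_sum_commutator_zero hħ hσ hw castSucc_ne_last (s (Fin.last n))
      ((hC (Fin.init s)).ampliation (Nat.le_succ (p + n)))).const_smul _⟩

theorem norm_pairAt_le {ι : Type} [Fintype ι] (hħ : ħ ≠ 0) (hσ : 0 < σ) (hw : IsPotential σ w)
    {i j : ι} (hij : i ≠ j) (s : ℝ) : ‖pairAt ħ w s i j‖ ≤ ∫ η, ‖potentialHat w η‖ :=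
  (hw.weylBound_pairAt hσ hij hħ s).norm_le le_rfl

theorem continuous_pairAt {ι : Type} [Fintype ι] (hħ : ħ ≠ 0) (i j : ι) (ψ : L2 ι) :
    Continuous fun s => pairAt ħ w s i j ψ :=
  (isSchrodingerGroup_freeGroup hħ).continuous_heisenberg _ _

theorem continuous_init {n : ℕ} : Continuous fun s : Fin (n + 1) → ℝ => (Fin.init s : Fin n → ℝ) :=
  continuous_pi fun i => continuous_apply (Fin.castSucc i)

/-- The tree amplitudes are strongly continuous in the times. -/
theorem continuous_tree (hħ : ħ ≠ 0) (hσ : 0 < σ) (hw : IsPotential σ w) (t : ℝ)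
    (ha : WeylBound ħ 0 B a) (n : ℕ) (ψ : L2 (Fin (p + n))) :
    Continuous fun s => tree ħ w t a n s ψ := by
  induction n with
  | zero => exact continuous_const
  | succ n ih =>
    obtain ⟨C, hC⟩ := exists_weylBound_tree hħ hσ hw t ha n
    have h0 : ∀ s : Fin (n + 1) → ℝ, tree ħ w t a (n + 1) s ψ = (I / (ħ : ℂ)) •
        ∑ i : Fin (p + n), ⁅pairAt ħ w (s (Fin.last n)) (Fin.castSucc i) (Fin.last (p + n)),
          ampliation (Nat.le_succ (p + n)) (tree ħ w t a n (Fin.init s))⁆ ψ := fun s => by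
      rw [tree, smul_apply, sum_apply]
    rw [funext h0]
    refine Continuous.const_smul (M := ℂ) (α := L2 (Fin (p + n + 1)))
      (continuous_finsetSum (M := L2 (Fin (p + n + 1))) Finset.univ fun i _ => ?_) _
    have h1 : ∀ φ, Continuous fun s : Fin (n + 1) → ℝ =>
        pairAt ħ w (s (Fin.last n)) (Fin.castSucc i) (Fin.last (p + n)) φ := fun φ =>
      (continuous_pairAt hħ _ _ φ).comp (continuous_apply (Fin.last n))
    have h2 : ∀ φ, Continuous fun s : Fin (n + 1) → ℝ =>
        ampliation (Nat.le_succ (p + n)) (tree ħ w t a n (Fin.init s)) φ := fun φ =>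
      (continuous_ampliation (Nat.le_succ (p + n)) hC ih φ).comp continuous_init
    exact continuous_commutator
      (S := fun s : Fin (n + 1) → ℝ =>
        pairAt ħ w (s (Fin.last n)) (Fin.castSucc i) (Fin.last (p + n)))
      (T := fun s => ampliation (Nat.le_succ (p + n)) (tree ħ w t a n (Fin.init s)))
      (fun s => norm_pairAt_le hħ hσ hw (castSucc_ne_last i) _)
      (fun s => ((hC (Fin.init s)).ampliation _).norm_le le_rfl) h1 h2 ψ

theorem continuous_loop (hħ : ħ ≠ 0) (hσ : 0 < σ) (hw : IsPotential σ w) (t : ℝ)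
    (ha : WeylBound ħ 0 B a) (n : ℕ) {i j : Fin (p + n)} (hij : i ≠ j) (ψ : L2 (Fin (p + n))) :
    Continuous fun s : Fin (n + 1) → ℝ =>
      ⁅pairAt ħ w (s (Fin.last n)) i j, tree ħ w t a n (Fin.init s)⁆ ψ := by
  obtain ⟨C, hC⟩ := exists_weylBound_tree hħ hσ hw t ha n
  have h1 : ∀ φ, Continuous fun s : Fin (n + 1) → ℝ => pairAt ħ w (s (Fin.last n)) i j φ :=
    fun φ => (continuous_pairAt hħ i j φ).comp (continuous_apply (Fin.last n))
  have h2 : ∀ φ, Continuous fun s : Fin (n + 1) → ℝ => tree ħ w t a n (Fin.init s) φ :=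
    fun φ => (continuous_tree hħ hσ hw t ha n φ).comp continuous_init
  exact continuous_commutator (S := fun s : Fin (n + 1) → ℝ => pairAt ħ w (s (Fin.last n)) i j)
    (T := fun s => tree ħ w t a n (Fin.init s)) (fun s => norm_pairAt_le hħ hσ hw hij _)
    (fun s => (hC (Fin.init s)).norm_le le_rfl) h1 h2 ψ

variable {q δ : ℝ}

/-- The tree amplitudes in the weighted norms. -/
theorem weylBound_tree (hħ : 0 < ħ) (hσ : 0 < σ) (hw : IsPotential σ w) (hq : 1 + |t| ≤ q)
    (ha : WeylBound ħ σ B a) (hδ : 0 < δ) (n : ℕ) (hn : n * δ ≤ σ / (4 * q)) (s : Fin n → ℝ)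
    (hs : ∀ i, 1 + |s i| ≤ q) :
    WeylBound ħ (σ / (4 * q) - n * δ) ((q * (2 / σ) * potentialNorm σ w / δ) ^ n * B)
      (tree ħ w t a n s) := by
  have hq1 : 1 ≤ q := le_trans (by linarith [abs_nonneg t]) hq
  have hq0 : 0 < q := by linarith
  induction n with
  | zero =>
    simp only [Nat.cast_zero, zero_mul, sub_zero, pow_zero, one_mul]
    refine ha.heisenberg_free hħ.ne' (by positivity) ?_
    calc σ / (4 * q) * (1 + |t|) ≤ σ / (4 * q) * q := by gcongr
      _ = σ / 4 := by field_simp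
      _ ≤ σ := by linarith
  | succ n ih =>
    push_cast at hn ⊢
    have hn' : n * δ ≤ σ / (4 * q) := by linarith
    obtain ⟨Z, _, μ, _, c, v, hT, hi, hb⟩ := ih hn' (Fin.init s) (fun i => hs _)
    have hW : 0 ≤ potentialNorm σ w := integral_nonneg fun _ => by positivity
    have hA := hT.ampliation (Nat.le_succ (p + n))
    have h4 : 4 * (σ / (4 * q) - n * δ) * q ≤ σ := by
      calc 4 * (σ / (4 * q) - n * δ) * q ≤ 4 * (σ / (4 * q)) * q := by
            gcongr
            have : 0 ≤ n * δ := by positivity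
            linarith
        _ = σ := by field_simp
    -- `K = 1`: the added particle has size zero in the ampliated amplitude, so the sum over its
    -- partners is exactly `wsize`, whatever the number of particles.
    have := weylBound_sum_commutator (K := 1) (i := Fin.castSucc) (j := fun _ => Fin.last (p + n))
      hħ hσ hw hδ (by linarith) (hs (Fin.last n)) h4 castSucc_ne_last zero_le_one hA
      (by simpa only [wsize_extPhase (Nat.le_succ (p + n))] using hi) (fun z => by
        have e1 : psize (extPhase (p + n) (p + n).succ (v z)) (Fin.last (p + n)) = 0 :=
          psize_extPhase_of_le (N := (p + n).succ) _ _ le_rfl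
        have e2 : ∀ i : Fin (p + n), psize (extPhase (p + n) (p + n).succ (v z)) i.castSucc =
            psize (v z) i := fun i => psize_extPhase_castLE (Nat.le_succ (p + n)) (v z) i
        rw [one_mul, wsize_extPhase (Nat.le_succ (p + n))]
        simp only [e1, e2, add_zero]
        exact le_rfl)
    refine this.mono (by linarith) ?_
    simp only [wsize_extPhase (Nat.le_succ (p + n))]
    rw [one_mul, pow_succ', mul_assoc (q * (2 / σ) * potentialNorm σ w / δ)]
    exact mul_le_mul_of_nonneg_left hb (by positivity)

/-- The integrands of the loop terms in the weighted norms. -/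
theorem weylBound_loop (hħ : 0 < ħ) (hσ : 0 < σ) (hw : IsPotential σ w) (hq : 1 + |t| ≤ q)
    (ha : WeylBound ħ σ B a) (hδ : 0 < δ) (n : ℕ) (hn : (n + 1 : ℕ) * δ ≤ σ / (4 * q))
    (s : Fin (n + 1) → ℝ) (hs : ∀ i, 1 + |s i| ≤ q) :
    WeylBound ħ 0 ((p + n : ℕ) * ((q * (2 / σ) * potentialNorm σ w / δ) ^ (n + 1) * B))
      ((I / (ħ : ℂ)) • ∑ i : Fin (p + n), ∑ j ∈ Finset.Ioi i,
        ⁅pairAt ħ w (s (Fin.last n)) i j, tree ħ w t a n (Fin.init s)⁆) := by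
  have hq1 : 1 ≤ q := le_trans (by linarith [abs_nonneg t]) hq
  have hq0 : 0 < q := by linarith
  push_cast at hn
  obtain ⟨Z, _, μ, _, c, v, hT, hi, hb⟩ := weylBound_tree hħ hσ hw hq ha hδ n (by linarith)
    (Fin.init s) (fun i => hs _)
  have hW : 0 ≤ potentialNorm σ w := integral_nonneg fun _ => by positivity
  have h4 : 4 * (σ / (4 * q) - n * δ) * q ≤ σ := by
    calc 4 * (σ / (4 * q) - n * δ) * q ≤ 4 * (σ / (4 * q)) * q := by
          gcongr
          have : 0 ≤ n * δ := by positivity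
          linarith
      _ = σ := by field_simp
  rw [sum_Ioi_eq_sum_subtype]
  -- Here both particles of a pair have nonzero size, and summing over pairs costs `p + n`.
  have := weylBound_sum_commutator (K := ((p + n : ℕ) : ℝ))
    (i := fun q : {q : Fin (p + n) × Fin (p + n) // q.1 < q.2} => q.1.1) (j := fun q => q.1.2)
    hħ hσ hw hδ (by linarith) (hs (Fin.last n)) h4 (fun q => q.2.ne) (by positivity) hT hi
    (fun z => sum_pairs_le fun i => psize_nonneg _ i)
  refine this.mono (by linarith) ?_
  rw [pow_succ', mul_assoc (q * (2 / σ) * potentialNorm σ w / δ)]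
  gcongr

end Tree


/-! ### Compatibility of ampliation with commutators, free evolution and pair potentials. -/

section Ampliations

variable {m n N : ℕ} {ħ σ B C : ℝ} {w : E3 → ℝ}

theorem ampliation_sum {κ : Type*} (s : Finset κ) (h : m ≤ N)
    {T : κ → L2 (Fin m) →L[ℂ] L2 (Fin m)}
    (hT : ∀ k ∈ s, IsAmpliation h (T k) (ampliation h (T k))) :
    ampliation h (∑ k ∈ s, T k) = ∑ k ∈ s, ampliation h (T k) := by
  refine IsAmpliation.ampliation_eq ((isAmpliation_iff h).mpr fun f g => ?_)
  rw [sum_apply, sum_apply, map_sum]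
  exact Finset.sum_congr rfl fun k hk => (isAmpliation_iff h).mp (hT k hk) f g

theorem ampliation_smul (h : m ≤ N) (r : ℂ) {T : L2 (Fin m) →L[ℂ] L2 (Fin m)}
    (hT : IsAmpliation h T (ampliation h T)) : ampliation h (r • T) = r • ampliation h T := by
  refine IsAmpliation.ampliation_eq ((isAmpliation_iff h).mpr fun f g => ?_)
  rw [smul_apply, smul_apply, map_smul, (isAmpliation_iff h).mp hT]

theorem ampliation_commutator (h : m ≤ N) {S T : L2 (Fin m) →L[ℂ] L2 (Fin m)}
    (hS : WeylBound ħ 0 B S) (hT : WeylBound ħ 0 C T) :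
    ampliation h ⁅S, T⁆ = ⁅ampliation h S, ampliation h T⁆ := by
  refine IsAmpliation.ampliation_eq ((isAmpliation_iff h).mpr fun f g => ?_)
  simp only [Ring.lie_def, sub_apply, mul_apply_eq_comp, map_sub,
    (isAmpliation_iff h).mp (hT.isAmpliation h), (isAmpliation_iff h).mp (hS.isAmpliation h)]

theorem extPhase_extPhase (h : m ≤ n) (v : Conf (Fin m) × Conf (Fin m)) :
    extPhase n N (extPhase m n v) = extPhase m N v := by
  have e : ∀ x : Conf (Fin m), extZero n N (extZero m n x) = extZero m N x := fun x => by
    ext ⟨j, c⟩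
    simp only [extZero]
    by_cases h1 : j.val < m
    · simp [h1, h1.trans_le h]
    · simp [h1]
  simp only [extPhase, e]

theorem ampliation_ampliation (h : m ≤ n) (h' : n ≤ N) {T : L2 (Fin m) →L[ℂ] L2 (Fin m)}
    (hT : WeylBound ħ 0 B T) : ampliation h' (ampliation h T) = ampliation (h.trans h') T := by
  obtain ⟨Z, _, μ, _, c, v, hT, -, -⟩ := hT
  have h1 := (hT.ampliation h).ampliation h'
  simp only [extPhase_extPhase h] at h1
  exact h1.unique (hT.ampliation _)

theorem extPhase_freeFlow (t : ℝ) (v : Conf (Fin m) × Conf (Fin m)) :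
    extPhase m N (freeFlow t v) = freeFlow t (extPhase m N v) := by
  have e : extZero m N (v.2 + t • v.1) = extZero m N v.2 + t • extZero m N v.1 := by
    ext ⟨j, c⟩
    simp only [extZero, PiLp.add_apply, PiLp.smul_apply]
    split_ifs <;> simp
  simp only [extPhase, freeFlow, e]

/-- The free evolution of the added particles cancels in the conjugation; on phase space, extension
by zero commutes with the flow. -/
theorem ampliation_heisenberg (hħ : ħ ≠ 0) (h : m ≤ N) (t : ℝ)
    {T : L2 (Fin m) →L[ℂ] L2 (Fin m)} (hT : WeylBound ħ 0 B T) :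
    ampliation h (heisenberg (freeGroup (Fin m) ħ) t T) =
      heisenberg (freeGroup (Fin N) ħ) t (ampliation h T) := by
  obtain ⟨Z, _, μ, _, c, v, hT, -, -⟩ := hT
  have h1 := (hT.heisenberg_free hħ t).ampliation h
  simp only [extPhase_freeFlow] at h1
  exact h1.unique ((hT.ampliation h).heisenberg_free hħ t)

theorem extZero_single (h : m ≤ N) (i : Fin m) (η : E3) :
    extZero m N (single i η) = single (Fin.castLE h i) η := by
  ext ⟨j, c⟩
  simp only [extZero, single]
  by_cases h1 : j.val < m
  · have : (⟨j.val, h1⟩ : Fin m) = i ↔ j = Fin.castLE h i := by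
      rw [Fin.ext_iff, Fin.ext_iff]; rfl
    simp [h1, this]
  · have : j ≠ Fin.castLE h i := fun e => h1 (by rw [e]; exact i.2)
    simp [h1, this]

theorem extPhase_transfer (h : m ≤ N) (i j : Fin m) (η : E3) :
    extPhase m N (transfer i j η, 0) = (transfer (Fin.castLE h i) (Fin.castLE h j) η, 0) := by
  have e : ∀ x y : Conf (Fin m), extZero m N (x - y) = extZero m N x - extZero m N y := by
    intro x y
    ext ⟨j, c⟩
    simp only [extZero, PiLp.sub_apply]
    split_ifs <;> simp
  have e0 : extZero m N 0 = 0 := by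
    ext ⟨j, c⟩
    simp [extZero]
  simp only [extPhase, transfer, e, e0, extZero_single h]

theorem ampliation_pairAt (hħ : ħ ≠ 0) (hσ : 0 < σ) (hw : IsPotential σ w) (h : m ≤ N) (s : ℝ)
    {i j : Fin m} (hij : i ≠ j) :
    ampliation h (pairAt ħ w s i j) = pairAt ħ w s (Fin.castLE h i) (Fin.castLE h j) := by
  have hij' : Fin.castLE h i ≠ Fin.castLE h j := fun e => hij (Fin.castLE_injective h e)
  rw [pairAt, ampliation_heisenberg hħ h s (hw.weylBound_pairOp hσ hij ħ), pairAt]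
  congr 1
  have h1 := (isWeylIntegral_pairOp hσ hw hij ħ).ampliation h
  simp only [extPhase_transfer h] at h1
  exact h1.unique (isWeylIntegral_pairOp hσ hw hij' ħ)

/-- A pair interaction among the other particles commutes with `T ⊗ I`. -/
theorem commutator_pairAt_ampliation_eq_zero (hħ : ħ ≠ 0) (hσ : 0 < σ) (hw : IsPotential σ w)
    (h : m ≤ N) (s : ℝ) {i j : Fin N} (hij : i ≠ j) (hi : m ≤ i.val) (hj : m ≤ j.val)
    {T : L2 (Fin m) →L[ℂ] L2 (Fin m)} (hT : WeylBound ħ 0 B T) :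
    ⁅pairAt ħ w s i j, ampliation h T⁆ = 0 := by
  obtain ⟨Z, _, μ, _, c, v, hT, -, -⟩ := hT
  have hC := ((isWeylIntegral_pairOp hσ hw hij ħ).heisenberg_free hħ s).commutator
    (hT.ampliation h)
  -- The zero-extended vector has no component at `i` or `j`, so every sine in the commutator
  -- vanishes.
  have h0 : ∀ (η : E3) z, sympl (freeFlow s (transfer i j η, 0)) (extPhase m N (v z)) = 0 := by
    intro η z
    have := abs_sympl_transfer_le (κ := 1 + |s|) le_rfl i j η (extPhase m N (v z))
    rw [psize_extPhase_of_le _ i hi, psize_extPhase_of_le _ j hj] at this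
    rw [← abs_eq_zero]
    exact le_antisymm (by simpa using this) (abs_nonneg _)
  have h1 := hC.norm_le
  simp only [h0, mul_zero, Real.sin_zero, Complex.ofReal_zero, norm_zero, integral_zero] at h1
  exact norm_le_zero_iff.mp h1

end Ampliations

/-! ### Permutations acting on pair potentials and ampliations. -/

section Permutations

variable {ι : Type} [Fintype ι] {ħ σ B : ℝ} {w : E3 → ℝ}

theorem pos_permute (π : Equiv.Perm ι) (x : Conf ι) (j : ι) :
    pos (permute π x) j = pos x (π.symm j) := rfl

theorem permuteL2_pairOp (hσ : 0 < σ) (hw : IsPotential σ w) (π : Equiv.Perm ι) {i j : ι}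
    (hij : i ≠ j) (ψ : L2 ι) :
    permuteL2 π (pairOp w i j ψ) = pairOp w (π.symm i) (π.symm j) (permuteL2 π ψ) := by
  have hij' : π.symm i ≠ π.symm j := fun e => hij (π.symm.injective e)
  refine Lp.ext ?_
  filter_upwards [permuteL2_apply_of_ae π (pairOp_apply hσ hw hij ψ),
    pairOp_apply hσ hw hij' (permuteL2 π ψ), permuteL2_apply π ψ] with x h1 h2 h3
  rw [h1, h2, h3, pos_permute, pos_permute]

theorem permuteL2_pairAt (hħ : ħ ≠ 0) (hσ : 0 < σ) (hw : IsPotential σ w) (π : Equiv.Perm ι)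
    (s : ℝ) {i j : ι} (hij : i ≠ j) (ψ : L2 ι) :
    permuteL2 π (pairAt ħ w s i j ψ) = pairAt ħ w s (π.symm i) (π.symm j) (permuteL2 π ψ) := by
  rw [pairAt, heisenberg_apply, pairAt, heisenberg_apply, freeGroup_permuteL2 hħ,
    ← permuteL2_pairOp hσ hw π hij, freeGroup_permuteL2 hħ]

theorem permute_extZero {m N : ℕ} (π : Equiv.Perm (Fin N))
    (hπ : ∀ j : Fin N, j.val < m → π j = j) (x : Conf (Fin m)) :
    permute π (extZero m N x) = extZero m N x := by
  have hs : ∀ j : Fin N, j.val < m → π.symm j = j := fun j hj => by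
    rw [Equiv.symm_apply_eq, hπ j hj]
  ext ⟨j, c⟩
  rw [permute_apply]
  simp only [extZero]
  by_cases h1 : j.val < m
  · rw [hs j h1]
  · have h2 : ¬ (π.symm j).val < m := fun h => h1 (by
      have := hπ _ h
      rw [Equiv.apply_symm_apply] at this
      rwa [← this] at h)
    simp [h1, h2]

/-- A permutation fixing the first `m` particles fixes all zero-extended phase space vectors, hence
the superposition itself. -/
theorem permuteL2_ampliation {m N : ℕ} (h : m ≤ N) {T : L2 (Fin m) →L[ℂ] L2 (Fin m)}
    (hT : WeylBound ħ 0 B T) (π : Equiv.Perm (Fin N)) (hπ : ∀ j : Fin N, j.val < m → π j = j)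
    (ψ : L2 (Fin N)) : permuteL2 π (ampliation h T ψ) = ampliation h T (permuteL2 π ψ) := by
  have hs : ∀ j : Fin N, j.val < m → π.symm j = j := fun j hj => by
    rw [Equiv.symm_apply_eq, hπ j hj]
  obtain ⟨Z, _, μ, _, c, v, hT, -, -⟩ := hT
  have hA := hT.ampliation h
  have h1 := hA.conj_permute (T' := (permuteL2 π).toContinuousLinearMap ∘L ampliation h T ∘L
    (permuteL2 π.symm).toContinuousLinearMap) π (fun ψ => rfl)
  simp only [extPhase, permute_extZero π.symm hs] at h1
  have h2 := congrArg (fun A : L2 (Fin N) →L[ℂ] L2 (Fin N) => A (permuteL2 π ψ)) (h1.unique hA)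
  simp only [ContinuousLinearMap.comp_apply, LinearIsometry.coe_toContinuousLinearMap] at h2
  have h3 := IsWeylIntegral.permuteL2_apply_symm π.symm ψ
  rw [Equiv.symm_symm] at h3
  rwa [h3] at h2

end Permutations

/-! ### The interaction, the full group and their permutation symmetry. -/

section Interaction

variable {N : ℕ} {ħ σ : ℝ} {w : E3 → ℝ}

theorem inner_interaction (hσ : 0 < σ) (hw : IsPotential σ w) (φ ψ : L2 (Fin N)) :
    inner ℂ (interaction N w φ) ψ = inner ℂ φ (interaction N w ψ) := by
  simp only [interaction, smul_apply, sum_apply, inner_smul_left, inner_smul_right, sum_inner,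
    inner_sum]
  congr 1
  · simp
  · refine Finset.sum_congr rfl fun i _ => Finset.sum_congr rfl fun j hj => ?_
    exact inner_pairOp hσ hw (Finset.mem_Ioi.mp hj).ne φ ψ

/-- A sum over `i < j` is not visibly permutation invariant, while the sum over all ordered pairs of
distinct indices is. -/
theorem sum_ne_eq_two_smul {M : Type*} [AddCommMonoid M] {m : ℕ} (f : Fin m → Fin m → M)
    (hf : ∀ i j, i ≠ j → f i j = f j i) :
    ∑ i, ∑ j, (if i = j then 0 else f i j) = 2 • ∑ i, ∑ j ∈ Finset.Ioi i, f i j := by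
  have h1 : ∀ i : Fin m, ∀ g : Fin m → M, ∑ j ∈ Finset.Ioi i, g j =
      ∑ j, if i < j then g j else 0 := fun i g => by
    rw [← Finset.sum_filter]
    congr 1
    ext j; simp
  have h2 : ∀ i j, (if i = j then 0 else f i j) =
      (if i < j then f i j else 0) + if j < i then f j i else 0 := fun i j => by
    rcases lt_trichotomy i j with h | h | h
    · simp [h, h.ne, h.not_gt]
    · simp [h]
    · simp [h, h.ne', h.not_gt, hf i j h.ne']
  simp only [h1, h2, Finset.sum_add_distrib]
  rw [Finset.sum_comm (f := fun i j => if j < i then f j i else 0), two_smul]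

theorem permuteL2_interaction (hσ : 0 < σ) (hw : IsPotential σ w) (π : Equiv.Perm (Fin N))
    (ψ : L2 (Fin N)) :
    permuteL2 π (interaction N w ψ) = interaction N w (permuteL2 π ψ) := by
  simp only [interaction, smul_apply, sum_apply, map_smul, map_sum]
  congr 1
  have e1 := sum_ne_eq_two_smul (fun i j => permuteL2 π (pairOp w i j ψ)) fun i j hij => by
    rw [pairOp_swap hσ hw hij]
  have e2 := sum_ne_eq_two_smul (fun i j => pairOp w i j (permuteL2 π ψ)) fun i j hij => by
    rw [pairOp_swap hσ hw hij]
  have e3 : ∑ i, ∑ j, (if i = j then 0 else permuteL2 π (pairOp w i j ψ)) =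
      ∑ i, ∑ j, (if i = j then 0 else pairOp w i j (permuteL2 π ψ)) := by
    rw [← Equiv.sum_comp π.symm (fun i => ∑ j, if i = j then 0 else
      pairOp w i j (permuteL2 π ψ))]
    refine Finset.sum_congr rfl fun i _ => ?_
    rw [← Equiv.sum_comp π.symm (fun j => if π.symm i = j then 0 else
      pairOp w (π.symm i) j (permuteL2 π ψ))]
    refine Finset.sum_congr rfl fun j _ => ?_
    simp only [π.symm.injective.eq_iff]
    split_ifs with hij
    · rfl
    · exact permuteL2_pairOp hσ hw π hij ψ
  rw [e1, e2, ← Nat.cast_smul_eq_nsmul ℂ, ← Nat.cast_smul_eq_nsmul ℂ] at e3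
  exact smul_right_injective _ (by norm_num : ((2 : ℕ) : ℂ) ≠ 0) e3

theorem isSchrodingerGroup_full (hħ : ħ ≠ 0) (hσ : 0 < σ) (hw : IsPotential σ w) :
    IsSchrodingerGroup ħ (hamiltonian N ħ w) (expGroup ħ (hamiltonian N ħ w)) := by
  obtain ⟨V, hV, -, -⟩ := (isSchrodingerGroup_freeGroup (ι := Fin N) hħ).exists_perturbation
    (inner_interaction hσ hw)
  exact expGroup_spec ⟨_, hV⟩

/-- If a symmetry commutes with the free group and with the perturbation, it commutes with the
perturbed group. -/
theorem IsSchrodingerGroup.commute_perturbation {E : Type} [NormedAddCommGroup E]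
    [InnerProductSpace ℂ E] [CompleteSpace E] {H : E →ₗ.[ℂ] E} {U U' : ℝ → E →L[ℂ] E}
    {W P : E →L[ℂ] E} (hU : IsSchrodingerGroup ħ H U)
    (hW : ∀ x y, inner ℂ (W x) y = inner ℂ x (W y))
    (hU' : IsSchrodingerGroup ħ ((W : E →ₗ[ℂ] E) +ᵥ H) U') (hħ : ħ ≠ 0)
    (hPU : ∀ t x, U t (P x) = P (U t x)) (hPW : ∀ x, P (W x) = W (P x)) (t : ℝ) (x : E) :
    U' t (P x) = P (U' t x) := by
  -- The image under `P` of the interaction picture orbit of `x` solves the equation of the orbit of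
  -- `P x`, so uniqueness applies.
  have h1 : ∀ t, HasDerivAt (fun t => P (U (-t) (U' t x)))
      (interactionGen ħ U W t (P (U (-t) (U' t x)))) t := fun t => by
    have h := (P.restrictScalars ℝ).hasFDerivAt.comp_hasDerivAt t
      (hU.hasDerivAt_interaction hW hU' hħ x t)
    refine h.congr_deriv ?_
    simp only [interactionGen_apply, ContinuousLinearMap.coe_restrictScalars', map_smul, hPU,
      ← hPW]
  have h2 := eq_of_skew_flow (interactionGen_skew hU hW) h1
    (fun t => hU.hasDerivAt_interaction hW hU' hħ (P x) t)
    (by simp only [neg_zero, hU.map_zero, hU'.map_zero]; rfl) t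
  have h3 := congrArg (fun y => U t y) h2
  simp only [hPU, hU.self_apply_neg] at h3
  exact h3.symm

theorem full_permuteL2 (hħ : ħ ≠ 0) (hσ : 0 < σ) (hw : IsPotential σ w)
    (π : Equiv.Perm (Fin N)) (t : ℝ) (ψ : L2 (Fin N)) :
    expGroup ħ (hamiltonian N ħ w) t (permuteL2 π ψ) =
      permuteL2 π (expGroup ħ (hamiltonian N ħ w) t ψ) :=
  (isSchrodingerGroup_freeGroup (ι := Fin N) hħ).commute_perturbation
    (P := (permuteL2 π).toContinuousLinearMap) (inner_interaction hσ hw)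
    (isSchrodingerGroup_full hħ hσ hw) hħ (fun t x => freeGroup_permuteL2 hħ π t x)
    (fun x => permuteL2_interaction hσ hw π x) t ψ

end Interaction

/-! ### Operators compressed to the bosonic space. -/

section Restrict

variable {N : ℕ} {ħ σ B : ℝ} {w : E3 → ℝ}

theorem inner_onBosons (T : L2 (Fin N) →L[ℂ] L2 (Fin N)) (φ ψ : bosonic N) :
    inner ℂ φ (onBosons N T ψ) = inner ℂ (φ : L2 (Fin N)) (T ψ) := by
  rw [onBosons, ContinuousLinearMap.comp_apply, ContinuousLinearMap.comp_apply,
    Submodule.inner_orthogonalProjectionOnto_eq_of_mem_left]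
  rfl

theorem onBosons_ext {S T : L2 (Fin N) →L[ℂ] L2 (Fin N)}
    (h : ∀ φ ψ : bosonic N, inner ℂ (φ : L2 (Fin N)) (S ψ) = inner ℂ (φ : L2 (Fin N)) (T ψ)) :
    onBosons N S = onBosons N T :=
  ContinuousLinearMap.ext fun ψ => ext_inner_left ℂ fun φ => by
    rw [inner_onBosons, inner_onBosons, h]

theorem onBosons_smul (r : ℂ) (T : L2 (Fin N) →L[ℂ] L2 (Fin N)) :
    onBosons N (r • T) = r • onBosons N T :=
  ContinuousLinearMap.ext fun ψ => by simp [onBosons]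

theorem onBosons_zero : onBosons N 0 = 0 :=
  ContinuousLinearMap.ext fun ψ => by simp [onBosons]

theorem onBosons_sum {κ : Type*} (s : Finset κ) (T : κ → L2 (Fin N) →L[ℂ] L2 (Fin N)) :
    onBosons N (∑ k ∈ s, T k) = ∑ k ∈ s, onBosons N (T k) :=
  ContinuousLinearMap.ext fun ψ => by simp [onBosons]

theorem norm_onBosons_le (T : L2 (Fin N) →L[ℂ] L2 (Fin N)) : ‖onBosons N T‖ ≤ ‖T‖ :=
  ContinuousLinearMap.opNorm_le_bound _ (norm_nonneg _) fun ψ => by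
    rw [onBosons, ContinuousLinearMap.comp_apply, ContinuousLinearMap.comp_apply]
    exact ((bosonic N).norm_orthogonalProjectionOnto_apply_le _).trans (T.le_opNorm _)

theorem coe_onBosons {T : L2 (Fin N) →L[ℂ] L2 (Fin N)}
    (hT : ∀ (π : Equiv.Perm (Fin N)) ψ, T (permuteL2 π ψ) = permuteL2 π (T ψ)) (ψ : bosonic N) :
    (onBosons N T ψ : L2 (Fin N)) = T ψ := by
  have hmem : T ψ ∈ bosonic N := fun π => by
    rw [← hT, ψ.2 π]
  rw [onBosons, ContinuousLinearMap.comp_apply, ContinuousLinearMap.comp_apply]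
  exact (bosonic N).starProjection_eq_self_iff.mpr hmem

theorem coe_bosonFree (hħ : ħ ≠ 0) (t : ℝ) (ψ : bosonic N) :
    (bosonFree N ħ t ψ : L2 (Fin N)) = freeGroup (Fin N) ħ t ψ :=
  coe_onBosons (fun π ψ => freeGroup_permuteL2 hħ π t ψ) ψ

theorem coe_bosonFull (hħ : ħ ≠ 0) (hσ : 0 < σ) (hw : IsPotential σ w) (t : ℝ) (ψ : bosonic N) :
    (bosonFull N ħ w t ψ : L2 (Fin N)) = expGroup ħ (hamiltonian N ħ w) t ψ :=
  coe_onBosons (fun π ψ => full_permuteL2 hħ hσ hw π t ψ) ψ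

theorem inner_permuteL2 (π : Equiv.Perm (Fin N)) (φ ψ : L2 (Fin N)) :
    inner ℂ (permuteL2 π φ) (permuteL2 π ψ) = inner ℂ φ ψ :=
  (permuteL2 π).inner_map_map φ ψ

/-- Conjugation by a permutation is invisible on the bosonic space. -/
theorem onBosons_eq_of_permute {S T : L2 (Fin N) →L[ℂ] L2 (Fin N)} (π : Equiv.Perm (Fin N))
    (h : ∀ ψ, permuteL2 π (S ψ) = T (permuteL2 π ψ)) : onBosons N S = onBosons N T :=
  onBosons_ext fun φ ψ => by
    rw [← inner_permuteL2 π, h, φ.2 π, ψ.2 π]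

end Restrict


/-! ### Unitary groups restricted to the bosonic space. -/

section Restricted

variable {N : ℕ} {ħ : ℝ} {H : L2 (Fin N) →ₗ.[ℂ] L2 (Fin N)}
  {G : ℝ → L2 (Fin N) →L[ℂ] L2 (Fin N)}

/-- A group commuting with the permutations restricts to the bosonic space. -/
theorem IsSchrodingerGroup.onBosons_neg_apply (hG : IsSchrodingerGroup ħ H G)
    (hP : ∀ (π : Equiv.Perm (Fin N)) t ψ, G t (permuteL2 π ψ) = permuteL2 π (G t ψ)) (t : ℝ)
    (ψ : bosonic N) : onBosons N (G (-t)) (onBosons N (G t) ψ) = ψ :=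
  Subtype.ext (by rw [coe_onBosons (fun π => hP π (-t)), coe_onBosons (fun π => hP π t),
    hG.neg_apply_self])

theorem IsSchrodingerGroup.norm_onBosons (hG : IsSchrodingerGroup ħ H G)
    (hP : ∀ (π : Equiv.Perm (Fin N)) t ψ, G t (permuteL2 π ψ) = permuteL2 π (G t ψ)) (t : ℝ)
    (ψ : bosonic N) : ‖onBosons N (G t) ψ‖ = ‖ψ‖ := by
  change ‖((onBosons N (G t) ψ : bosonic N) : L2 (Fin N))‖ = ‖(ψ : L2 (Fin N))‖
  rw [coe_onBosons (fun π => hP π t), hG.norm_map]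

theorem continuous_onBosons {X : Type*} [TopologicalSpace X]
    {T : X → L2 (Fin N) →L[ℂ] L2 (Fin N)} (hT : ∀ ψ, Continuous fun x => T x ψ) (ψ : bosonic N) :
    Continuous fun x => onBosons N (T x) ψ :=
  (bosonic N).orthogonalProjectionOnto.continuous.comp (hT ψ)

theorem IsSchrodingerGroup.inner_onBosons_left (hG : IsSchrodingerGroup ħ H G) (t : ℝ)
    (hP : ∀ (π : Equiv.Perm (Fin N)) t ψ, G t (permuteL2 π ψ) = permuteL2 π (G t ψ))
    (φ ψ : bosonic N) :
    inner ℂ φ (onBosons N (G (-t)) ψ) = inner ℂ (onBosons N (G t) φ) ψ := by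
  rw [inner_onBosons, ← hG.inner_left, ← coe_onBosons (fun π => hP π t)]
  rfl

end Restricted

/-! ### Conjugation by the interaction picture evolution on bosons. -/

section InteractionPicture

variable {N : ℕ} {ħ σ : ℝ} {w : E3 → ℝ}

theorem inner_bosonFree (hħ : ħ ≠ 0) (t : ℝ) (φ ψ : bosonic N) :
    inner ℂ φ (bosonFree N ħ (-t) ψ) = inner ℂ (bosonFree N ħ t φ) ψ :=
  (isSchrodingerGroup_freeGroup hħ).inner_onBosons_left t (freeGroup_permuteL2 hħ) φ ψ

theorem inner_bosonFull (hħ : ħ ≠ 0) (hσ : 0 < σ) (hw : IsPotential σ w) (t : ℝ)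
    (φ ψ : bosonic N) :
    inner ℂ φ (bosonFull N ħ w (-t) ψ) = inner ℂ (bosonFull N ħ w t φ) ψ :=
  (isSchrodingerGroup_full hħ hσ hw).inner_onBosons_left t (full_permuteL2 hħ hσ hw) φ ψ

theorem norm_bosonFree (hħ : ħ ≠ 0) (t : ℝ) (ψ : bosonic N) : ‖bosonFree N ħ t ψ‖ = ‖ψ‖ :=
  (isSchrodingerGroup_freeGroup hħ).norm_onBosons (freeGroup_permuteL2 hħ) t ψ

theorem norm_bosonFull (hħ : ħ ≠ 0) (hσ : 0 < σ) (hw : IsPotential σ w) (t : ℝ)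
    (ψ : bosonic N) : ‖bosonFull N ħ w t ψ‖ = ‖ψ‖ :=
  (isSchrodingerGroup_full hħ hσ hw).norm_onBosons (full_permuteL2 hħ hσ hw) t ψ

theorem continuous_bosonFree (hħ : ħ ≠ 0) (ψ : bosonic N) :
    Continuous fun t => bosonFree N ħ t ψ :=
  continuous_onBosons (isSchrodingerGroup_freeGroup hħ).continuous ψ

theorem continuous_bosonFull (hħ : ħ ≠ 0) (hσ : 0 < σ) (hw : IsPotential σ w) (ψ : bosonic N) :
    Continuous fun t => bosonFull N ħ w t ψ :=
  continuous_onBosons (isSchrodingerGroup_full hħ hσ hw).continuous ψ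

theorem interConj_apply (s : ℝ) (X : bosonic N →L[ℂ] bosonic N) (ψ : bosonic N) :
    interConj N ħ w s X ψ = bosonFull N ħ w (-s) (bosonFree N ħ s
      (X (bosonFree N ħ (-s) (bosonFull N ħ w s ψ)))) := by
  rw [interConj, heisenberg_apply, heisenberg_apply, neg_neg]

theorem interConj_add (s : ℝ) (X Y : bosonic N →L[ℂ] bosonic N) :
    interConj N ħ w s (X + Y) = interConj N ħ w s X + interConj N ħ w s Y :=
  ContinuousLinearMap.ext fun ψ => by
    simp only [interConj_apply, add_apply, map_add]

theorem interConj_smul (s : ℝ) (r : ℂ) (X : bosonic N →L[ℂ] bosonic N) :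
    interConj N ħ w s (r • X) = r • interConj N ħ w s X :=
  ContinuousLinearMap.ext fun ψ => by
    simp only [interConj_apply, smul_apply, map_smul]

theorem norm_interConj_le (hħ : ħ ≠ 0) (hσ : 0 < σ) (hw : IsPotential σ w) (s : ℝ)
    (X : bosonic N →L[ℂ] bosonic N) : ‖interConj N ħ w s X‖ ≤ ‖X‖ :=
  ContinuousLinearMap.opNorm_le_bound _ (ContinuousLinearMap.opNorm_nonneg X) fun ψ => by
    rw [interConj_apply, norm_bosonFull hħ hσ hw, norm_bosonFree hħ]
    refine (X.le_opNorm _).trans (le_of_eq ?_)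
    rw [norm_bosonFree hħ, norm_bosonFull hħ hσ hw]

theorem continuous_interConj (hħ : ħ ≠ 0) (hσ : 0 < σ) (hw : IsPotential σ w) {Y : Type*}
    [TopologicalSpace Y] {τ : Y → ℝ} (hτ : Continuous τ) {X : Y → bosonic N →L[ℂ] bosonic N}
    {C : ℝ} (hX : ∀ ψ, Continuous fun y => X y ψ) (hC : ∀ y, ‖X y‖ ≤ C) (ψ : bosonic N) :
    Continuous fun y => interConj N ħ w (τ y) (X y) ψ := by
  have h0 : ∀ t, ‖bosonFree N ħ t‖ ≤ 1 := fun t =>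
    ContinuousLinearMap.opNorm_le_bound _ zero_le_one fun ψ => by
      rw [norm_bosonFree hħ, one_mul]
  have h1 : ∀ t, ‖bosonFull N ħ w t‖ ≤ 1 := fun t =>
    ContinuousLinearMap.opNorm_le_bound _ zero_le_one fun ψ => by
      rw [norm_bosonFull hħ hσ hw, one_mul]
  simp only [interConj_apply]
  refine continuous_clm_apply_of_bounded (T := fun y => bosonFull N ħ w (-τ y))
    (fun φ => (continuous_bosonFull hħ hσ hw φ).comp hτ.neg) (fun y => h1 _) ?_
  refine continuous_clm_apply_of_bounded (T := fun y => bosonFree N ħ (τ y))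
    (fun φ => (continuous_bosonFree hħ φ).comp hτ) (fun y => h0 _) ?_
  refine continuous_clm_apply_of_bounded hX hC ?_
  exact continuous_clm_apply_of_bounded (T := fun y => bosonFree N ħ (-τ y))
    (fun φ => (continuous_bosonFree hħ φ).comp hτ.neg) (fun y => h0 _)
    ((continuous_bosonFull hħ hσ hw ψ).comp hτ)

/-- Moving the outer unitaries onto `φ` leaves matrix elements of `T` between interaction picture
vectors in the full `L²` space. These are differentiable for all `φ` and `ψ`. -/
theorem inner_interConj (hħ : ħ ≠ 0) (hσ : 0 < σ) (hw : IsPotential σ w) (s : ℝ)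
    (T : L2 (Fin N) →L[ℂ] L2 (Fin N)) (φ ψ : bosonic N) :
    inner ℂ φ (interConj N ħ w s (onBosons N T) ψ) =
      inner ℂ (freeGroup (Fin N) ħ (-s) (expGroup ħ (hamiltonian N ħ w) s (φ : L2 (Fin N))))
        (T (freeGroup (Fin N) ħ (-s) (expGroup ħ (hamiltonian N ħ w) s (ψ : L2 (Fin N))))) := by
  rw [interConj_apply, inner_bosonFull hħ hσ hw]
  have h := inner_bosonFree hħ (-s) (bosonFull N ħ w s φ)
    (onBosons N T (bosonFree N ħ (-s) (bosonFull N ħ w s ψ)))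
  rw [neg_neg] at h
  rw [h, inner_onBosons, coe_bosonFree hħ, coe_bosonFree hħ, coe_bosonFull hħ hσ hw,
    coe_bosonFull hħ hσ hw]

theorem interConj_zero_left (hħ : ħ ≠ 0) (hσ : 0 < σ) (hw : IsPotential σ w)
    (T : L2 (Fin N) →L[ℂ] L2 (Fin N)) : interConj N ħ w 0 (onBosons N T) = onBosons N T :=
  ContinuousLinearMap.ext fun ψ => ext_inner_left ℂ fun φ => by
    rw [inner_interConj hħ hσ hw, inner_onBosons, neg_zero,
      (isSchrodingerGroup_freeGroup hħ).map_zero, (isSchrodingerGroup_full hħ hσ hw).map_zero]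
    rfl

end InteractionPicture

/-! ### Duhamel's formula. -/

section Duhamel

variable {E : Type} [NormedAddCommGroup E] [InnerProductSpace ℂ E] {ħ σ : ℝ}

/-- Both vectors solve the bounded interaction equation; skewness of its generator combines the two
derivatives into a commutator. -/
theorem IsSchrodingerGroup.hasDerivAt_inner [CompleteSpace E] {H : E →ₗ.[ℂ] E}
    {U U' : ℝ → E →L[ℂ] E} {W : E →L[ℂ] E} (hU : IsSchrodingerGroup ħ H U)
    (hW : ∀ x y, inner ℂ (W x) y = inner ℂ x (W y))
    (hU' : IsSchrodingerGroup ħ ((W : E →ₗ[ℂ] E) +ᵥ H) U') (hħ : ħ ≠ 0) (T : E →L[ℂ] E)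
    (φ ψ : E) (t : ℝ) :
    HasDerivAt (fun t => inner ℂ (U (-t) (U' t φ)) (T (U (-t) (U' t ψ))))
      (inner ℂ (U (-t) (U' t φ))
        (((I / (ħ : ℂ)) • ⁅heisenberg U t W, T⁆) (U (-t) (U' t ψ)))) t := by
  have h1 := hU.hasDerivAt_interaction hW hU' hħ φ t
  have h2 := (T.restrictScalars ℝ).hasFDerivAt.comp_hasDerivAt t
    (hU.hasDerivAt_interaction hW hU' hħ ψ t)
  refine (h1.inner ℂ h2).congr_deriv ?_
  simp only [ContinuousLinearMap.coe_restrictScalars', Function.comp_apply]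
  rw [interactionGen_skew hU hW, ← sub_eq_add_neg, ← inner_sub_right]
  congr 1
  simp only [interactionGen, smul_apply, map_smul, Ring.lie_def, sub_apply, mul_apply_eq_comp]
  module

/-- Weak differentiability with a norm continuous derivative already yields the vector-valued
integral formula, so strong differentiability need not be checked. -/
theorem eq_add_integral_of_hasDerivAt_inner [CompleteSpace E] {f g : ℝ → E} (hg : Continuous g)
    (h : ∀ φ t, HasDerivAt (fun t => inner ℂ φ (f t)) (inner ℂ φ (g t)) t) (t : ℝ) :
    f t = f 0 + ∫ s in (0 : ℝ)..t, g s := by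
  refine ext_inner_left ℂ fun φ => ?_
  have h1 := intervalIntegral.integral_eq_sub_of_hasDerivAt (fun s _ => h φ s)
    ((Continuous.inner (𝕜 := ℂ) continuous_const hg).intervalIntegrable 0 t)
  have h2 := ContinuousLinearMap.intervalIntegral_comp_comm (innerSL ℂ φ)
    (hg.intervalIntegrable 0 t) (μ := volume)
  simp only [innerSL_apply_apply] at h2
  rw [inner_add_right, ← h2, h1]
  ring

variable {N : ℕ} {w : E3 → ℝ}

/-- The interaction `W_N` evolved freely. -/
def interactionAt (N : ℕ) (ħ : ℝ) (w : E3 → ℝ) (s : ℝ) : L2 (Fin N) →L[ℂ] L2 (Fin N) :=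
  heisenberg (freeGroup (Fin N) ħ) s (interaction N w)

theorem continuous_lie_interactionAt (hħ : ħ ≠ 0) (T : L2 (Fin N) →L[ℂ] L2 (Fin N))
    (ψ : L2 (Fin N)) : Continuous fun s => ((I / (ħ : ℂ)) • ⁅interactionAt N ħ w s, T⁆) ψ := by
  have hU := isSchrodingerGroup_freeGroup (ι := Fin N) hħ
  have h := continuous_commutator (S := fun s => interactionAt N ħ w s) (T := fun _ => T)
    (fun s => hU.norm_heisenberg_le s (interaction N w)) (fun _ => le_rfl)
    (hU.continuous_heisenberg (interaction N w)) (fun φ => continuous_const) ψ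
  exact h.const_smul (I / (ħ : ℂ))

theorem norm_lie_interactionAt_le (hħ : ħ ≠ 0) (T : L2 (Fin N) →L[ℂ] L2 (Fin N)) (s : ℝ) :
    ‖(I / (ħ : ℂ)) • ⁅interactionAt N ħ w s, T⁆‖ ≤
      ‖I / (ħ : ℂ)‖ * (2 * (‖interaction N w‖ * ‖T‖)) := by
  have hW := (isSchrodingerGroup_freeGroup (ι := Fin N) hħ).norm_heisenberg_le s (interaction N w)
  rw [norm_smul]
  refine mul_le_mul_of_nonneg_left ?_ (norm_nonneg _)
  rw [Ring.lie_def]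
  have h1 := norm_mul_le_of_le hW (le_refl ‖T‖)
  have h2 := norm_mul_le_of_le (le_refl ‖T‖) hW
  refine (norm_sub_le _ _).trans ((add_le_add h1 h2).trans (le_of_eq (by ring)))

/-- Duhamel's formula in the interaction picture. -/
theorem interConj_apply_eq_add_integral (hħ : ħ ≠ 0) (hσ : 0 < σ) (hw : IsPotential σ w)
    (T : L2 (Fin N) →L[ℂ] L2 (Fin N)) (t : ℝ) (ψ : bosonic N) :
    interConj N ħ w t (onBosons N T) ψ = onBosons N T ψ + ∫ s in (0 : ℝ)..t,
      interConj N ħ w s (onBosons N ((I / (ħ : ℂ)) • ⁅interactionAt N ħ w s, T⁆)) ψ := by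
  have h := eq_add_integral_of_hasDerivAt_inner
    (f := fun s => interConj N ħ w s (onBosons N T) ψ)
    (g := fun s => interConj N ħ w s
      (onBosons N ((I / (ħ : ℂ)) • ⁅interactionAt N ħ w s, T⁆)) ψ)
    (continuous_interConj hħ hσ hw continuous_id
      (continuous_onBosons (continuous_lie_interactionAt hħ T))
      (fun s => (norm_onBosons_le _).trans (norm_lie_interactionAt_le hħ T s)) ψ)
    (fun φ s => by
      simp only [inner_interConj hħ hσ hw]
      exact (isSchrodingerGroup_freeGroup hħ).hasDerivAt_inner (inner_interaction hσ hw)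
        (isSchrodingerGroup_full hħ hσ hw) hħ T φ ψ s) t
  rw [interConj_zero_left hħ hσ hw] at h
  exact h

end Duhamel

/-! ### Splitting the commutator with the interaction into tree and loop parts. -/

section Combinatorics

variable {m N : ℕ} {ħ σ B : ℝ} {w : E3 → ℝ}

/-- Pairs are sorted by how many members lie among the first `m`: two, one (with `N - m` equal terms
for each inner index), or none. -/
theorem sum_pairs_split {M : Type*} [AddCommMonoid M] (h : m ≤ N) (F : Fin N → Fin N → M)
    (G : Fin m → M) (h0 : ∀ i j : Fin N, m ≤ i.val → i < j → F i j = 0)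
    (hG : ∀ (i : Fin m) (j : Fin N), m ≤ j.val → F (Fin.castLE h i) j = G i) :
    ∑ i, ∑ j ∈ Finset.Ioi i, F i j =
      ∑ i : Fin m, ∑ j ∈ Finset.Ioi i, F (Fin.castLE h i) (Fin.castLE h j) +
        (N - m) • ∑ i, G i := by
  obtain ⟨d, rfl⟩ := Nat.exists_eq_add_of_le h
  have h1 : ∀ {n : ℕ} (i : Fin n) (g : Fin n → M), ∑ j ∈ Finset.Ioi i, g j =
      ∑ j, if i < j then g j else 0 := fun i g => by
    rw [← Finset.sum_filter]
    congr 1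
    ext j; simp
  simp only [h1]
  rw [Fin.sum_univ_add, Nat.add_sub_cancel_left, Finset.smul_sum]
  have e2 : ∑ i : Fin d, ∑ j, (if Fin.natAdd m i < j then F (Fin.natAdd m i) j else 0) = 0 := by
    refine Finset.sum_eq_zero fun i _ => Finset.sum_eq_zero fun j _ => ?_
    split_ifs with hij
    · exact h0 _ _ (Nat.le_add_right _ _) hij
    · rfl
  rw [e2, add_zero, ← Finset.sum_add_distrib]
  refine Finset.sum_congr rfl fun i _ => ?_
  rw [Fin.sum_univ_add]
  congr 1
  have e3 : ∀ j : Fin d, (if Fin.castAdd d i < Fin.natAdd m j then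
      F (Fin.castAdd d i) (Fin.natAdd m j) else 0) = G i := fun j => by
    have hlt : Fin.castAdd d i < Fin.natAdd m j := by
      rw [Fin.lt_def, Fin.val_castAdd, Fin.val_natAdd]
      omega
    rw [if_pos hlt]
    exact hG i _ (Nat.le_add_right _ _)
  simp only [e3, Finset.sum_const, Finset.card_univ, Fintype.card_fin]

theorem interactionAt_eq (s : ℝ) : interactionAt N ħ w s =
    (1 / (N : ℂ)) • ∑ i : Fin N, ∑ j ∈ Finset.Ioi i, pairAt ħ w s i j := by
  refine ContinuousLinearMap.ext fun ψ => ?_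
  simp only [interactionAt, interaction, pairAt, heisenberg_apply, smul_apply, sum_apply,
    map_smul, map_sum]

theorem smul_commutator {A : Type*} [Ring A] [Algebra ℂ A] (r : ℂ) (S T : A) :
    ⁅r • S, T⁆ = r • ⁅S, T⁆ := by
  rw [Ring.lie_def, Ring.lie_def, smul_mul_assoc, mul_smul_comm, smul_sub]

theorem sum_commutator {A κ : Type*} [Ring A] (s : Finset κ) (S : κ → A) (T : A) :
    ⁅∑ k ∈ s, S k, T⁆ = ∑ k ∈ s, ⁅S k, T⁆ := by
  simp only [Ring.lie_def, Finset.sum_mul, Finset.mul_sum, Finset.sum_sub_distrib]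

/-- The transposition of `j` and `k` fixes the first `m` particles and is invisible between bosonic
states, so all outer partners contribute equally. -/
theorem onBosons_commutator_swap (hħ : ħ ≠ 0) (hσ : 0 < σ) (hw : IsPotential σ w) (h : m ≤ N)
    (s : ℝ) {b : L2 (Fin m) →L[ℂ] L2 (Fin m)} (hb : WeylBound ħ 0 B b) (i : Fin m)
    {j k : Fin N} (hj : m ≤ j.val) (hk : m ≤ k.val) :
    onBosons N ⁅pairAt ħ w s (Fin.castLE h i) j, ampliation h b⁆ =
      onBosons N ⁅pairAt ħ w s (Fin.castLE h i) k, ampliation h b⁆ := by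
  have hij : Fin.castLE h i ≠ j := fun e => by
    have : j.val < m := by rw [← e]; exact i.2
    omega
  have hfix : ∀ l : Fin N, l.val < m → Equiv.swap j k l = l := fun l hl =>
    Equiv.swap_apply_of_ne_of_ne (fun e => by rw [e] at hl; omega) (fun e => by
      rw [e] at hl; omega)
  refine onBosons_eq_of_permute (Equiv.swap j k) fun ψ => ?_
  simp only [Ring.lie_def, sub_apply, mul_apply_eq_comp, map_sub,
    permuteL2_pairAt hħ hσ hw _ s hij, permuteL2_ampliation h hb _ hfix]
  rw [Equiv.symm_swap, hfix _ (show (Fin.castLE h i).val < m from i.2), Equiv.swap_apply_left]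

/-- Choosing particle `m + 1` as the outer partner turns the commutator into an ampliation from `m +
1` particles. -/
theorem onBosons_commutator_ampliation (hħ : ħ ≠ 0) (hσ : 0 < σ) (hw : IsPotential σ w)
    (h : m + 1 ≤ N) (s : ℝ) {b : L2 (Fin m) →L[ℂ] L2 (Fin m)} (hb : WeylBound ħ 0 B b)
    (i : Fin m) {j : Fin N} (hj : m ≤ j.val) :
    onBosons N ⁅pairAt ħ w s (Fin.castLE (Nat.le_of_succ_le h) i) j,
        ampliation (Nat.le_of_succ_le h) b⁆ =
      onBosons N (ampliation h ⁅pairAt ħ w s (Fin.castSucc i) (Fin.last m),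
        ampliation (Nat.le_succ m) b⁆) := by
  rw [onBosons_commutator_swap hħ hσ hw (Nat.le_of_succ_le h) s hb i hj
    (k := Fin.castLE h (Fin.last m)) le_rfl,
    ampliation_commutator h (hw.weylBound_pairAt hσ (castSucc_ne_last i) hħ s)
      (hb.ampliation (Nat.le_succ m)),
    ampliation_pairAt hħ hσ hw h s (castSucc_ne_last i), ampliation_ampliation _ h hb]
  rfl

theorem secondQuant_eq (h : m ≤ N) (b : L2 (Fin m) →L[ℂ] L2 (Fin m)) : secondQuant N m b =
    ((N.descFactorial m : ℂ) / (N : ℂ) ^ m) • onBosons N (ampliation h b) := dif_pos h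

theorem secondQuant_of_lt (h : N < m) (b : L2 (Fin m) →L[ℂ] L2 (Fin m)) :
    secondQuant N m b = 0 := dif_neg (not_le.mpr h)

/-- Coupling `1/N` times `N - m` equal partners is exactly the ratio of consecutive normalizations,
so the tree part carries no error term. -/
theorem descFactorial_ratio_succ (h : m < N) :
    ((N.descFactorial m : ℂ) / (N : ℂ) ^ m) * ((1 / (N : ℂ)) * ((N - m : ℕ) : ℂ)) =
      (N.descFactorial (m + 1) : ℂ) / (N : ℂ) ^ (m + 1) := by
  have hN : (N : ℂ) ≠ 0 := by exact_mod_cast (by omega : N ≠ 0)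
  rw [Nat.descFactorial_succ, pow_succ]
  push_cast
  field_simp

/-- The sum of the commutators of the added particle with the others. -/
def treeStep (ħ : ℝ) (w : E3 → ℝ) (s : ℝ) (b : L2 (Fin m) →L[ℂ] L2 (Fin m)) :
    L2 (Fin (m + 1)) →L[ℂ] L2 (Fin (m + 1)) :=
  (I / (ħ : ℂ)) • ∑ i : Fin m, ⁅pairAt ħ w s (Fin.castSucc i) (Fin.last m),
    ampliation (Nat.le_succ m) b⁆

/-- The sum of the commutators of the particles already present. -/
def loopStep (N : ℕ) (ħ : ℝ) (w : E3 → ℝ) (s : ℝ) (b : L2 (Fin m) →L[ℂ] L2 (Fin m)) :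
    bosonic N →L[ℂ] bosonic N :=
  (I / (ħ : ℂ)) • ∑ i : Fin m, ∑ j ∈ Finset.Ioi i, secondQuant N m ⁅pairAt ħ w s i j, b⁆

theorem ampliation_treeStep (hħ : ħ ≠ 0) (hσ : 0 < σ) (hw : IsPotential σ w) (h : m + 1 ≤ N)
    (s : ℝ) {b : L2 (Fin m) →L[ℂ] L2 (Fin m)} (hb : WeylBound ħ 0 B b) :
    ampliation h (treeStep ħ w s b) = (I / (ħ : ℂ)) • ∑ i : Fin m,
      ampliation h ⁅pairAt ħ w s (Fin.castSucc i) (Fin.last m),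
        ampliation (Nat.le_succ m) b⁆ := by
  have hb' := hb.ampliation (Nat.le_succ m)
  rw [treeStep, ampliation_smul h _
    ((weylBound_sum_commutator_zero hħ hσ hw castSucc_ne_last s hb').isAmpliation h),
    ampliation_sum _ h fun i _ => ((hw.weylBound_pairAt hσ (castSucc_ne_last i) hħ s).commutator
      hb').isAmpliation h]

theorem secondQuant_commutator_pairAt (hħ : ħ ≠ 0) (hσ : 0 < σ) (hw : IsPotential σ w)
    (h : m ≤ N) (s : ℝ) {b : L2 (Fin m) →L[ℂ] L2 (Fin m)} (hb : WeylBound ħ 0 B b) {i j : Fin m}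
    (hij : i ≠ j) : secondQuant N m ⁅pairAt ħ w s i j, b⁆ =
      ((N.descFactorial m : ℂ) / (N : ℂ) ^ m) • onBosons N
        ⁅pairAt ħ w s (Fin.castLE h i) (Fin.castLE h j), ampliation h b⁆ := by
  rw [secondQuant_eq h, ampliation_commutator h (hw.weylBound_pairAt hσ hij hħ s) hb,
    ampliation_pairAt hħ hσ hw h s hij]

theorem loopStep_eq (hħ : ħ ≠ 0) (hσ : 0 < σ) (hw : IsPotential σ w) (h : m ≤ N) (s : ℝ)
    {b : L2 (Fin m) →L[ℂ] L2 (Fin m)} (hb : WeylBound ħ 0 B b) :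
    loopStep N ħ w s b = (I / (ħ : ℂ)) • ((N.descFactorial m : ℂ) / (N : ℂ) ^ m) •
      ∑ i : Fin m, ∑ j ∈ Finset.Ioi i, onBosons N
        ⁅pairAt ħ w s (Fin.castLE h i) (Fin.castLE h j), ampliation h b⁆ := by
  rw [loopStep, Finset.smul_sum (r := (N.descFactorial m : ℂ) / (N : ℂ) ^ m)]
  congr 1
  refine Finset.sum_congr rfl fun i _ => ?_
  rw [Finset.smul_sum]
  exact Finset.sum_congr rfl fun j hj =>
    secondQuant_commutator_pairAt hħ hσ hw h s hb (Finset.mem_Ioi.mp hj).ne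

theorem onBosons_smul_commutator_interactionAt (s : ℝ) (A : L2 (Fin N) →L[ℂ] L2 (Fin N)) :
    onBosons N ((I / (ħ : ℂ)) • ⁅interactionAt N ħ w s, A⁆) =
      (I / (ħ : ℂ)) • (1 / (N : ℂ)) • ∑ i : Fin N, ∑ j ∈ Finset.Ioi i,
        onBosons N ⁅pairAt ħ w s i j, A⁆ := by
  rw [interactionAt_eq, smul_commutator, sum_commutator, onBosons_smul, onBosons_smul,
    onBosons_sum]
  congr 2
  refine Finset.sum_congr rfl fun i _ => ?_
  rw [sum_commutator, onBosons_sum]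

/-- Commutators with the interaction produce a tree and a loop contribution. -/
theorem smul_onBosons_commutator_interactionAt (hħ : ħ ≠ 0) (hσ : 0 < σ) (hw : IsPotential σ w)
    (h : m ≤ N) (s : ℝ) {b : L2 (Fin m) →L[ℂ] L2 (Fin m)} (hb : WeylBound ħ 0 B b) :
    ((N.descFactorial m : ℂ) / (N : ℂ) ^ m) •
        onBosons N ((I / (ħ : ℂ)) • ⁅interactionAt N ħ w s, ampliation h b⁆) =
      secondQuant N (m + 1) (treeStep ħ w s b) + (1 / (N : ℂ)) • loopStep N ħ w s b := by
  have h0 : ∀ i j : Fin N, m ≤ i.val → i < j →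
      onBosons N ⁅pairAt ħ w s i j, ampliation h b⁆ = 0 := fun i j hi hij => by
    rw [commutator_pairAt_ampliation_eq_zero hħ hσ hw h s hij.ne hi
      (hi.trans (Fin.lt_def.mp hij).le) hb, onBosons_zero]
  rw [onBosons_smul_commutator_interactionAt, loopStep_eq hħ hσ hw h s hb]
  rcases h.lt_or_eq with hlt | heq
  · rw [sum_pairs_split h (fun i j => onBosons N ⁅pairAt ħ w s i j, ampliation h b⁆) _ h0
      (fun i j hj => onBosons_commutator_ampliation hħ hσ hw hlt s hb i hj),
      secondQuant_eq hlt, ampliation_treeStep hħ hσ hw hlt s hb, onBosons_smul, onBosons_sum,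
      ← descFactorial_ratio_succ hlt, ← Nat.cast_smul_eq_nsmul ℂ]
    module
  -- For `m = N` there is no outer particle; this agrees with the convention that `secondQuant`
  -- vanishes beyond `N` particles.
  · have hlt : N < m + 1 := by omega
    have h1 := secondQuant_of_lt hlt (treeStep ħ w s b)
    subst heq
    have h2 : ∀ i : Fin m, Fin.castLE h i = i := fun i => rfl
    simp only [h2]
    rw [h1, zero_add, smul_smul, smul_smul, smul_smul, smul_smul]
    congr 1
    ring

end Combinatorics


/-! ### Integrals over time-ordered simplices. -/

section TimeIntegral

variable {E : Type} [NormedAddCommGroup E]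

theorem continuous_cons {X : Type*} [TopologicalSpace X] {n : ℕ} {f : X → ℝ}
    {g : X → Fin n → ℝ} (hf : Continuous f) (hg : Continuous g) :
    Continuous fun x => (Fin.cons (f x) (g x) : Fin (n + 1) → ℝ) :=
  continuous_pi fun i => by
    refine Fin.cases ?_ (fun j => ?_) i
    · simpa using hf
    · exact (continuous_apply j).comp hg

/-- The upper limit must be a continuous function of the parameter, because in the induction it is
itself an outer integration variable. -/
theorem continuous_timeIntegral [NormedSpace ℝ E] {X : Type} [TopologicalSpace X]
    [FirstCountableTopology X] [LocallyCompactSpace X] {n : ℕ} {t : X → ℝ} (ht : Continuous t)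
    {f : X → (Fin n → ℝ) → E} (hf : Continuous fun q : X × (Fin n → ℝ) => f q.1 q.2) :
    Continuous fun x => timeIntegral n (t x) (f x) := by
  induction n generalizing X with
  | zero => exact hf.comp (continuous_id.prodMk continuous_const)
  | succ n ih =>
    have h1 : Continuous fun q : X × ℝ => timeIntegral n q.2 fun s => f q.1 (Fin.cons q.2 s) := by
      refine ih (X := X × ℝ) continuous_snd ?_
      exact hf.comp ((continuous_fst.comp continuous_fst).prodMk
        (continuous_cons (continuous_snd.comp continuous_fst) continuous_snd))
    exact intervalIntegral.continuous_parametric_intervalIntegral_of_continuous h1 ht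

theorem continuous_timeIntegral_cons [NormedSpace ℝ E] {n : ℕ} {f : (Fin (n + 1) → ℝ) → E}
    (hf : Continuous f) : Continuous fun r => timeIntegral n r fun s => f (Fin.cons r s) :=
  continuous_timeIntegral continuous_id
    (hf.comp (continuous_cons continuous_fst continuous_snd))

theorem continuous_comp_cons {n : ℕ} {f : (Fin (n + 1) → ℝ) → E} (hf : Continuous f) (r : ℝ) :
    Continuous fun s : Fin n → ℝ => f (Fin.cons r s) :=
  hf.comp (continuous_cons continuous_const continuous_id)

theorem timeIntegral_add [NormedSpace ℝ E] {n : ℕ} {f g : (Fin n → ℝ) → E} (hf : Continuous f)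
    (hg : Continuous g) (t : ℝ) : timeIntegral n t (fun s => f s + g s) =
      timeIntegral n t f + timeIntegral n t g := by
  induction n generalizing t with
  | zero => rfl
  | succ n ih =>
    simp only [timeIntegral]
    rw [← intervalIntegral.integral_add
      ((continuous_timeIntegral_cons hf).intervalIntegrable _ _)
      ((continuous_timeIntegral_cons hg).intervalIntegrable _ _)]
    congr 1
    funext r
    exact ih (continuous_comp_cons hf r) (continuous_comp_cons hg r) r

theorem timeIntegral_smul [NormedSpace ℂ E] {n : ℕ} (c : ℂ) (f : (Fin n → ℝ) → E) (t : ℝ) :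
    timeIntegral n t (fun s => c • f s) = c • timeIntegral n t f := by
  induction n generalizing t with
  | zero => rfl
  | succ n ih =>
    simp only [timeIntegral]
    rw [← intervalIntegral.integral_smul]
    congr 1
    funext r
    exact ih _ r

theorem norm_timeIntegral_le [NormedSpace ℝ E] {n : ℕ} {f : (Fin n → ℝ) → E} (hf : Continuous f)
    {t C : ℝ} (ht : 0 ≤ t) (hC : ∀ s : Fin n → ℝ, (∀ i, 0 ≤ s i ∧ s i ≤ t) → ‖f s‖ ≤ C) :
    ‖timeIntegral n t f‖ ≤ C * (t ^ n / n.factorial) := by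
  induction n generalizing t with
  | zero =>
    simpa [timeIntegral] using hC Fin.elim0 (fun i => i.elim0)
  | succ n ih =>
    have h1 : ∀ r ∈ Set.Icc 0 t, ‖timeIntegral n r fun s => f (Fin.cons r s)‖ ≤
        C * (r ^ n / n.factorial) := fun r hr =>
      ih (continuous_comp_cons hf r) hr.1 fun s hs => hC _ fun i => by
        refine Fin.cases ?_ (fun j => ?_) i
        · simpa using hr
        · simpa using ⟨(hs j).1, (hs j).2.trans hr.2⟩
    have h2 : ∫ r in (0 : ℝ)..t, C * (r ^ n / n.factorial) =
        C * (t ^ (n + 1) / (n + 1).factorial) := by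
      rw [intervalIntegral.integral_const_mul, intervalIntegral.integral_div, integral_pow,
        Nat.factorial_succ]
      push_cast
      field_simp
      simp
    rw [← h2]
    exact intervalIntegral.norm_integral_le_of_norm_le ht
      (Filter.Eventually.of_forall fun r hr => h1 r (Set.Ioc_subset_Icc_self hr))
      (Continuous.intervalIntegrable (by fun_prop) _ _)

/-- The definition peels off the outermost variable, whereas Duhamel's formula is inserted at the
innermost one. The upper limit is the last entry of `(t, s)`, which is `t` itself when `n = 0`. -/
theorem timeIntegral_succ_eq [NormedSpace ℝ E] {n : ℕ} (t : ℝ) (f : (Fin (n + 1) → ℝ) → E) :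
    timeIntegral (n + 1) t f = timeIntegral n t fun s =>
      ∫ r in (0 : ℝ)..(Fin.cons t s : Fin (n + 1) → ℝ) (Fin.last n), f (Fin.snoc s r) := by
  induction n generalizing t with
  | zero =>
    change ∫ r in (0 : ℝ)..t, f (Fin.cons r Fin.elim0) =
      ∫ r in (0 : ℝ)..t, f (Fin.snoc Fin.elim0 r)
    congr 1
    funext r
    congr 1
    funext i
    rw [show i = Fin.last 0 from Fin.ext (by omega), Fin.snoc_last]
    rfl
  | succ n ih =>
    change ∫ r in (0 : ℝ)..t, timeIntegral (n + 1) r (fun s => f (Fin.cons r s)) =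
      ∫ r in (0 : ℝ)..t, timeIntegral n r fun s =>
        ∫ r' in (0 : ℝ)..(Fin.cons t (Fin.cons r s : Fin (n + 1) → ℝ) : Fin (n + 2) → ℝ)
          (Fin.last (n + 1)), f (Fin.snoc (Fin.cons r s : Fin (n + 1) → ℝ) r')
    congr 1
    funext r
    rw [ih]
    congr 1
    funext s
    have e : (Fin.cons t (Fin.cons r s : Fin (n + 1) → ℝ) : Fin (n + 2) → ℝ) (Fin.last (n + 1)) =
        (Fin.cons r s : Fin (n + 1) → ℝ) (Fin.last n) := rfl
    rw [e]
    congr 1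
    funext r'
    congr 1
    exact Fin.cons_snoc_eq_snoc_cons (β := ℝ) r s r'

theorem exists_isTimeIntegral [NormedSpace ℂ E] {n : ℕ} {t C : ℝ} (ht : 0 ≤ t)
    {F : (Fin n → ℝ) → E →L[ℂ] E} (hF : ∀ ψ, Continuous fun s => F s ψ)
    (hC : ∀ s : Fin n → ℝ, (∀ i, 0 ≤ s i ∧ s i ≤ t) → ‖F s‖ ≤ C) :
    ∃ T, IsTimeIntegral n t F T ∧ ‖T‖ ≤ C * (t ^ n / n.factorial) := by
  have hC0 : 0 ≤ C := (norm_nonneg _).trans (hC (fun _ => 0) fun i => ⟨le_rfl, ht⟩)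
  have hb : ∀ ψ, ‖timeIntegral n t fun s => F s ψ‖ ≤ C * (t ^ n / n.factorial) * ‖ψ‖ := by
    intro ψ
    refine (norm_timeIntegral_le (hF ψ) ht fun s hs => ((F s).le_opNorm ψ).trans
      (mul_le_mul_of_nonneg_right (hC s hs) (norm_nonneg ψ))).trans (le_of_eq ?_)
    ring
  refine ⟨LinearMap.mkContinuous
    { toFun := fun ψ => timeIntegral n t fun s => F s ψ
      map_add' := fun ψ φ => by
        simp only [map_add]
        exact timeIntegral_add (hF ψ) (hF φ) t
      map_smul' := fun r ψ => by
        simp only [map_smul]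
        exact timeIntegral_smul r _ t } _ hb, fun ψ => ⟨hF ψ, rfl⟩, ?_⟩
  exact LinearMap.mkContinuous_norm_le _ (by positivity) _

end TimeIntegral

/-! ### Elementary operator norm inequalities. -/

section OperatorNorm

variable {E κ : Type} [NormedAddCommGroup E] [InnerProductSpace ℂ E]

theorem opNorm_smul_le_mul (c : ℂ) (X : E →L[ℂ] E) : ‖c • X‖ ≤ ‖c‖ * ‖X‖ := norm_smul_le c X

theorem opNorm_sum_le_sum (s : Finset κ) (X : κ → E →L[ℂ] E) :
    ‖∑ k ∈ s, X k‖ ≤ ∑ k ∈ s, ‖X k‖ := norm_sum_le s X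

theorem smul_sum_sum_zero {κ' : Type} (c : ℂ) (s : Finset κ) (s' : κ → Finset κ') :
    c • ∑ i ∈ s, ∑ _j ∈ s' i, (0 : E →L[ℂ] E) = 0 := by simp

end OperatorNorm

/-! ### Norms and continuity of the integrands. -/

section Terms

variable {p N : ℕ} {ħ σ t A : ℝ} {w : E3 → ℝ} {a : L2 (Fin p) →L[ℂ] L2 (Fin p)}

theorem norm_descFactorial_div_le (N m : ℕ) :
    ‖(N.descFactorial m : ℂ) / (N : ℂ) ^ m‖ ≤ 1 := by
  rw [norm_div, norm_pow, Complex.norm_natCast, Complex.norm_natCast]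
  refine div_le_one_of_le₀ ?_ (by positivity)
  exact_mod_cast Nat.descFactorial_le_pow N m

theorem WeylBound.norm_secondQuant_le {m : ℕ} {b : L2 (Fin m) →L[ℂ] L2 (Fin m)}
    (hb : WeylBound ħ 0 A b) (N : ℕ) : ‖secondQuant N m b‖ ≤ A := by
  by_cases h : m ≤ N
  · rw [secondQuant_eq h]
    refine (opNorm_smul_le_mul _ _).trans ?_
    refine (mul_le_mul (norm_descFactorial_div_le N m) ((norm_onBosons_le _).trans
      ((hb.ampliation h).norm_le le_rfl)) (ContinuousLinearMap.opNorm_nonneg _)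
        zero_le_one).trans (one_mul A).le
  · rw [secondQuant_of_lt (not_le.mp h)]
    exact ContinuousLinearMap.opNorm_zero.trans_le hb.zero_le

theorem continuous_secondQuant {X : Type*} [TopologicalSpace X] {m : ℕ}
    {T : X → L2 (Fin m) →L[ℂ] L2 (Fin m)} (hT : ∀ x, WeylBound ħ 0 A (T x))
    (hc : ∀ ψ, Continuous fun x => T x ψ) (ψ : bosonic N) :
    Continuous fun x => secondQuant N m (T x) ψ := by
  by_cases h : m ≤ N
  · simp only [secondQuant_eq h, smul_apply]
    exact (continuous_onBosons (continuous_ampliation h hT hc) ψ).const_smul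
      ((N.descFactorial m : ℂ) / (N : ℂ) ^ m)
  · simp only [secondQuant_of_lt (not_le.mp h)]
    exact continuous_const

theorem continuous_treeTerm (hħ : ħ ≠ 0) (hσ : 0 < σ) (hw : IsPotential σ w) (t : ℝ)
    (ha : WeylBound ħ 0 A a) (n : ℕ) (ψ : bosonic N) :
    Continuous fun s => treeTerm N ħ w t a n s ψ := by
  obtain ⟨C, hC⟩ := exists_weylBound_tree hħ hσ hw t ha n
  exact continuous_secondQuant hC (continuous_tree hħ hσ hw t ha n) ψ

theorem continuous_last {n : ℕ} (t : ℝ) :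
    Continuous fun s : Fin n → ℝ => (Fin.cons t s : Fin (n + 1) → ℝ) (Fin.last n) :=
  (continuous_apply (Fin.last n)).comp (continuous_cons continuous_const continuous_id)

theorem continuous_remainderTerm (hħ : ħ ≠ 0) (hσ : 0 < σ) (hw : IsPotential σ w) (t : ℝ)
    (ha : WeylBound ħ 0 A a) (n : ℕ) (ψ : bosonic N) :
    Continuous fun s => remainderTerm N ħ w t a n s ψ := by
  obtain ⟨C, hC⟩ := exists_weylBound_tree hħ hσ hw t ha n
  have h := continuous_interConj hħ hσ hw (continuous_last (n := n) t)
    (continuous_treeTerm (N := N) hħ hσ hw t ha n) (fun s => (hC s).norm_secondQuant_le N) ψ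
  exact h.sub (continuous_treeTerm hħ hσ hw t ha n ψ)

theorem loopTerm_eq (n : ℕ) (s : Fin (n + 1) → ℝ) : loopTerm N ħ w t a n s =
    interConj N ħ w (s (Fin.last n))
      (loopStep N ħ w (s (Fin.last n)) (tree ħ w t a n (Fin.init s))) := rfl

/-- With all pairs under one second quantization, the weighted bound of the whole sum applies, which
grows like the number of particles rather than the number of pairs. -/
theorem loopStep_eq_secondQuant {m : ℕ} (hħ : ħ ≠ 0) (hσ : 0 < σ) (hw : IsPotential σ w) (s : ℝ)
    {b : L2 (Fin m) →L[ℂ] L2 (Fin m)} (hb : WeylBound ħ 0 A b) :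
    loopStep N ħ w s b = secondQuant N m
      ((I / (ħ : ℂ)) • ∑ i : Fin m, ∑ j ∈ Finset.Ioi i, ⁅pairAt ħ w s i j, b⁆) := by
  by_cases h : m ≤ N
  · have hc : ∀ i : Fin m, ∀ j ∈ Finset.Ioi i, WeylBound ħ 0 _ ⁅pairAt ħ w s i j, b⁆ :=
      fun i j hj => (hw.weylBound_pairAt hσ (Finset.mem_Ioi.mp hj).ne hħ s).commutator hb
    have h1 : ampliation h (∑ i : Fin m, ∑ j ∈ Finset.Ioi i, ⁅pairAt ħ w s i j, b⁆) =
        ∑ i : Fin m, ∑ j ∈ Finset.Ioi i, ampliation h ⁅pairAt ħ w s i j, b⁆ ∧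
        IsAmpliation h (∑ i : Fin m, ∑ j ∈ Finset.Ioi i, ⁅pairAt ħ w s i j, b⁆)
          (ampliation h (∑ i : Fin m, ∑ j ∈ Finset.Ioi i, ⁅pairAt ħ w s i j, b⁆)) := by
      rw [sum_Ioi_eq_sum_subtype, sum_Ioi_eq_sum_subtype]
      refine ⟨ampliation_sum _ h fun q _ =>
        (hc q.1.1 q.1.2 (Finset.mem_Ioi.mpr q.2)).isAmpliation h, ?_⟩
      exact (weylBound_sum_commutator_zero hħ hσ hw
        (i := fun q : {q : Fin m × Fin m // q.1 < q.2} => q.1.1) (j := fun q => q.1.2)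
        (fun q => q.2.ne) s hb).isAmpliation h
    rw [loopStep, secondQuant_eq h, ampliation_smul h _ h1.2, h1.1, onBosons_smul, onBosons_sum,
      smul_comm, Finset.smul_sum (r := (N.descFactorial m : ℂ) / (N : ℂ) ^ m)]
    congr 1
    refine Finset.sum_congr rfl fun i _ => ?_
    rw [onBosons_sum, Finset.smul_sum]
    exact Finset.sum_congr rfl fun j _ => secondQuant_eq h _
  · rw [loopStep, secondQuant_of_lt (not_le.mp h)]
    simp only [secondQuant_of_lt (not_le.mp h)]
    exact smul_sum_sum_zero _ _ _

end Terms


/-! ### Integrating a one-step identity over the simplex. -/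

section Expansion

variable {E : Type} [NormedAddCommGroup E] [NormedSpace ℂ E]

theorem smul_eq_add_integral {c : ℂ} {x y : E} {f g : ℝ → E} {t : ℝ}
    (h : x = y + ∫ s in (0 : ℝ)..t, f s) (hg : ∀ s, c • f s = g s) :
    c • x = c • y + ∫ s in (0 : ℝ)..t, g s := by
  rw [h, smul_add, ← intervalIntegral.integral_smul]
  simp only [hg]

theorem timeIntegral_congr {n : ℕ} {f g : (Fin n → ℝ) → E} (h : ∀ s, f s = g s) {t : ℝ} :
    timeIntegral n t f = timeIntegral n t g := by
  rw [funext h]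

theorem IsTimeIntegral.eq_add_add_smul {n : ℕ} {t : ℝ} {c : ℂ} {F : (Fin n → ℝ) → E →L[ℂ] E}
    {G G' L : (Fin (n + 1) → ℝ) → E →L[ℂ] E} {R B R' Q : E →L[ℂ] E}
    (hR : IsTimeIntegral n t F R) (hB : IsTimeIntegral (n + 1) t G B)
    (hR' : IsTimeIntegral (n + 1) t G' R') (hQ : IsTimeIntegral (n + 1) t L Q)
    (h : ∀ s ψ, F s ψ = ∫ r in (0 : ℝ)..(Fin.cons t s : Fin (n + 1) → ℝ) (Fin.last n),
      (G (Fin.snoc s r) ψ + G' (Fin.snoc s r) ψ + c • L (Fin.snoc s r) ψ)) :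
    R = B + R' + c • Q := by
  refine ContinuousLinearMap.ext fun ψ => ?_
  have e : ∀ ψ, (B + R' + c • Q) ψ = B ψ + R' ψ + c • Q ψ := fun ψ => rfl
  rw [e, (hR ψ).2, (hB ψ).2, (hR' ψ).2, (hQ ψ).2, ← timeIntegral_smul,
    ← timeIntegral_add (hB ψ).1 (hR' ψ).1,
    timeIntegral_congr (h · ψ),
    ← timeIntegral_succ_eq t fun s => G s ψ + G' s ψ + c • L s ψ]
  exact timeIntegral_add ((hB ψ).1.add (hR' ψ).1) ((hQ ψ).1.const_smul c) t

end Expansion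

/-! ### The one-step expansion of the remainder. -/

section Bosons

variable {p m N : ℕ} {ħ σ A : ℝ} {w : E3 → ℝ} {a : L2 (Fin p) →L[ℂ] L2 (Fin p)}

/-- Duhamel's formula with its commutator split into tree and loop parts. For `m > N` all terms
vanish. -/
theorem interConj_secondQuant_apply (hħ : ħ ≠ 0) (hσ : 0 < σ) (hw : IsPotential σ w)
    {b : L2 (Fin m) →L[ℂ] L2 (Fin m)} (hb : WeylBound ħ 0 A b) (t : ℝ) (ψ : bosonic N) :
    interConj N ħ w t (secondQuant N m b) ψ = secondQuant N m b ψ + ∫ s in (0 : ℝ)..t,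
      (interConj N ħ w s (secondQuant N (m + 1) (treeStep ħ w s b)) ψ +
        (1 / (N : ℂ)) • interConj N ħ w s (loopStep N ħ w s b) ψ) := by
  by_cases h : m ≤ N
  · rw [secondQuant_eq h, interConj_smul]
    refine smul_eq_add_integral
      (interConj_apply_eq_add_integral hħ hσ hw (ampliation h b) t ψ) fun s => ?_
    have h1 := smul_onBosons_commutator_interactionAt hħ hσ hw h s hb
    have h2 := congrArg (fun X => interConj N ħ w s X ψ) h1
    simp only [interConj_smul, interConj_add] at h2
    exact h2
  · have h1 : ∀ s, interConj N ħ w s 0 ψ = 0 := fun s => by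
      rw [interConj_apply]
      exact (congrArg _ (map_zero (bosonFree N ħ s))).trans (map_zero (bosonFull N ħ w (-s)))
    have h2 : ∀ s, loopStep N ħ w s b = 0 := fun s => by
      rw [loopStep]
      simp only [secondQuant_of_lt (not_le.mp h)]
      exact smul_sum_sum_zero _ _ _
    have h3 : ∀ s, secondQuant N (m + 1) (treeStep ħ w s b) = 0 := fun s =>
      secondQuant_of_lt (by omega) _
    rw [secondQuant_of_lt (not_le.mp h)]
    simp only [h2, h3, h1]
    simp

/-- The conjugated tree term of the next order is written as the tree term itself plus the next
remainder; the loop part is kept conjugated and is not expanded further. -/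
theorem remainderTerm_apply (hħ : ħ ≠ 0) (hσ : 0 < σ) (hw : IsPotential σ w) (t : ℝ)
    (ha : WeylBound ħ 0 A a) (n : ℕ) (s : Fin n → ℝ) (ψ : bosonic N) :
    remainderTerm N ħ w t a n s ψ =
      ∫ r in (0 : ℝ)..(Fin.cons t s : Fin (n + 1) → ℝ) (Fin.last n),
        (treeTerm N ħ w t a (n + 1) (Fin.snoc s r) ψ +
          remainderTerm N ħ w t a (n + 1) (Fin.snoc s r) ψ +
          (1 / (N : ℂ)) • loopTerm N ħ w t a n (Fin.snoc s r) ψ) := by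
  obtain ⟨C, hC⟩ := exists_weylBound_tree hħ hσ hw t ha n
  have h := interConj_secondQuant_apply hħ hσ hw (hC s)
    ((Fin.cons t s : Fin (n + 1) → ℝ) (Fin.last n)) ψ
  have e : remainderTerm N ħ w t a n s ψ =
    interConj N ħ w ((Fin.cons t s : Fin (n + 1) → ℝ) (Fin.last n))
      (secondQuant N (p + n) (tree ħ w t a n s)) ψ -
        secondQuant N (p + n) (tree ħ w t a n s) ψ := rfl
  rw [e, h, add_sub_cancel_left]
  congr 1
  funext r
  have h1 : treeTerm N ħ w t a (n + 1) (Fin.snoc s r) =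
      secondQuant N (p + n + 1) (treeStep ħ w r (tree ħ w t a n s)) := by
    simp only [treeTerm, tree, treeStep, Fin.init_snoc, Fin.snoc_last]
    rfl
  have h2 : loopTerm N ħ w t a n (Fin.snoc s r) =
      interConj N ħ w r (loopStep N ħ w r (tree ħ w t a n s)) := by
    rw [loopTerm_eq, Fin.init_snoc, Fin.snoc_last]
  -- The conjugation time of the next remainder is the newly appended innermost variable.
  have h3 : (Fin.cons t (Fin.snoc s r : Fin (n + 1) → ℝ) : Fin (n + 2) → ℝ)
      (Fin.last (n + 1)) = r := by
    rw [← Fin.succ_last, Fin.cons_succ, Fin.snoc_last]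
  have h4 : remainderTerm N ħ w t a (n + 1) (Fin.snoc s r) ψ =
      interConj N ħ w r (treeTerm N ħ w t a (n + 1) (Fin.snoc s r)) ψ -
        treeTerm N ħ w t a (n + 1) (Fin.snoc s r) ψ := by
    rw [remainderTerm, h3]
    rfl
  rw [h4, h2, h1, add_sub_cancel]

theorem continuous_loopTerm (hħ : ħ ≠ 0) (hσ : 0 < σ) (hw : IsPotential σ w) (t : ℝ)
    (ha : WeylBound ħ 0 A a) (n : ℕ) (ψ : bosonic N) :
    Continuous fun s => loopTerm N ħ w t a n s ψ := by
  obtain ⟨C, hC⟩ := exists_weylBound_tree hħ hσ hw t ha n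
  have hl : ∀ s : Fin (n + 1) → ℝ, loopTerm N ħ w t a n s = interConj N ħ w (s (Fin.last n))
      (secondQuant N (p + n) ((I / (ħ : ℂ)) • ∑ i : Fin (p + n), ∑ j ∈ Finset.Ioi i,
        ⁅pairAt ħ w (s (Fin.last n)) i j, tree ħ w t a n (Fin.init s)⁆)) := fun s => by
    rw [loopTerm_eq, loopStep_eq_secondQuant hħ hσ hw _ (hC _)]
  simp only [hl]
  have hb : ∀ s : Fin (n + 1) → ℝ, WeylBound ħ 0 _
      ((I / (ħ : ℂ)) • ∑ i : Fin (p + n), ∑ j ∈ Finset.Ioi i,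
        ⁅pairAt ħ w (s (Fin.last n)) i j, tree ħ w t a n (Fin.init s)⁆) := fun s => by
    rw [sum_Ioi_eq_sum_subtype]
    exact (weylBound_sum_commutator_zero hħ hσ hw
      (i := fun q : {q : Fin (p + n) × Fin (p + n) // q.1 < q.2} => q.1.1) (j := fun q => q.1.2)
      (fun q => q.2.ne) (s (Fin.last n)) (hC (Fin.init s))).const_smul _
  have hc : ∀ φ, Continuous fun s : Fin (n + 1) → ℝ =>
      ((I / (ħ : ℂ)) • ∑ i : Fin (p + n), ∑ j ∈ Finset.Ioi i,
        ⁅pairAt ħ w (s (Fin.last n)) i j, tree ħ w t a n (Fin.init s)⁆) φ := fun φ => by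
    have h0 : ∀ s : Fin (n + 1) → ℝ, ((I / (ħ : ℂ)) • ∑ i : Fin (p + n), ∑ j ∈ Finset.Ioi i,
        ⁅pairAt ħ w (s (Fin.last n)) i j, tree ħ w t a n (Fin.init s)⁆) φ = (I / (ħ : ℂ)) •
          ∑ i : Fin (p + n), ∑ j ∈ Finset.Ioi i,
            ⁅pairAt ħ w (s (Fin.last n)) i j, tree ħ w t a n (Fin.init s)⁆ φ := fun s => by
      simp only [smul_apply, sum_apply]
    simp only [h0]
    exact (continuous_finsetSum (M := L2 (Fin (p + n))) _ fun i _ =>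
      continuous_finsetSum (M := L2 (Fin (p + n))) _ fun j hj => continuous_loop hħ hσ hw t ha n
        (Finset.mem_Ioi.mp hj).ne φ).const_smul (I / (ħ : ℂ))
  exact continuous_interConj hħ hσ hw (continuous_apply (Fin.last n))
    (continuous_secondQuant hb hc)
    (fun s => (hb s).norm_secondQuant_le N) ψ

theorem heisenberg_bosonFull (hħ : ħ ≠ 0) (t : ℝ) (X : bosonic N →L[ℂ] bosonic N) :
    heisenberg (bosonFull N ħ w) t X =
      interConj N ħ w t (heisenberg (bosonFree N ħ) t X) := by
  have hU : ∀ t (φ : bosonic N), bosonFree N ħ (-t) (bosonFree N ħ t φ) = φ :=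
    (isSchrodingerGroup_freeGroup hħ).onBosons_neg_apply (freeGroup_permuteL2 hħ)
  refine ContinuousLinearMap.ext fun ψ => ?_
  rw [interConj_apply, heisenberg_apply, heisenberg_apply]
  have h1 := hU (-t)
  rw [neg_neg] at h1
  rw [h1, h1]

theorem heisenberg_bosonFree_secondQuant (hħ : ħ ≠ 0) (t : ℝ) (hb : WeylBound ħ 0 A a) :
    heisenberg (bosonFree N ħ) t (secondQuant N p a) =
      secondQuant N p (heisenberg (freeGroup (Fin p) ħ) t a) := by
  by_cases h : p ≤ N
  · rw [secondQuant_eq h, secondQuant_eq h, ampliation_heisenberg hħ h t hb]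
    refine ContinuousLinearMap.ext fun ψ => ?_
    have h1 : heisenberg (bosonFree N ħ) t (((N.descFactorial p : ℂ) / (N : ℂ) ^ p) •
        onBosons N (ampliation h a)) ψ = ((N.descFactorial p : ℂ) / (N : ℂ) ^ p) •
          bosonFree N ħ (-t) (onBosons N (ampliation h a) (bosonFree N ħ t ψ)) := by
      rw [heisenberg_apply, smul_apply, map_smul]
    have h2 : bosonFree N ħ (-t) (onBosons N (ampliation h a) (bosonFree N ħ t ψ)) =
        onBosons N (heisenberg (freeGroup (Fin N) ħ) t (ampliation h a)) ψ :=
      ext_inner_left ℂ fun φ => by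
        rw [inner_bosonFree hħ, inner_onBosons, inner_onBosons, coe_bosonFree hħ,
          coe_bosonFree hħ, heisenberg_apply, ← (isSchrodingerGroup_freeGroup hħ).inner_left]
    rw [h1, h2]
    rfl
  · rw [secondQuant_of_lt (not_le.mp h), secondQuant_of_lt (not_le.mp h)]
    refine ContinuousLinearMap.ext fun ψ => ?_
    rw [heisenberg_apply]
    exact map_zero (bosonFree N ħ (-t))

end Bosons


theorem opNorm_sub_le_add {E : Type} [NormedAddCommGroup E] [InnerProductSpace ℂ E]
    (X Y : E →L[ℂ] E) : ‖X - Y‖ ≤ ‖X‖ + ‖Y‖ := norm_sub_le X Y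

/-! ### Pointwise bounds on the terms of order `n`. -/

section Bounds

variable {p N : ℕ} {ħ σ t q A : ℝ} {w : E3 → ℝ} {a : L2 (Fin p) →L[ℂ] L2 (Fin p)}

theorem potentialNorm_nonneg (σ : ℝ) (w : E3 → ℝ) : 0 ≤ potentialNorm σ w :=
  integral_nonneg fun _ => by positivity

/-- The growth rate of the tree amplitudes: the `n`-th one is bounded by
`(n * growthRate q σ w) ^ n` on the time interval `|t| ≤ q - 1`. -/
def growthRate (q σ : ℝ) (w : E3 → ℝ) : ℝ :=
  q * (2 / σ) * potentialNorm σ w * (4 * q / σ)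

theorem growthRate_nonneg (hσ : 0 < σ) (hq : 0 ≤ q) : 0 ≤ growthRate q σ w := by
  have := potentialNorm_nonneg σ w
  unfold growthRate
  positivity

/-- The weight `σ/(4q)` is spent in `n` equal portions, which puts `n` into each of the `n` factors.
-/
theorem growthRate_eq (hσ : 0 < σ) (hq : 0 < q) {n : ℕ} (hn : 0 < n) :
    q * (2 / σ) * potentialNorm σ w / (σ / (4 * q) / n) = growthRate q σ w * n := by
  unfold growthRate
  field_simp

theorem norm_treeTerm_le (hħ : 0 < ħ) (hσ : 0 < σ) (hw : IsPotential σ w) (hq : 1 + |t| ≤ q)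
    (ha : WeylBound ħ σ A a) (n : ℕ) (s : Fin n → ℝ) (hs : ∀ i, 1 + |s i| ≤ q) :
    ‖treeTerm N ħ w t a n s‖ ≤ (growthRate q σ w * n) ^ n * A := by
  have hq0 : 0 < q := by linarith [abs_nonneg t]
  rcases n.eq_zero_or_pos with rfl | hn
  -- At order zero no weight is spent and `δ` is a dummy value.
  · have h := weylBound_tree hħ hσ hw hq ha (δ := 1) one_pos 0 (by simp; positivity) s hs
    refine ((h.mono (by simp; positivity) (le_of_eq ?_)).norm_secondQuant_le N)
    simp
  · have hn' : (0 : ℝ) < n := by exact_mod_cast hn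
    have h := weylBound_tree hħ hσ hw hq ha (δ := σ / (4 * q) / n) (by positivity) n
      (le_of_eq (by field_simp)) s hs
    refine ((h.mono (le_of_eq (by field_simp; ring)) (le_of_eq ?_)).norm_secondQuant_le N)
    rw [growthRate_eq hσ hq0 hn]

theorem norm_loopTerm_le (hħ : 0 < ħ) (hσ : 0 < σ) (hw : IsPotential σ w) (hq : 1 + |t| ≤ q)
    (ha : WeylBound ħ σ A a) (n : ℕ) (s : Fin (n + 1) → ℝ) (hs : ∀ i, 1 + |s i| ≤ q) :
    ‖loopTerm N ħ w t a n s‖ ≤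
      (p + n : ℕ) * ((growthRate q σ w * (n + 1 : ℕ)) ^ (n + 1) * A) := by
  have hq0 : 0 < q := by linarith [abs_nonneg t]
  have ha0 : WeylBound ħ 0 A a := ha.mono hσ.le le_rfl
  obtain ⟨C, hC⟩ := exists_weylBound_tree hħ.ne' hσ hw t ha0 n
  rw [loopTerm_eq, loopStep_eq_secondQuant hħ.ne' hσ hw _ (hC _)]
  refine (norm_interConj_le hħ.ne' hσ hw _ _).trans ?_
  have hn' : (0 : ℝ) < (n + 1 : ℕ) := by positivity
  -- `n + 1` portions: `n` for the tree amplitude and one for the loop commutator.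
  have h := weylBound_loop hħ hσ hw hq ha (δ := σ / (4 * q) / (n + 1 : ℕ)) (by positivity) n
    (le_of_eq (by field_simp)) s hs
  refine (h.norm_secondQuant_le N).trans (le_of_eq ?_)
  rw [growthRate_eq hσ hq0 n.succ_pos]

theorem norm_remainderTerm_le (hħ : 0 < ħ) (hσ : 0 < σ) (hw : IsPotential σ w)
    (hq : 1 + |t| ≤ q) (ha : WeylBound ħ σ A a) (n : ℕ) (s : Fin n → ℝ)
    (hs : ∀ i, 1 + |s i| ≤ q) :
    ‖remainderTerm N ħ w t a n s‖ ≤ 2 * ((growthRate q σ w * n) ^ n * A) := by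
  have h := norm_treeTerm_le (N := N) hħ hσ hw hq ha n s hs
  rw [two_mul]
  exact (opNorm_sub_le_add _ _).trans
    (add_le_add ((norm_interConj_le hħ.ne' hσ hw _ _).trans h) h)

end Bounds

/-! ### The expansion to arbitrary order, with bounds. -/

section Expansion

variable {p N : ℕ} {ħ σ t q A : ℝ} {w : E3 → ℝ} {a : L2 (Fin p) →L[ℂ] L2 (Fin p)}

theorem one_add_abs_le_of_mem {n : ℕ} (hq : 1 + t ≤ q) {s : Fin n → ℝ}
    (hs : ∀ i, 0 ≤ s i ∧ s i ≤ t) (i : Fin n) : 1 + |s i| ≤ q := by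
  rw [abs_of_nonneg (hs i).1]
  linarith [(hs i).2]

theorem exists_treeIntegral (hħ : 0 < ħ) (hσ : 0 < σ) (hw : IsPotential σ w) (ht : 0 ≤ t)
    (hq : 1 + t ≤ q) (ha : WeylBound ħ σ A a) (n : ℕ) :
    ∃ B : bosonic N →L[ℂ] bosonic N, IsTimeIntegral n t (treeTerm N ħ w t a n) B ∧
      ‖B‖ ≤ (growthRate q σ w * n) ^ n * A * (t ^ n / n.factorial) :=
  exists_isTimeIntegral ht
    (continuous_treeTerm hħ.ne' hσ hw t (ha.mono hσ.le le_rfl) n) fun s hs =>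
      norm_treeTerm_le hħ hσ hw ((abs_of_nonneg ht).symm ▸ hq) ha n s
        (one_add_abs_le_of_mem hq hs)

theorem exists_loopIntegral (hħ : 0 < ħ) (hσ : 0 < σ) (hw : IsPotential σ w) (ht : 0 ≤ t)
    (hq : 1 + t ≤ q) (ha : WeylBound ħ σ A a) (n : ℕ) :
    ∃ Q : bosonic N →L[ℂ] bosonic N, IsTimeIntegral (n + 1) t (loopTerm N ħ w t a n) Q ∧
      ‖Q‖ ≤ (p + n : ℕ) * ((growthRate q σ w * (n + 1 : ℕ)) ^ (n + 1) * A) *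
        (t ^ (n + 1) / (n + 1).factorial) :=
  exists_isTimeIntegral ht
    (continuous_loopTerm hħ.ne' hσ hw t (ha.mono hσ.le le_rfl) n) fun s hs =>
      norm_loopTerm_le hħ hσ hw ((abs_of_nonneg ht).symm ▸ hq) ha n s
        (one_add_abs_le_of_mem hq hs)

theorem exists_remainderIntegral (hħ : 0 < ħ) (hσ : 0 < σ) (hw : IsPotential σ w) (ht : 0 ≤ t)
    (hq : 1 + t ≤ q) (ha : WeylBound ħ σ A a) (n : ℕ) :
    ∃ R : bosonic N →L[ℂ] bosonic N, IsTimeIntegral n t (remainderTerm N ħ w t a n) R ∧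
      ‖R‖ ≤ 2 * ((growthRate q σ w * n) ^ n * A) * (t ^ n / n.factorial) :=
  exists_isTimeIntegral ht
    (continuous_remainderTerm hħ.ne' hσ hw t (ha.mono hσ.le le_rfl) n) fun s hs =>
      norm_remainderTerm_le hħ hσ hw ((abs_of_nonneg ht).symm ▸ hq) ha n s
        (one_add_abs_le_of_mem hq hs)

theorem IsTimeIntegral.eq_of_zero {E : Type} [NormedAddCommGroup E] [NormedSpace ℂ E]
    {F : (Fin 0 → ℝ) → E →L[ℂ] E} {T : E →L[ℂ] E} (h : IsTimeIntegral 0 t F T) :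
    T = F Fin.elim0 :=
  ContinuousLinearMap.ext fun ψ => (h ψ).2

/-- Telescoping of the remainders. -/
theorem expansion_succ {M : Type*} [AddCommGroup M] [Module ℂ M] {x x₀ : M} {B Q R : ℕ → M}
    {c : ℂ} (h0 : x = x₀ + R 0) (h : ∀ n, R n = B (n + 1) + R (n + 1) + c • Q (n + 1)) (k : ℕ) :
    x = x₀ + ∑ n ∈ Finset.Icc 1 k, B n + R k + c • ∑ n ∈ Finset.Icc 1 k, Q n := by
  induction k with
  | zero => simpa using h0
  | succ k ih =>
    rw [ih, h k, Finset.sum_Icc_succ_top (by omega), Finset.sum_Icc_succ_top (by omega)]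
    module

theorem heisenberg_eq_add_remainder (hħ : ħ ≠ 0) (ha : WeylBound ħ 0 A a)
    {R : bosonic N →L[ℂ] bosonic N} (hR : IsTimeIntegral 0 t (remainderTerm N ħ w t a 0) R) :
    heisenberg (bosonFull N ħ w) t (secondQuant N p a) =
      heisenberg (bosonFree N ħ) t (secondQuant N p a) + R := by
  have e : R = interConj N ħ w t (heisenberg (bosonFree N ħ) t (secondQuant N p a)) -
      heisenberg (bosonFree N ħ) t (secondQuant N p a) := by
    rw [hR.eq_of_zero, heisenberg_bosonFree_secondQuant hħ t ha]
    rfl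
  rw [e, heisenberg_bosonFull hħ]
  exact (add_sub_cancel _ _).symm

theorem exists_expansion (hħ : 0 < ħ) (hσ : 0 < σ) (hw : IsPotential σ w) (ht : 0 ≤ t)
    (hq : 1 + t ≤ q) (ha : WeylBound ħ σ A a) (N : ℕ) :
    ∃ B Q R : ℕ → bosonic N →L[ℂ] bosonic N,
      (∀ n, IsTimeIntegral n t (treeTerm N ħ w t a n) (B n)) ∧
      (∀ n, IsTimeIntegral (n + 1) t (loopTerm N ħ w t a n) (Q (n + 1))) ∧
      (∀ n, IsTimeIntegral n t (remainderTerm N ħ w t a n) (R n)) ∧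
      (∀ n, ‖B n‖ ≤ (growthRate q σ w * n) ^ n * A * (t ^ n / n.factorial)) ∧
      (∀ n, ‖Q (n + 1)‖ ≤ (p + n : ℕ) * ((growthRate q σ w * (n + 1 : ℕ)) ^ (n + 1) * A) *
        (t ^ (n + 1) / (n + 1).factorial)) ∧
      (∀ n, ‖R n‖ ≤ 2 * ((growthRate q σ w * n) ^ n * A) * (t ^ n / n.factorial)) ∧
      ∀ k, heisenberg (bosonFull N ħ w) t (secondQuant N p a) =
        heisenberg (bosonFree N ħ) t (secondQuant N p a) + ∑ n ∈ Finset.Icc 1 k, B n + R k +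
          (1 / (N : ℂ)) • ∑ n ∈ Finset.Icc 1 k, Q n := by
  choose B hB hB' using exists_treeIntegral (N := N) hħ hσ hw ht hq ha
  choose Q hQ hQ' using exists_loopIntegral (N := N) hħ hσ hw ht hq ha
  choose R hR hR' using exists_remainderIntegral (N := N) hħ hσ hw ht hq ha
  have ha0 : WeylBound ħ 0 A a := ha.mono hσ.le le_rfl
  -- Loop terms are produced with index shifted by one; the value at `0` is never used.
  refine ⟨B, fun n => Q (n - 1), R, hB, hQ, hR, hB', hQ', hR', ?_⟩
  refine expansion_succ (heisenberg_eq_add_remainder hħ.ne' ha0 (hR 0)) fun n => ?_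
  exact (hR n).eq_add_add_smul (hB (n + 1)) (hR (n + 1)) (hQ n)
    (remainderTerm_apply hħ.ne' hσ hw t ha0 n)

end Expansion


/-! ### Factorials, truncation order and summation. -/

section Estimates

theorem pow_self_le_exp_mul_factorial (n : ℕ) :
    (n : ℝ) ^ n / n.factorial ≤ Real.exp 1 ^ n := by
  rw [← Real.exp_nat_mul, mul_one]
  exact Real.pow_div_factorial_le_exp _ (by positivity) n

/-- The simplex volume compensates the `n^n` from dividing the weight, leaving a geometric bound. -/
theorem mul_pow_mul_div_factorial_le {G t : ℝ} (hG : 0 ≤ G) (ht : 0 ≤ t) (n : ℕ) :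
    (G * n) ^ n * (t ^ n / n.factorial) ≤ (G * Real.exp 1 * t) ^ n := by
  calc (G * n) ^ n * (t ^ n / n.factorial) = (G * t) ^ n * ((n : ℝ) ^ n / n.factorial) := by
        rw [mul_pow, mul_pow]; ring
    _ ≤ (G * t) ^ n * Real.exp 1 ^ n :=
        mul_le_mul_of_nonneg_left (pow_self_le_exp_mul_factorial n) (by positivity)
    _ = (G * Real.exp 1 * t) ^ n := by rw [← mul_pow]; ring

/-- Truncating at order `⌊1 / √ε⌋` makes the last term stretched-exponentially small. -/
theorem pow_floor_le_exp {K ε : ℝ} (hK : 0 ≤ K) (hε : 0 < ε) :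
    (K * ε) ^ ⌊1 / √ε⌋₊ ≤ Real.exp (1 + K * Real.exp 1) * Real.exp (-1 / √ε) := by
  have hs : 0 < √ε := Real.sqrt_pos.mpr hε
  set k := ⌊1 / √ε⌋₊ with hk
  have h1 : (k : ℝ) * √ε ≤ 1 := by
    have := Nat.floor_le (a := 1 / √ε) (by positivity)
    rwa [← hk, le_div_iff₀ hs] at this
  have h2 : 1 / √ε ≤ k + 1 := (Nat.lt_floor_add_one _).le
  -- `k! ≤ (k²)^k` and `k²ε ≤ 1` by the choice of `k`.
  have h3 : (k.factorial : ℝ) * ε ^ k ≤ 1 := by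
    have h4 : (k.factorial : ℝ) ≤ ((k : ℝ) ^ 2) ^ k := by
      have : k.factorial ≤ (k ^ 2) ^ k :=
        k.factorial_le_pow.trans (Nat.pow_le_pow_left (Nat.le_self_pow two_ne_zero k) k)
      exact_mod_cast this
    calc (k.factorial : ℝ) * ε ^ k ≤ ((k : ℝ) ^ 2) ^ k * ε ^ k := by gcongr
      _ = ((k * √ε) ^ 2) ^ k := by rw [← mul_pow, mul_pow _ (√ε), Real.sq_sqrt hε.le]
      _ ≤ 1 := pow_le_one₀ (by positivity) (pow_le_one₀ (by positivity) h1)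
  have h5 : (K * Real.exp 1) ^ k / k.factorial ≤ Real.exp (K * Real.exp 1) :=
    Real.pow_div_factorial_le_exp _ (by positivity) k
  have hf : (0 : ℝ) < k.factorial := by positivity
  -- A spare `e^k` is hidden in the bounded factor `(Ke)^k / k!`; what remains is `e^{-k}`, at most
  -- `e^{1 - 1/√ε}` since `k > 1/√ε - 1`.
  calc (K * ε) ^ k = ((K * Real.exp 1) ^ k / k.factorial) * (k.factorial * ε ^ k) *
        Real.exp (-k) := by
        rw [Real.exp_neg, mul_pow, mul_pow, ← Real.exp_nat_mul, mul_one]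
        field_simp
    _ ≤ Real.exp (K * Real.exp 1) * 1 * Real.exp (1 + -1 / √ε) := by
        gcongr
        rw [neg_div]
        linarith
    _ = _ := by rw [mul_one, ← Real.exp_add, ← Real.exp_add]; congr 1; ring

/-- `K ε` may exceed `1`, so the geometric series is unavailable. Below the truncation order
`((n+1)²ε)^n ≤ 1`, which trades `ε^n` for `1/n!`; the sum becomes exponential, and the growth `p + n
≤ p 2^n` doubles its argument. -/
theorem sum_pow_le_of_lt_floor {K ε : ℝ} (hK : 0 ≤ K) (hε : 0 < ε) {p : ℕ} (hp : 0 < p) :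
    ∑ n ∈ Finset.range ⌊1 / √ε⌋₊, (p + n : ℕ) * (K * ε) ^ (n + 1) ≤
      p * K * Real.exp (2 * K) * ε := by
  have hs : 0 < √ε := Real.sqrt_pos.mpr hε
  have h1 : ∀ n ∈ Finset.range ⌊1 / √ε⌋₊, (p + n : ℕ) * (K * ε) ^ (n + 1) ≤
      p * K * ε * ((2 * K) ^ n / n.factorial) := fun n hn => by
    have h2 : ((n + 1 : ℕ) : ℝ) * √ε ≤ 1 := by
      have := (Nat.le_floor_iff (a := 1 / √ε) (by positivity)).mp (Finset.mem_range.mp hn)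
      rwa [le_div_iff₀ hs] at this
    have h3 : (((n + 1 : ℕ) : ℝ) ^ 2) ^ n * ε ^ n ≤ 1 := by
      calc (((n + 1 : ℕ) : ℝ) ^ 2) ^ n * ε ^ n = ((((n + 1 : ℕ) : ℝ) * √ε) ^ 2) ^ n := by
            rw [← mul_pow, mul_pow _ (√ε), Real.sq_sqrt hε.le]
        _ ≤ 1 := pow_le_one₀ (by positivity) (pow_le_one₀ (by positivity) h2)
    have h4 : (p + n) * n.factorial ≤ p * 2 ^ n * ((n + 1) ^ 2) ^ n := by
      have e1 : p + n ≤ p * (n + 1) := by nlinarith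
      have e2 : n + 1 ≤ 2 ^ n := Nat.lt_two_pow_self
      have e3 : n.factorial ≤ ((n + 1) ^ 2) ^ n := n.factorial_le_pow.trans
        (Nat.pow_le_pow_left (n.le_succ.trans (Nat.le_self_pow two_ne_zero _)) n)
      exact Nat.mul_le_mul (e1.trans (Nat.mul_le_mul_left p e2)) e3
    have h5 : ((p + n : ℕ) : ℝ) * n.factorial ≤ p * 2 ^ n * (((n + 1 : ℕ) : ℝ) ^ 2) ^ n := by
      exact_mod_cast h4
    have h6 : ((p + n : ℕ) : ℝ) * n.factorial * ε ^ n ≤ p * 2 ^ n := by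
      calc ((p + n : ℕ) : ℝ) * n.factorial * ε ^ n
          ≤ p * 2 ^ n * (((n + 1 : ℕ) : ℝ) ^ 2) ^ n * ε ^ n := by gcongr
        _ = p * 2 ^ n * ((((n + 1 : ℕ) : ℝ) ^ 2) ^ n * ε ^ n) := by ring
        _ ≤ p * 2 ^ n * 1 := by gcongr
        _ = p * 2 ^ n := mul_one _
    have hf : (0 : ℝ) < n.factorial := by positivity
    calc ((p + n : ℕ) : ℝ) * (K * ε) ^ (n + 1) =
          K * ε * (K ^ n / n.factorial) * (((p + n : ℕ) : ℝ) * n.factorial * ε ^ n) := by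
          rw [mul_pow, pow_succ, pow_succ]; field_simp
      _ ≤ K * ε * (K ^ n / n.factorial) * (p * 2 ^ n) := by gcongr
      _ = p * K * ε * ((2 * K) ^ n / n.factorial) := by rw [mul_pow]; ring
  refine (Finset.sum_le_sum h1).trans ?_
  rw [← Finset.mul_sum]
  calc p * K * ε * ∑ n ∈ Finset.range ⌊1 / √ε⌋₊, (2 * K) ^ n / n.factorial
      ≤ p * K * ε * Real.exp (2 * K) := by
        gcongr
        exact Real.sum_le_exp_of_nonneg (by positivity) _
    _ = _ := by ring

theorem sum_Icc_one_eq_sum_range {M : Type*} [AddCommMonoid M] (f : ℕ → M) (k : ℕ) :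
    ∑ n ∈ Finset.Icc 1 k, f n = ∑ n ∈ Finset.range k, f (n + 1) := by
  rw [Finset.range_eq_Ico, Finset.sum_Ico_add' f 0 k 1]
  rfl

theorem IsWeylQuantization.weylBound {p : ℕ} {ħ σ : ℝ} {τ : Phase p → ℂ}
    {a : L2 (Fin p) →L[ℂ] L2 (Fin p)} (hħ : 0 < ħ) (hσ : 0 < σ) (hτ : IsSymbol σ τ)
    (ha : IsWeylQuantization ħ τ a) : WeylBound ħ σ (symbolNorm σ τ) a :=
  ⟨Phase p, inferInstance, volume, inferInstance, symbolHat τ, fun s => s,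
    ha.isWeylIntegral hħ hσ hτ, hτ.integrable_weight, le_rfl⟩

theorem growthRate_eq_mul (q σ : ℝ) (w : E3 → ℝ) :
    growthRate q σ w = 8 * q ^ 2 / σ ^ 2 * potentialNorm σ w := by
  unfold growthRate
  ring

theorem supNorm_nonneg (w : E3 → ℝ) : 0 ≤ supNorm w := lpNorm_nonneg

end Estimates


/-! ### Constants independent of `t`, `ħ` and `N`. -/

section Main

variable {p N : ℕ} {ħ σ t A : ℝ} {w : E3 → ℝ} {a : L2 (Fin p) →L[ℂ] L2 (Fin p)}

/-- `k ≥ 1` means `ε ≤ 1`, that is `t ≤ 1/‖w‖_∞`. This bounds the expansion factor of the free flow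
independently of `t`. -/
theorem one_add_le_of_one_le_floor {s : ℝ} (hs : 0 < s) (ht : 0 < t)
    (hk : 1 ≤ ⌊1 / √(s * t)⌋₊) : 1 + t ≤ 1 + 1 / s := by
  have h1 : 0 < s * t := mul_pos hs ht
  have h2 : 0 < √(s * t) := Real.sqrt_pos.mpr h1
  have h3 : (1 : ℝ) ≤ 1 / √(s * t) := by
    simpa using (Nat.le_floor_iff (a := 1 / √(s * t)) (by positivity)).mp hk
  rw [le_div_iff₀ h2, one_mul, Real.sqrt_le_one] at h3
  have h4 : t ≤ 1 / s := by rw [le_div_iff₀ hs]; linarith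
  linarith

theorem exists_expansion_floor (hp : 0 < p) (hħ : 0 < ħ) (hσ : 0 < σ) (hw : IsPotential σ w)
    (hs : 0 < supNorm w) (ht : 0 < t) (ha : WeylBound ħ σ A a) (N : ℕ) {K : ℝ}
    (hK : K = growthRate (1 + 1 / supNorm w) σ w * Real.exp 1 / supNorm w) {k : ℕ}
    (hk : k = ⌊1 / √(supNorm w * t)⌋₊) :
    ∃ B Q R : ℕ → bosonic N →L[ℂ] bosonic N,
      (∀ n, IsTimeIntegral n t (treeTerm N ħ w t a n) (B n)) ∧
      (∀ n, IsTimeIntegral (n + 1) t (loopTerm N ħ w t a n) (Q (n + 1))) ∧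
      (∀ n, IsTimeIntegral n t (remainderTerm N ħ w t a n) (R n)) ∧
      (1 ≤ k → ∀ n, ‖B n‖ ≤ (K * (supNorm w * t)) ^ n * A) ∧
      (‖∑ n ∈ Finset.range k, Q (n + 1)‖ ≤
        p * K * Real.exp (2 * K) * (supNorm w * t) * A) ∧
      (‖R k‖ ≤ 2 * ((K * (supNorm w * t)) ^ k * A)) ∧
      heisenberg (bosonFull N ħ w) t (secondQuant N p a) =
        heisenberg (bosonFree N ħ) t (secondQuant N p a) + ∑ n ∈ Finset.Icc 1 k, B n + R k +
          (1 / (N : ℂ)) • ∑ n ∈ Finset.Icc 1 k, Q n := by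
  have hA : 0 ≤ A := ha.zero_le
  have hG : 0 ≤ growthRate (1 + 1 / supNorm w) σ w := growthRate_nonneg hσ (by positivity)
  have hK0 : 0 ≤ K := by rw [hK]; positivity
  have hε : 0 < supNorm w * t := mul_pos hs ht
  rcases k.eq_zero_or_pos with h0 | h1
  -- For `k = 0` the time is unrestricted, but only the bound on `R 0` is used and it does not
  -- involve `q`, so `q = 1 + t` is allowed.
  · obtain ⟨B, Q, R, hB, hQ, hR, -, -, hR', he⟩ :=
      exists_expansion hħ hσ hw ht.le (le_refl (1 + t)) ha N
    refine ⟨B, Q, R, hB, hQ, hR, fun h => by omega, ?_, ?_, he k⟩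
    · subst h0
      rw [Finset.sum_range_zero]
      exact ContinuousLinearMap.opNorm_zero.trans_le (by positivity)
    · subst h0
      simpa using hR' 0
  · obtain ⟨B, Q, R, hB, hQ, hR, hB', hQ', hR', he⟩ :=
      exists_expansion hħ hσ hw ht.le (one_add_le_of_one_le_floor hs ht (hk ▸ h1)) ha N
    have hKε : growthRate (1 + 1 / supNorm w) σ w * Real.exp 1 * t = K * (supNorm w * t) := by
      rw [hK]
      field_simp
    have hpow : ∀ n : ℕ, (growthRate (1 + 1 / supNorm w) σ w * n) ^ n * (t ^ n / n.factorial) ≤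
        (K * (supNorm w * t)) ^ n := fun n => by
      rw [← hKε]
      exact mul_pow_mul_div_factorial_le hG ht.le n
    refine ⟨B, Q, R, hB, hQ, hR, fun _ n => (hB' n).trans ?_, ?_, (hR' k).trans ?_, he k⟩
    · rw [mul_right_comm]
      exact mul_le_mul_of_nonneg_right (hpow n) hA
    · refine (opNorm_sum_le_sum _ _).trans ?_
      have hQn : ∀ n ∈ Finset.range k, ‖Q (n + 1)‖ ≤
          ((p + n : ℕ) * (K * (supNorm w * t)) ^ (n + 1)) * A := fun n _ => by
        refine (hQ' n).trans ?_
        rw [mul_assoc, mul_assoc _ _ A, mul_right_comm _ A]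
        exact mul_le_mul_of_nonneg_left (mul_le_mul_of_nonneg_right (hpow (n + 1)) hA)
          (by positivity)
      refine (Finset.sum_le_sum hQn).trans ?_
      rw [← Finset.sum_mul, hk]
      exact mul_le_mul_of_nonneg_right (sum_pow_le_of_lt_floor hK0 hε hp) hA
    · rw [mul_assoc, mul_right_comm]
      exact mul_le_mul_of_nonneg_left (mul_le_mul_of_nonneg_right (hpow k) hA) two_pos.le

end Main

end
end MeanField

theorem proposition2p5 (p : ℕ) (hp : 0 < p) (σ : ℝ) (hσ : 0 < σ) (w : E3 → ℝ)
    (hw : IsPotential σ w) :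
    ∃ M₁ L₁ M₂ M₃ L₃ : ℝ, 0 < M₁ ∧ 0 < L₁ ∧ 0 < M₂ ∧ 0 < M₃ ∧ 0 < L₃ ∧
      ∀ (ħ t ε : ℝ) (k N : ℕ) (τ : Phase p → ℂ) (a : L2 (Fin p) →L[ℂ] L2 (Fin p)),
        0 < ħ → ε = supNorm w * t → 0 < ε → k = ⌊1 / √ε⌋₊ → p ≤ N →
        IsSymbol σ τ → IsWeylQuantization ħ τ a →
        ∃ (B Q : ℕ → bosonic N →L[ℂ] bosonic N) (R Λ : bosonic N →L[ℂ] bosonic N),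
          (∀ n ∈ Finset.Icc 1 k, IsTimeIntegral n t (treeTerm N ħ w t a n) (B n)) ∧
          (∀ n < k, IsTimeIntegral (n + 1) t (loopTerm N ħ w t a n) (Q (n + 1))) ∧
          IsTimeIntegral k t (remainderTerm N ħ w t a k) R ∧
          Λ = ∑ n ∈ Finset.Icc 1 k, Q n ∧
          heisenberg (bosonFull N ħ w) t (secondQuant N p a) =
            heisenberg (bosonFree N ħ) t (secondQuant N p a) +
              ∑ n ∈ Finset.Icc 1 k, B n + R + (1 / (N : ℂ)) • Λ ∧
          ‖∑ n ∈ Finset.Icc 1 k, B n‖ ≤ M₁ * symbolNorm σ τ *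
            ∑ n ∈ Finset.Icc 1 k, L₁ ^ n * (n.factorial : ℝ) ^ 2 * (potentialNorm σ w * t) ^ n ∧
          ‖R‖ ≤ M₃ * symbolNorm σ τ * Real.exp (-L₃ / √ε) ∧
          (1 ≤ k → ‖B k‖ ≤ M₃ * symbolNorm σ τ * Real.exp (-L₃ / √ε)) ∧
          ‖Λ‖ ≤ M₂ * symbolNorm σ τ * ε := by
  set c := supNorm w with hc
  have hc0 : 0 ≤ c := supNorm_nonneg w
  -- Chosen so that `K ε = D ‖w‖_σ t`, with `‖w‖_σ` factored out. If `c = 0` then `1 / c = 0` and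
  -- `D` is still positive; that case is excluded later by `ε > 0`.
  set D := 8 * (1 + 1 / c) ^ 2 / σ ^ 2 * Real.exp 1 with hD
  have hD0 : 0 < D := by positivity
  set K := growthRate (1 + 1 / c) σ w * Real.exp 1 / c with hK
  have hG : 0 ≤ growthRate (1 + 1 / c) σ w := growthRate_nonneg hσ (by positivity)
  have hK0 : 0 ≤ K := by positivity
  -- The summand `1` only secures positivity, as `K ≥ 0` is all that is known. The factor `2` in
  -- `M₃` counts the two terms of the remainder.
  refine ⟨1, D, p * K * Real.exp (2 * K) + 1, 2 * Real.exp (1 + K * Real.exp 1), 1, one_pos, hD0,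
    by positivity, by positivity, one_pos, ?_⟩
  rintro ħ t ε k N τ a hħ rfl hε hk - hτ ha
  have hs : 0 < c := hc0.lt_of_ne fun h => by rw [← h, zero_mul] at hε; exact hε.false
  have ht : 0 < t := pos_of_mul_pos_right hε hs.le
  have hb := ha.weylBound hħ hσ hτ
  set A := symbolNorm σ τ with hA
  have hA0 : 0 ≤ A := hb.zero_le
  obtain ⟨B, Q, R, hB, hQ, hR, hB', hQ', hR', he⟩ :=
    exists_expansion_floor hp hħ hσ hw hs ht hb N hK hk
  have hexp : (K * (c * t)) ^ k ≤ Real.exp (1 + K * Real.exp 1) * Real.exp (-1 / √(c * t)) :=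
    hk ▸ pow_floor_le_exp hK0 hε
  refine ⟨B, Q, R k, ∑ n ∈ Finset.Icc 1 k, Q n, fun n _ => hB n, fun n _ => hQ n, hR k, rfl, he,
    ?_, ?_, fun h1 => ?_, ?_⟩
  · have hD' : K * (c * t) = D * (potentialNorm σ w * t) := by
      rw [hK, hD, growthRate_eq_mul]
      field_simp
    refine (opNorm_sum_le_sum _ _).trans ?_
    rw [one_mul, Finset.mul_sum]
    refine Finset.sum_le_sum fun n hn => ?_
    rw [Finset.mem_Icc] at hn
    refine (hB' (hn.1.trans hn.2) n).trans ?_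
    have hW := potentialNorm_nonneg σ w
    -- The geometric bound on `B n` is stronger than required; `n!²` only weakens it.
    have hf : (1 : ℝ) ≤ (n.factorial : ℝ) ^ 2 :=
      one_le_pow₀ (by exact_mod_cast n.factorial_pos)
    rw [hD', mul_pow, mul_comm]
    refine mul_le_mul_of_nonneg_left (mul_le_mul_of_nonneg_right ?_ (by positivity)) hA0
    exact le_mul_of_one_le_right (by positivity) hf
  · refine hR'.trans ?_
    calc 2 * ((K * (c * t)) ^ k * A)
        ≤ 2 * (Real.exp (1 + K * Real.exp 1) * Real.exp (-1 / √(c * t)) * A) := by gcongr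
      _ = _ := by ring
  · refine (hB' h1 k).trans ?_
    calc (K * (c * t)) ^ k * A
        ≤ 2 * (Real.exp (1 + K * Real.exp 1) * Real.exp (-1 / √(c * t)) * A) := by
          refine (mul_le_mul_of_nonneg_right hexp hA0).trans ?_
          exact le_mul_of_one_le_left (by positivity) one_le_two
      _ = _ := by ring
  · rw [sum_Icc_one_eq_sum_range]
    refine hQ'.trans ?_
    rw [mul_right_comm]
    refine mul_le_mul_of_nonneg_right (mul_le_mul_of_nonneg_right ?_ hA0) hε.le
    linarith
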